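/- Let $n\ge 2$ and $N\ge 1$ be integers, $G=GL(n,\mathbb R)$, and let $w=w_{\rm long}\in G$ be the antidiagonal permutation matrix. Let $P\subset G$ (resp. $\widetilde P\subset G$) be the subgroup of matrices $p=\begin{pmatrix}a&0\\ *&B\end{pmatrix}$ with first row $(a,0,\dots,0)$ (resp. $p=\begin{pmatrix}B&0\\ *&a\end{pmatrix}$ with last column $(0,\dots,0,a)^t$), where $a\in\mathbb R^*$ and $B\in GL(n-1,\mathbb R)$. For $\nu\in\mathbb C$, $\varepsilon\in\mathbb Z/2\mathbb Z$ put $$\chi_{\nu,\varepsilon}(p)=|a|^{(n-1)\nu/n}(\operatorname{sgn}a)^\varepsilon|\det B|^{-\nu/n}\ \ (p\in P),\qquad \widetilde\chi_{\nu,\varepsilon}(p)=|\det B|^{\nu/n}|a|^{-(n-1)\nu/n}(\operatorname{sgn}a)^\varepsilon\ \ (p\in\widetilde P),$$ and let $W^\infty_{\nu,\varepsilon}=\{f\in C^\infty(G): f(gp)=\chi_{\nu-n/2,\varepsilon}(p^{-1})f(g),\ g\in G,\ p\in P\}$, with its $C^\infty$ topology; define $\widetilde W^\infty_{\nu,\varepsilon}$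 in the same way from $\widetilde P$, $\widetilde\chi$. These are the smooth sections of line bundles over $G/P$ and $G/\widetilde P$. The corresponding spaces of distribution sections $W^{-\infty}_{\nu,\varepsilon}$, $\widetilde W^{-\infty}_{\nu,\varepsilon}$ are the strong duals of $W^\infty_{-\nu,\varepsilon}$, $\widetilde W^\infty_{-\nu,\varepsilon}$ (a function $f$ acts by $h\mapsto\int f(u)h(u)\,du$ over the open cell). $G$ acts by left translation $\ell$. Let $\delta_e$ denote evaluation at $e\in G$, and let $\delta_\infty=\ell(w)\delta_e\in W^{-\infty}_{\nu,\varepsilon}$ and $\delta_{\widetilde\infty}=\ell(w)\delta_e\in\widetilde W^{-\infty}_{\nu,\varepsilon}$. Let $\Gamma=\Gamma_0(N)\subset GL(n,\mathbb Z)$ be the subgroup of matrices with last row $\equiv(0,\dots,0,*)$ mod $N$, $\widetilde\Gamma=\widetilde\Gamma_0(N)$ the subgroup of matrices with first column $\equiv(*,0,\dots,0)^t$ mod $N$, $\Gamma_\infty=\Gamma\cap wPw$, $\widetilde\Gamma_{\widetilde\infty}=\widetilde\Gamma\cap w\widetilde Pw$. Let $\psi$ be a Dirichlet character modulo $N$ and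 choose $\varepsilon$ with $\psi(-1)=(-1)^\varepsilon$. Put $\alpha(\gamma)=\psi(\gamma_{nn})^{-1}$ on $\Gamma$, $\widetilde\alpha(\gamma)=\psi(\gamma_{11})$ on $\widetilde\Gamma$, and for $\operatorname{Re}\nu>n/2$ define $$E_{\nu,\psi}=L(\nu+\tfrac n2,\psi)\sum_{\gamma\in\Gamma/\Gamma_\infty}\alpha(\gamma)\,\ell(\gamma)\delta_\infty\in W^{-\infty}_{\nu,\varepsilon},\qquad \widetilde E_{\nu,\psi}=L(\nu+\tfrac n2,\psi)\sum_{\gamma\in\widetilde\Gamma/\widetilde\Gamma_{\widetilde\infty}}\widetilde\alpha(\gamma)\,\ell(\gamma)\delta_{\widetilde\infty}\in\widetilde W^{-\infty}_{\nu,\varepsilon}.$$ Write $e(z)=e^{2\pi iz}$ and $\widehat\psi(m)=\sum_{a\bmod N}\psi(a)e(am/N)$. For $u\in\mathbb R^{n-1}$ let $r(u)\in G$ be the matrix with first row $(1,u_{n-1},\dots,u_1)$ and the other rows those of the identity, and let $c(u)\in G$ be the matrix with last column $(u_1,\dots,u_{n-1},1)^t$ and the other columns those of the identity; $u\mapsto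 r(u)P$ and $u\mapsto c(u)\widetilde P$ are coordinates on the open cells $U\subset G/P$, $\widetilde U\subset G/\widetilde P$. A distribution section restricts to a distribution in $u\in\mathbb R^{n-1}$ by pairing it with the sections obtained by extending test functions by zero from the cell. (1) Let $\operatorname{Re}\nu>n/2$. Both series converge in the strong topology. As distributions in $u\in\mathbb R^{n-1}$, $$\begin{aligned}E_{\nu,\psi}(r(-u))=\widetilde E_{\nu,\psi}(c(u))&=\sum_{\substack{v\in\mathbb Z^n,\ v_1>0\\ N\mid v_1,\dots,v_{n-1}}}\psi(v_n)\,v_1^{-\nu-n/2}\,\delta_{v_n/v_1}(u_1)\,\delta_{v_{n-1}/v_1}(u_2)\cdots\delta_{v_2/v_1}(u_{n-1})\\&=N^{-\nu-n/2}\sum_{v\in\mathbb Z^n,\ v_1>0}v_1^{-\nu-n/2+1}\,e(v_1v_nu_1)\,\delta_{v_{n-1}/v_1}(u_2)\cdots\delta_{v_2/v_1}(u_{n-1})\,\widehat\psi(-v_n)\\&=\sum_{r\in\mathbb Z^{n-1}}a_r\,e(r_1u_1+\dots+r_{n-1}u_{n-1}),\qquad a_r=N^{-\nu-n/2}\sum_{\substack{d>0\\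 d\mid r_1,\dots,r_{n-1}}}d^{-\nu+n/2-1}\,\widehat\psi(-r_1/d),\end{aligned}$$ and $$\begin{aligned}(\ell(w)E_{\nu,\psi})(r(u))=(\ell(w)\widetilde E_{\nu,\psi})(c(u))&=\sum_{\substack{v\in\mathbb Z^n,\ v_n>0\\ N\mid v_1,\dots,v_{n-1}}}\psi(v_n)\,v_n^{-\nu-n/2}\,\delta_{v_1/v_n}(u_1)\cdots\delta_{v_{n-1}/v_n}(u_{n-1})\\&=\sum_{r\in\mathbb Z^{n-1}}c_r\,e\!\left(\tfrac{r_1u_1+\dots+r_{n-1}u_{n-1}}N\right),\qquad c_r=\frac1{N^{n-1}}\sum_{\substack{d>0\\ d\mid r_1,\dots,r_{n-1}}}\psi(d)\,d^{-\nu+n/2-1}.\end{aligned}$$ (2) The distributions in (1), and both $E_{\nu,\psi}$ and $\widetilde E_{\nu,\psi}$, continue holomorphically in $\nu$ to $\mathbb C\setminus\{n/2\}$. They are entire if $\psi$ is nontrivial (i.e. not the principal character modulo $N$), and have a simple pole at $\nu=n/2$ if $\psi$ is trivial. Here holomorphy of a family of distribution sections means holomorphy of its pairing with every family of smooth sections $h_\nu$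 (in $W^\infty_{-\nu,\varepsilon}$, resp. $\widetilde W^\infty_{-\nu,\varepsilon}$) whose restriction to $O(n)$ is independent of $\nu$. -/

import Mathlib

open scoped MatrixGroups Distributions ContDiff Topology

noncomputable section

namespace MirabolicEisenstein

/-! ### Smooth functions on `GL(n, ℝ)` -/

/-- A function on `GL(n, ℝ)`, extended by zero to all `n × n` arrays of real numbers. -/
def zeroExt {n : ℕ} (f : GL (Fin n) ℝ → ℂ) (A : Fin n → Fin n → ℝ) : ℂ :=
  open Classical in
  if h : (Matrix.of A).det ≠ 0 then
    f (Matrix.GeneralLinearGroup.mkOfDetNeZero (Matrix.of A) h) else 0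

/-- The open set of invertible matrices in the space of all `n × n` arrays. -/
def invertibleSet (n : ℕ) : Set (Fin n → Fin n → ℝ) := {A | (Matrix.of A).det ≠ 0}

/-- `f ∈ C^∞(G)` for `G = GL(n, ℝ)`, an open subset of `ℝ^{n × n}`. -/
def IsSmooth {n : ℕ} (f : GL (Fin n) ℝ → ℂ) : Prop :=
  ContDiffOn ℝ ∞ (zeroExt f) (invertibleSet n)

theorem zeroExt_coe {n : ℕ} (f : GL (Fin n) ℝ → ℂ) (g : GL (Fin n) ℝ) :
    zeroExt f (fun i j => g i j) = f g := by
  have h : (Matrix.of (fun i j => g i j)).det ≠ 0 := by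
    have := (Matrix.isUnit_iff_isUnit_det _).1 g.isUnit
    exact this.ne_zero
  unfold zeroExt
  rw [dif_pos h]
  congr 1
  ext i j
  rfl

theorem contDiff_det {n : ℕ} {E : Type*} [NormedAddCommGroup E] [NormedSpace ℝ E]
    {M : E → Matrix (Fin n) (Fin n) ℝ} (hM : ∀ i j, ContDiff ℝ ∞ (fun x => M x i j)) :
    ContDiff ℝ ∞ (fun x => (M x).det) := by
  simp only [Matrix.det_apply]
  refine ContDiff.sum fun σ _ => ?_
  refine ContDiff.const_smul _ ?_
  exact contDiff_prod fun i _ => hM _ _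

theorem contDiff_entry {n : ℕ} (i j : Fin n) :
    ContDiff ℝ ∞ (fun A : Fin n → Fin n → ℝ => A i j) := by fun_prop

theorem isOpen_invertibleSet (n : ℕ) : IsOpen (invertibleSet n) :=
  isOpen_ne_fun
    (contDiff_det (M := fun A : Fin n → Fin n → ℝ => Matrix.of A)
      (fun i j => contDiff_entry i j)).continuous continuous_const

theorem IsSmooth.contDiffAt {n : ℕ} {f : GL (Fin n) ℝ → ℂ} (hf : IsSmooth f)
    {A : Fin n → Fin n → ℝ} (hA : A ∈ invertibleSet n) : ContDiffAt ℝ ∞ (zeroExt f) A :=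
  ContDiffOn.contDiffAt hf ((isOpen_invertibleSet n).mem_nhds hA)

/-! ### Smooth sections of equivariant line bundles on `G / Q` -/

/-- For a subgroup `Q ⊆ G = GL(n, ℝ)` and a character `χ` of `Q`, the space
`{f ∈ C^∞(G) | f(g q) = χ(q⁻¹) f(g) for g ∈ G, q ∈ Q}`, as a space of functions.
Only the values of `χ` on `Q` matter. -/
def sectionSubmodule {n : ℕ} (Q : Subgroup (GL (Fin n) ℝ)) (χ : GL (Fin n) ℝ → ℂ) :
    Submodule ℂ (GL (Fin n) ℝ → ℂ) where
  carrier := {f | IsSmooth f ∧ ∀ g, ∀ q ∈ Q, f (g * q) = χ q⁻¹ * f g}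
  zero_mem' := by
    refine ⟨?_, by simp⟩
    have : zeroExt (0 : GL (Fin n) ℝ → ℂ) = fun _ => 0 := by
      funext A; unfold zeroExt; split_ifs <;> rfl
    unfold IsSmooth; rw [this]; exact contDiffOn_const
  add_mem' := by
    rintro f g ⟨hf, hf'⟩ ⟨hg, hg'⟩
    refine ⟨?_, fun x q hq => by simp [hf' x q hq, hg' x q hq, mul_add]⟩
    have : zeroExt (f + g) = fun A => zeroExt f A + zeroExt g A := by
      funext A; unfold zeroExt; split_ifs <;> simp
    unfold IsSmooth; rw [this]; exact ContDiffOn.add hf hg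
  smul_mem' := by
    rintro c f ⟨hf, hf'⟩
    refine ⟨?_, fun x q hq => by simp [hf' x q hq]; ring⟩
    have : zeroExt (c • f) = fun A => c • zeroExt f A := by
      funext A; unfold zeroExt; split_ifs <;> simp
    unfold IsSmooth; rw [this]; exact ContDiffOn.const_smul c hf

/-- The space of smooth sections, as a type of its own: it carries the `C^∞` topology below and not
the topology of pointwise convergence. -/
def SmoothSection {n : ℕ} (Q : Subgroup (GL (Fin n) ℝ)) (χ : GL (Fin n) ℝ → ℂ) : Type :=
  ↥(sectionSubmodule Q χ)

namespace SmoothSection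

variable {n : ℕ} {Q : Subgroup (GL (Fin n) ℝ)} {χ : GL (Fin n) ℝ → ℂ}

instance : AddCommGroup (SmoothSection Q χ) :=
  inferInstanceAs (AddCommGroup ↥(sectionSubmodule Q χ))

instance : Module ℂ (SmoothSection Q χ) :=
  inferInstanceAs (Module ℂ ↥(sectionSubmodule Q χ))

instance : FunLike (SmoothSection Q χ) (GL (Fin n) ℝ) ℂ where
  coe f := f.1
  coe_injective := fun _ _ h => Subtype.ext h

theorem smooth (f : SmoothSection Q χ) : IsSmooth (f : GL (Fin n) ℝ → ℂ) := f.2.1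

theorem equivariant (f : SmoothSection Q χ) (g : GL (Fin n) ℝ) {q : GL (Fin n) ℝ} (hq : q ∈ Q) :
    f (g * q) = χ q⁻¹ * f g := f.2.2 g q hq

theorem zeroExt_add (f g : SmoothSection Q χ) :
    zeroExt (f + g : SmoothSection Q χ) = zeroExt f + zeroExt g := by
  funext A
  change zeroExt (fun x => f x + g x) A = zeroExt f A + zeroExt g A
  unfold zeroExt; split_ifs <;> simp

theorem zeroExt_smul (c : ℂ) (f : SmoothSection Q χ) :
    zeroExt (c • f : SmoothSection Q χ) = c • zeroExt f := by
  funext A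
  change zeroExt (fun x => c * f x) A = c * zeroExt f A
  unfold zeroExt; split_ifs <;> simp

variable (Q χ) in
/-- All iterated derivatives of a smooth section, as continuous functions on `G`. -/
def jets : SmoothSection Q χ →ₗ[ℂ]
    ((m : ℕ) → C(invertibleSet n, (Fin n → Fin n → ℝ) [×m]→L[ℝ] ℂ)) where
  toFun f m :=
    { toFun := fun A => iteratedFDeriv ℝ m (zeroExt f) A
      continuous_toFun := by
        rw [continuous_iff_continuousAt]
        intro A
        have h := (f.smooth.contDiffAt A.2).iteratedFDeriv_right (m := 0) (i := m) (by
          simp only [zero_add]; exact_mod_cast le_top)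
        exact h.continuousAt.comp continuousAt_subtype_val }
  map_add' f g := by
    funext m; ext1 A
    change iteratedFDeriv ℝ m (zeroExt (f + g : SmoothSection Q χ)) A = _
    rw [zeroExt_add, iteratedFDeriv_add_apply]
    · rfl
    · exact (f.smooth.contDiffAt A.2).of_le (by exact_mod_cast le_top)
    · exact (g.smooth.contDiffAt A.2).of_le (by exact_mod_cast le_top)
  map_smul' c f := by
    funext m; ext1 A
    change iteratedFDeriv ℝ m (zeroExt (c • f : SmoothSection Q χ)) A = _
    rw [zeroExt_smul, iteratedFDeriv_const_smul_apply]
    · rfl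
    · exact (f.smooth.contDiffAt A.2).of_le (by exact_mod_cast le_top)

/-- The `C^∞` topology: uniform convergence of every derivative on compact subsets of `G`. -/
instance : TopologicalSpace (SmoothSection Q χ) :=
  TopologicalSpace.induced (jets Q χ) inferInstance

instance : IsTopologicalAddGroup (SmoothSection Q χ) :=
  topologicalAddGroup_induced (jets Q χ)

instance : ContinuousSMul ℂ (SmoothSection Q χ) :=
  continuousSMul_induced (jets Q χ)

theorem continuous_jet (m : ℕ) : Continuous fun f : SmoothSection Q χ => jets Q χ f m :=
  (continuous_apply m).comp continuous_induced_dom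

variable (Q χ) in
/-- Evaluation of smooth sections at `g ∈ G`. -/
def evalAt (g : GL (Fin n) ℝ) : SmoothSection Q χ →L[ℂ] ℂ where
  toFun f := f g
  map_add' _ _ := rfl
  map_smul' _ _ := rfl
  cont := by
    have hg : (fun i j => g i j) ∈ invertibleSet n :=
      ((Matrix.isUnit_iff_isUnit_det _).1 g.isUnit).ne_zero
    have h1 : Continuous fun f : SmoothSection Q χ => jets Q χ f 0 ⟨_, hg⟩ 0 :=
      ((ContinuousMultilinearMap.apply ℝ (fun _ : Fin 0 => (Fin n → Fin n → ℝ)) ℂ 0).continuous).comp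
        ((continuous_eval_const _).comp (continuous_jet 0))
    convert h1 using 1
    funext f
    change f g = iteratedFDeriv ℝ 0 (zeroExt f) (fun i j => g i j) 0
    rw [iteratedFDeriv_zero_apply, zeroExt_coe]

/-- Left multiplication by `g` on the space of arrays. -/
def leftMul (g : GL (Fin n) ℝ) : (Fin n → Fin n → ℝ) ≃L[ℝ] (Fin n → Fin n → ℝ) :=
  LinearEquiv.toContinuousLinearEquiv
    { toFun := fun A i j => (g.1 * Matrix.of A) i j
      invFun := fun A i j => (g⁻¹.1 * Matrix.of A) i j
      map_add' := fun A B => by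
        funext i j; simp [Matrix.mul_apply, mul_add, Finset.sum_add_distrib]
      map_smul' := fun c A => by
        funext i j; simp [Matrix.mul_apply, Finset.mul_sum, mul_left_comm]
      left_inv := fun A => by
        funext i j
        change (g⁻¹.1 * (g.1 * Matrix.of A)) i j = A i j
        rw [← mul_assoc, Units.inv_mul, one_mul]; rfl
      right_inv := fun A => by
        funext i j
        change (g.1 * (g⁻¹.1 * Matrix.of A)) i j = A i j
        rw [← mul_assoc, Units.mul_inv, one_mul]; rfl }

theorem leftMul_mem (g : GL (Fin n) ℝ) {A : Fin n → Fin n → ℝ} (hA : A ∈ invertibleSet n) :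
    leftMul g A ∈ invertibleSet n := by
  change (g.1 * Matrix.of A).det ≠ 0
  rw [Matrix.det_mul]
  exact mul_ne_zero ((Matrix.isUnit_iff_isUnit_det _).1 g.isUnit).ne_zero hA

theorem zeroExt_translate (f : GL (Fin n) ℝ → ℂ) (g : GL (Fin n) ℝ) :
    zeroExt (fun x => f (g * x)) = zeroExt f ∘ leftMul g := by
  funext A
  by_cases hA : (Matrix.of A).det ≠ 0
  · have h2 : (Matrix.of (leftMul g A)).det ≠ 0 := leftMul_mem g hA
    simp only [zeroExt, Function.comp]
    rw [dif_pos hA, dif_pos h2]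
    congr 1
    ext i j
    rfl
  · have h2 : ¬ (Matrix.of (leftMul g A)).det ≠ 0 := by
      intro h
      change (g.1 * Matrix.of A).det ≠ 0 at h
      rw [Matrix.det_mul] at h
      exact hA (right_ne_zero_of_mul h)
    simp only [zeroExt, Function.comp]
    rw [dif_neg hA, dif_neg h2]

theorem isSmooth_translate {f : GL (Fin n) ℝ → ℂ} (hf : IsSmooth f) (g : GL (Fin n) ℝ) :
    IsSmooth fun x => f (g * x) := by
  unfold IsSmooth at hf ⊢
  rw [zeroExt_translate]
  exact hf.comp (leftMul g).contDiff.contDiffOn (fun A hA => leftMul_mem _ hA)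

/-- Left translation `(ℓ(g) f)(x) = f(g⁻¹ x)` of smooth sections. -/
def translate (g : GL (Fin n) ℝ) : SmoothSection Q χ →L[ℂ] SmoothSection Q χ where
  toFun f := ⟨fun x => f (g⁻¹ * x), isSmooth_translate f.smooth g⁻¹, fun x q hq => by
    change f (g⁻¹ * (x * q)) = _
    rw [← mul_assoc]; exact f.equivariant _ hq⟩
  map_add' _ _ := rfl
  map_smul' _ _ := rfl
  cont := by
    refine continuous_induced_rng.2 (continuous_pi fun m => ?_)
    let L := leftMul (n := n) g⁻¹
    let c : C(invertibleSet n, invertibleSet n) :=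
      ⟨fun A => ⟨L A, leftMul_mem _ A.2⟩, by
        exact (L.continuous.comp continuous_subtype_val).subtype_mk _⟩
    let p := ContinuousMultilinearMap.compContinuousLinearMapL (𝕜 := ℝ) (F := ℂ)
      (fun _ : Fin m => (L : (Fin n → Fin n → ℝ) →L[ℝ] (Fin n → Fin n → ℝ)))
    have h : Continuous fun f : SmoothSection Q χ =>
        (ContinuousMap.mk p p.continuous).comp ((jets Q χ f m).comp c) :=
      (ContinuousMap.continuous_postcomp _).comp
        ((ContinuousMap.continuous_precomp c).comp (continuous_jet m))
    convert h using 1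
    funext f
    ext1 A
    change iteratedFDeriv ℝ m (zeroExt (fun x => f (g⁻¹ * x))) A =
      (iteratedFDeriv ℝ m (zeroExt f) (L A)).compContinuousLinearMap fun _ => (L : _ →L[ℝ] _)
    rw [zeroExt_translate]
    simpa only [iteratedFDerivWithin_univ, Set.preimage_univ] using
      L.iteratedFDerivWithin_comp_right (zeroExt f) uniqueDiffOn_univ (x := (A : _ → _ → ℝ))
        (Set.mem_univ _) m

end SmoothSection

/-! ### Distributions, translation, Dirac distributions, families -/

section Distributions

variable {n : ℕ} {Q : Subgroup (GL (Fin n) ℝ)}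

/-- Left translation of distribution vectors: `⟨ℓ(g) T, f⟩ = ⟨T, ℓ(g⁻¹) f⟩`. -/
def ell {χ : GL (Fin n) ℝ → ℂ} (g : GL (Fin n) ℝ) (T : SmoothSection Q χ →L[ℂ] ℂ) :
    SmoothSection Q χ →L[ℂ] ℂ :=
  T.comp (SmoothSection.translate g⁻¹)

/-- Test functions on `ℝ^k`. -/
abbrev Test (k : ℕ) : Type := 𝓓((⊤ : TopologicalSpace.Opens (Fin k → ℝ)), ℂ)

/-- The section `f` is the extension by zero of the test function `φ` on the open cell
`{u(x) Q | x ∈ ℝ^k} ⊆ G / Q`, with respect to the coordinates `x ↦ u(x)`. -/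
def IsCellExtension {k : ℕ} {χ : GL (Fin n) ℝ → ℂ} (u : (Fin k → ℝ) → GL (Fin n) ℝ) (φ : Test k)
    (f : SmoothSection Q χ) : Prop :=
  (∀ x, f (u x) = φ x) ∧ ∀ g, (∀ x, (u x)⁻¹ * g ∉ Q) → f g = 0

open Classical in
/-- The section which is the extension by zero of `φ` from the cell. For each of the cells used
below it exists, by `exists_rowExtension`, `exists_rowExtension_neg` and `exists_colExtension`, and
it is determined by its equivariance. -/
def cellExtension {k : ℕ} {χ : GL (Fin n) ℝ → ℂ} (u : (Fin k → ℝ) → GL (Fin n) ℝ) (φ : Test k) :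
    SmoothSection Q χ :=
  if h : ∃ f : SmoothSection Q χ, IsCellExtension u φ f then h.choose else 0

/-- The restriction of a distribution vector to the open cell, as a functional on the test
functions in the coordinates `x ↦ u(x)`. -/
def restrict {k : ℕ} {χ : GL (Fin n) ℝ → ℂ} (u : (Fin k → ℝ) → GL (Fin n) ℝ)
    (T : SmoothSection Q χ →L[ℂ] ℂ) (φ : Test k) : ℂ :=
  T (cellExtension u φ)

/-- A family of sections `h_ν` is flat if its restriction to the maximal compact subgroup `O(n)` does
not depend on `ν`. -/
def IsFlat {χ : ℂ → GL (Fin n) ℝ → ℂ} (h : (ν : ℂ) → SmoothSection Q (χ ν)) : Prop :=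
  ∀ ν ν' (g : GL (Fin n) ℝ), g.1 ∈ Matrix.orthogonalGroup (Fin n) ℝ → h ν g = h ν' g

/-- Holomorphic dependence on `ν ∈ S` of a family of distribution vectors: the pairing with every
flat family of smooth sections is holomorphic on `S`. -/
def IsHolomorphicFamily {χ : ℂ → GL (Fin n) ℝ → ℂ} (S : Set ℂ)
    (T : (ν : ℂ) → SmoothSection Q (χ ν) →L[ℂ] ℂ) : Prop :=
  ∀ h : (ν : ℂ) → SmoothSection Q (χ ν), IsFlat h → DifferentiableOn ℂ (fun ν => T ν (h ν)) S

/-- Holomorphic dependence on `ν ∈ S` of the restrictions to the cell of a family of distribution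
vectors. -/
def IsHolomorphicOnCell {k : ℕ} {χ : ℂ → GL (Fin n) ℝ → ℂ} (S : Set ℂ)
    (u : (Fin k → ℝ) → GL (Fin n) ℝ) (T : (ν : ℂ) → SmoothSection Q (χ ν) →L[ℂ] ℂ) : Prop :=
  ∀ φ : Test k, DifferentiableOn ℂ (fun ν => restrict u (T ν) φ) S

/-- The non-zero distribution vector `R` is the residue of the family `T` at `ν₀`, in the sense that
`(ν - ν₀) T_ν` tends to `R` as `ν → ν₀`. -/
def HasSimplePole {χ : ℂ → GL (Fin n) ℝ → ℂ} (ν₀ : ℂ)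
    (T : (ν : ℂ) → SmoothSection Q (χ ν) →L[ℂ] ℂ) (R : SmoothSection Q (χ ν₀) →L[ℂ] ℂ) : Prop :=
  R ≠ 0 ∧ ∀ h : (ν : ℂ) → SmoothSection Q (χ ν), IsFlat h →
    Filter.Tendsto (fun ν => (ν - ν₀) * T ν (h ν)) (𝓝[≠] ν₀) (𝓝 (R (h ν₀)))

/-- The same for the restrictions to a cell. -/
def HasSimplePoleOnCell {k : ℕ} {χ : ℂ → GL (Fin n) ℝ → ℂ} (ν₀ : ℂ)
    (u : (Fin k → ℝ) → GL (Fin n) ℝ) (T : (ν : ℂ) → SmoothSection Q (χ ν) →L[ℂ] ℂ)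
    (R : SmoothSection Q (χ ν₀) →L[ℂ] ℂ) : Prop :=
  (∃ φ : Test k, restrict u R φ ≠ 0) ∧ ∀ φ : Test k,
    Filter.Tendsto (fun ν => (ν - ν₀) * restrict u (T ν) φ) (𝓝[≠] ν₀) (𝓝 (restrict u R φ))

end Distributions

/-! ### The mirabolic subgroups, their characters and the open cells; `n = k + 1` -/

/-- The matrices in `GL(n, R)` whose `i`-th row vanishes off the diagonal. -/
def rowSubgroup {n : ℕ} (R : Type*) [CommRing R] (i : Fin n) : Subgroup (GL (Fin n) R) where
  carrier := {g | ∀ j, j ≠ i → g i j = 0}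
  one_mem' := fun j hj => by simp [Matrix.one_apply_ne hj.symm]
  mul_mem' := by
    intro a b ha hb j hj
    change (a.1 * b.1) i j = 0
    rw [Matrix.mul_apply]
    refine Finset.sum_eq_zero fun l _ => ?_
    by_cases hl : l = i
    · subst hl
      have := hb j hj
      simp [this]
    · have := ha l hl
      simp [this]
  inv_mem' := by
    intro a ha j hj
    have key : ∀ j, a i i * a⁻¹.1 i j = (1 : Matrix (Fin n) (Fin n) R) i j := by
      intro j
      rw [← Units.mul_inv a, Matrix.mul_apply, Finset.sum_eq_single i]
      · intro l _ hl
        have := ha l hl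
        simp [this]
      · simp
    have h1 := key i
    have h2 := key j
    rw [Matrix.one_apply_eq] at h1
    rw [Matrix.one_apply_ne hj.symm] at h2
    calc a⁻¹.1 i j = (a i i * a⁻¹.1 i i) * a⁻¹.1 i j := by rw [h1, one_mul]
      _ = a⁻¹.1 i i * (a i i * a⁻¹.1 i j) := by ring
      _ = 0 := by rw [h2, mul_zero]

/-- The matrices in `GL(n, R)` whose `i`-th column vanishes off the diagonal. -/
def colSubgroup {n : ℕ} (R : Type*) [CommRing R] (i : Fin n) : Subgroup (GL (Fin n) R) where
  carrier := {g | ∀ j, j ≠ i → g j i = 0}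
  one_mem' := fun j hj => by simp [Matrix.one_apply_ne hj]
  mul_mem' := by
    intro a b ha hb j hj
    change (a.1 * b.1) j i = 0
    rw [Matrix.mul_apply]
    refine Finset.sum_eq_zero fun l _ => ?_
    by_cases hl : l = i
    · subst hl
      have := ha j hj
      simp [this]
    · have := hb l hl
      simp [this]
  inv_mem' := by
    intro a ha j hj
    have key : ∀ j, a⁻¹.1 j i * a i i = (1 : Matrix (Fin n) (Fin n) R) j i := by
      intro j
      rw [← Units.inv_mul a, Matrix.mul_apply, Finset.sum_eq_single i]
      · intro l _ hl
        have := ha l hl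
        simp [this]
      · simp
    have h1 := key i
    have h2 := key j
    rw [Matrix.one_apply_eq] at h1
    rw [Matrix.one_apply_ne hj] at h2
    calc a⁻¹.1 j i = a⁻¹.1 j i * (a⁻¹.1 i i * a i i) := by rw [h1, mul_one]
      _ = a⁻¹.1 i i * (a⁻¹.1 j i * a i i) := by ring
      _ = 0 := by rw [h2, mul_zero]

/-- `P`: the first row is `(a, 0, …, 0)`. -/
def P (k : ℕ) : Subgroup (GL (Fin (k + 1)) ℝ) := rowSubgroup ℝ 0

/-- `P̃`: the last column is `(0, …, 0, a)`. -/
def Pt (k : ℕ) : Subgroup (GL (Fin (k + 1)) ℝ) := colSubgroup ℝ (Fin.last k)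

/-- `χ_{ν,ε}(p) = |a|^{(n-1)ν/n} sgn(a)^ε |det B|^{-ν/n}` for `p ∈ P` with corner entry `a` and
complementary block `B`. -/
def chi (k : ℕ) (ε : ZMod 2) (ν : ℂ) (p : GL (Fin (k + 1)) ℝ) : ℂ :=
  ((|p 0 0| : ℝ) : ℂ) ^ ((k : ℂ) * ν / ((k : ℂ) + 1)) * ((Real.sign (p 0 0) : ℝ) : ℂ) ^ ε.val *
    ((|(p.1.submatrix Fin.succ Fin.succ).det| : ℝ) : ℂ) ^ (-ν / ((k : ℂ) + 1))

/-- `χ̃_{ν,ε}(p) = |det B|^{ν/n} |a|^{-(n-1)ν/n} sgn(a)^ε` for `p ∈ P̃` with corner entry `a` and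
complementary block `B`. -/
def chit (k : ℕ) (ε : ZMod 2) (ν : ℂ) (p : GL (Fin (k + 1)) ℝ) : ℂ :=
  ((|(p.1.submatrix Fin.castSucc Fin.castSucc).det| : ℝ) : ℂ) ^ (ν / ((k : ℂ) + 1)) *
    ((|p (Fin.last k) (Fin.last k)| : ℝ) : ℂ) ^ (-((k : ℂ) * ν / ((k : ℂ) + 1))) *
    ((Real.sign (p (Fin.last k) (Fin.last k)) : ℝ) : ℂ) ^ ε.val

/-- `ρ_mir = n / 2`. -/
def rhoMir (k : ℕ) : ℂ := ((k : ℂ) + 1) / 2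

/-- The smooth vectors `W_{ν,ε}^∞`. -/
abbrev W (k : ℕ) (ε : ZMod 2) (ν : ℂ) : Type := SmoothSection (P k) (chi k ε (ν - rhoMir k))

/-- The smooth vectors `W̃_{ν,ε}^∞`. -/
abbrev Wt (k : ℕ) (ε : ZMod 2) (ν : ℂ) : Type := SmoothSection (Pt k) (chit k ε (ν - rhoMir k))

/-- The distribution vectors `W_{ν,ε}^{-∞}`: the distribution sections of the line bundle with
parameter `ν - ρ_mir` over the compact manifold `G / P`, i.e. the strong dual of the space of
smooth sections of the dual line bundle tensored with the densities, which is `W_{-ν,ε}^∞`.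
A continuous `f` in the degenerate principal series gives the functional `h ↦ ∫_U f(u) h(u) du`. -/
abbrev Wdist (k : ℕ) (ε : ZMod 2) (ν : ℂ) : Type := W k ε (-ν) →L[ℂ] ℂ

/-- The distribution vectors `W̃_{ν,ε}^{-∞}`. -/
abbrev Wtdist (k : ℕ) (ε : ZMod 2) (ν : ℂ) : Type := Wt k ε (-ν) →L[ℂ] ℂ

/-- The matrix with first row `(1, x_{n-1}, …, x_1)` and the other rows those of the identity. -/
def rowMatrix {k : ℕ} (x : Fin k → ℝ) : Matrix (Fin (k + 1)) (Fin (k + 1)) ℝ :=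
  Matrix.of fun i j => if i = 0 then Fin.cons (α := fun _ => ℝ) 1 (fun l => x l.rev) j
    else if i = j then 1 else 0

/-- The matrix with last column `(x_1, …, x_{n-1}, 1)` and the other columns those of the
identity. -/
def colMatrix {k : ℕ} (x : Fin k → ℝ) : Matrix (Fin (k + 1)) (Fin (k + 1)) ℝ :=
  Matrix.of fun i j => if j = Fin.last k then Fin.snoc (α := fun _ => ℝ) x 1 i
    else if i = j then 1 else 0

theorem rowMatrix_mul {k : ℕ} (x y : Fin k → ℝ) :
    rowMatrix x * rowMatrix y = rowMatrix (x + y) := by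
  ext i j
  rw [Matrix.mul_apply, Fin.sum_univ_succ]
  refine Fin.cases ?_ (fun i => ?_) i <;> refine Fin.cases ?_ (fun j => ?_) j <;>
    simp [rowMatrix, Fin.succ_ne_zero, add_comm]

theorem colMatrix_mul {k : ℕ} (x y : Fin k → ℝ) :
    colMatrix x * colMatrix y = colMatrix (x + y) := by
  ext i j
  rw [Matrix.mul_apply, Fin.sum_univ_castSucc]
  refine Fin.lastCases ?_ (fun i => ?_) i <;> refine Fin.lastCases ?_ (fun j => ?_) j <;>
    simp [colMatrix, Fin.castSucc_ne_last, (Fin.castSucc_ne_last _).symm, add_comm]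

theorem rowMatrix_zero (k : ℕ) : rowMatrix (0 : Fin k → ℝ) = 1 := by
  ext i j
  refine Fin.cases ?_ (fun i => ?_) i <;> refine Fin.cases ?_ (fun j => ?_) j <;>
    simp [rowMatrix, Matrix.one_apply, Fin.succ_ne_zero, (Fin.succ_ne_zero _).symm]

theorem colMatrix_zero (k : ℕ) : colMatrix (0 : Fin k → ℝ) = 1 := by
  ext i j
  refine Fin.lastCases ?_ (fun i => ?_) i <;> refine Fin.lastCases ?_ (fun j => ?_) j <;>
    simp [colMatrix, Matrix.one_apply, Fin.castSucc_ne_last, (Fin.castSucc_ne_last _).symm]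

/-- The element of `U` with first row `(1, x_{n-1}, …, x_1)`. -/
def rowUnipotent {k : ℕ} (x : Fin k → ℝ) : GL (Fin (k + 1)) ℝ where
  val := rowMatrix x
  inv := rowMatrix (-x)
  val_inv := by rw [rowMatrix_mul, add_neg_cancel, rowMatrix_zero]
  inv_val := by rw [rowMatrix_mul, neg_add_cancel, rowMatrix_zero]

/-- The element of `Ũ` with last column `(x_1, …, x_{n-1}, 1)`. -/
def colUnipotent {k : ℕ} (x : Fin k → ℝ) : GL (Fin (k + 1)) ℝ where
  val := colMatrix x
  inv := colMatrix (-x)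
  val_inv := by rw [colMatrix_mul, add_neg_cancel, colMatrix_zero]
  inv_val := by rw [colMatrix_mul, neg_add_cancel, colMatrix_zero]

theorem antidiagonal_mul_self (n : ℕ) :
    (Matrix.of fun i j : Fin n => if j = i.rev then (1 : ℝ) else 0) *
      (Matrix.of fun i j : Fin n => if j = i.rev then (1 : ℝ) else 0) = 1 := by
  ext i j
  rw [Matrix.mul_apply, Finset.sum_eq_single i.rev]
  · simp [Matrix.one_apply, eq_comm]
  · intro l _ hl
    simp [hl]
  · simp

/-- The antidiagonal permutation matrix. -/
def wLong (n : ℕ) : GL (Fin n) ℝ where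
  val := Matrix.of fun i j => if j = i.rev then 1 else 0
  inv := Matrix.of fun i j => if j = i.rev then 1 else 0
  val_inv := antidiagonal_mul_self n
  inv_val := antidiagonal_mul_self n

/-! ### Test functions on the cells extend to smooth sections -/

section CellExtension

/-- The function on `ℝ × ℝ^k` that is homogeneous of degree `μ` and parity `ε`, equals `φ` on
`{1} × ℝ^k` and vanishes on `{0} × ℝ^k`. -/
def homog {k : ℕ} (φ : Test k) (ε : ZMod 2) (μ : ℂ) (t : ℝ) (y : Fin k → ℝ) : ℂ :=
  if t = 0 then 0 else
    ((|t| : ℝ) : ℂ) ^ μ * ((Real.sign t : ℝ) : ℂ) ^ ε.val * φ (t⁻¹ • y)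

theorem contDiffAt_abs_cpow {t : ℝ} (ht : t ≠ 0) (μ : ℂ) :
    ContDiffAt ℝ ∞ (fun t : ℝ => ((|t| : ℝ) : ℂ) ^ μ) t := by
  have h : (fun t : ℝ => Complex.exp (((Real.log t : ℝ) : ℂ) * μ)) =ᶠ[𝓝 t]
      fun t : ℝ => ((|t| : ℝ) : ℂ) ^ μ := by
    filter_upwards [isOpen_ne.mem_nhds ht] with s hs
    have hs' : ((|s| : ℝ) : ℂ) ≠ 0 := by exact_mod_cast abs_ne_zero.2 hs
    rw [Complex.cpow_def_of_ne_zero hs', ← Complex.ofReal_log (abs_nonneg s), Real.log_abs]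
  refine ContDiffAt.congr_of_eventuallyEq ?_ h.symm
  have h1 : ContDiffAt ℝ ∞ (fun t : ℝ => ((Real.log t : ℝ) : ℂ)) t :=
    (Complex.ofRealCLM.contDiff.contDiffAt).comp t (Real.contDiffAt_log.2 ht)
  exact (h1.mul contDiffAt_const).cexp

theorem contDiffAt_sign {t : ℝ} (ht : t ≠ 0) (m : ℕ) :
    ContDiffAt ℝ ∞ (fun t : ℝ => ((Real.sign t : ℝ) : ℂ) ^ m) t := by
  rcases lt_or_gt_of_ne ht with h | h
  · refine (contDiffAt_const (c := ((-1 : ℝ) : ℂ) ^ m)).congr_of_eventuallyEq ?_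
    filter_upwards [isOpen_Iio.mem_nhds h] with s hs
    rw [Real.sign_of_neg hs]
  · refine (contDiffAt_const (c := ((1 : ℝ) : ℂ) ^ m)).congr_of_eventuallyEq ?_
    filter_upwards [isOpen_Ioi.mem_nhds h] with s hs
    rw [Real.sign_of_pos hs]

theorem contDiffAt_homog {k : ℕ} (φ : Test k) (ε : ZMod 2) (μ : ℂ) {z : ℝ × (Fin k → ℝ)}
    (hz : z.1 = 0 → z.2 ≠ 0) :
    ContDiffAt ℝ ∞ (fun z : ℝ × (Fin k → ℝ) => homog φ ε μ z.1 z.2) z := by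
  by_cases ht : z.1 = 0
  · obtain ⟨R, hR⟩ := φ.hasCompactSupport.isCompact.isBounded.exists_norm_le
    have hpos : 0 < ‖z.2‖ := norm_pos_iff.2 (hz ht)
    have hev : (fun z : ℝ × (Fin k → ℝ) => homog φ ε μ z.1 z.2) =ᶠ[𝓝 z] fun _ => 0 := by
      have h1 : ∀ᶠ w : ℝ × (Fin k → ℝ) in 𝓝 z, |w.1| * (|R| + 1) < ‖w.2‖ := by
        refine IsOpen.mem_nhds (isOpen_lt (by fun_prop) (by fun_prop)) ?_
        change |z.1| * (|R| + 1) < ‖z.2‖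
        rw [ht]; simpa using hpos
      filter_upwards [h1] with w hw
      unfold homog
      split_ifs with h0
      · rfl
      · have : w.1⁻¹ • w.2 ∉ tsupport φ := by
          intro hmem
          have h2 := hR _ hmem
          rw [norm_smul, norm_inv, Real.norm_eq_abs] at h2
          have h3 : 0 < |w.1| := abs_pos.2 h0
          rw [inv_mul_le_iff₀ h3] at h2
          have : |w.1| * R ≤ |w.1| * (|R| + 1) :=
            mul_le_mul_of_nonneg_left (by linarith [le_abs_self R]) h3.le
          linarith
        rw [image_eq_zero_of_notMem_tsupport this, mul_zero]
    exact contDiffAt_const.congr_of_eventuallyEq hev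
  · have hev : (fun z : ℝ × (Fin k → ℝ) => homog φ ε μ z.1 z.2) =ᶠ[𝓝 z] fun z =>
        ((|z.1| : ℝ) : ℂ) ^ μ * ((Real.sign z.1 : ℝ) : ℂ) ^ ε.val * φ (z.1⁻¹ • z.2) := by
      filter_upwards [(isOpen_ne.preimage continuous_fst).mem_nhds ht] with w hw
      unfold homog
      rw [if_neg hw]
    refine ContDiffAt.congr_of_eventuallyEq ?_ hev
    have h1 : ContDiffAt ℝ ∞ (fun z : ℝ × (Fin k → ℝ) => z.1) z := contDiffAt_fst
    refine ContDiffAt.mul (ContDiffAt.mul ?_ ?_) ?_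
    · exact (contDiffAt_abs_cpow ht μ).comp z h1
    · exact (contDiffAt_sign ht ε.val).comp z h1
    · exact φ.contDiff.contDiffAt.comp z ((h1.inv ht).smul contDiffAt_snd)

theorem homog_smul {k : ℕ} (φ : Test k) (ε : ZMod 2) (μ : ℂ) {a : ℝ} (ha : a ≠ 0) (t : ℝ)
    (y : Fin k → ℝ) : homog φ ε μ (a * t) (a • y) =
      ((|a| : ℝ) : ℂ) ^ μ * ((Real.sign a : ℝ) : ℂ) ^ ε.val * homog φ ε μ t y := by
  unfold homog
  by_cases ht : t = 0
  · simp [ht]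
  · rw [if_neg (mul_ne_zero ha ht), if_neg ht]
    have h1 : (a * t)⁻¹ • a • y = t⁻¹ • y := by
      rw [smul_smul]; congr 1; field_simp
    have h2 : ((|a * t| : ℝ) : ℂ) ^ μ = ((|a| : ℝ) : ℂ) ^ μ * ((|t| : ℝ) : ℂ) ^ μ := by
      rw [abs_mul, Complex.ofReal_mul,
        Complex.mul_cpow_ofReal_nonneg (abs_nonneg a) (abs_nonneg t)]
    have h3 : Real.sign (a * t) = Real.sign a * Real.sign t := by
      rcases lt_or_gt_of_ne ha with h | h <;> rcases lt_or_gt_of_ne ht with h' | h'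
      · rw [Real.sign_of_neg h, Real.sign_of_neg h', Real.sign_of_pos (mul_pos_of_neg_of_neg h h')]
        norm_num
      · rw [Real.sign_of_neg h, Real.sign_of_pos h', Real.sign_of_neg (mul_neg_of_neg_of_pos h h')]
        norm_num
      · rw [Real.sign_of_pos h, Real.sign_of_neg h', Real.sign_of_neg (mul_neg_of_pos_of_neg h h')]
        norm_num
      · rw [Real.sign_of_pos h, Real.sign_of_pos h', Real.sign_of_pos (mul_pos h h')]
        norm_num
    rw [h1, h2, h3, Complex.ofReal_mul, mul_pow]
    ring

theorem homog_one {k : ℕ} (φ : Test k) (ε : ZMod 2) (μ : ℂ) (y : Fin k → ℝ) :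
    homog φ ε μ 1 y = φ y := by
  simp [homog, Real.sign_of_pos]

theorem det_ne_zero' {n : ℕ} (g : GL (Fin n) ℝ) : g.1.det ≠ 0 :=
  ((Matrix.isUnit_iff_isUnit_det _).1 g.isUnit).ne_zero

theorem isSmooth_of_formula {n : ℕ} {f : GL (Fin n) ℝ → ℂ} {F : (Fin n → Fin n → ℝ) → ℂ}
    (hF : ∀ A ∈ invertibleSet n, ContDiffAt ℝ ∞ F A)
    (hf : ∀ g : GL (Fin n) ℝ, f g = F (fun i j => g i j)) : IsSmooth f := by
  intro A hA
  refine ((hF A hA).contDiffWithinAt).congr_of_mem (fun B hB => ?_) hA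
  unfold zeroExt
  have hB' : (Matrix.of B).det ≠ 0 := hB
  rw [dif_pos hB', hf]
  rfl

theorem contDiffAt_det_cpow {n : ℕ} (s : ℂ) {A : Fin n → Fin n → ℝ} (hA : A ∈ invertibleSet n) :
    ContDiffAt ℝ ∞ (fun A : Fin n → Fin n → ℝ => ((|(Matrix.of A).det| : ℝ) : ℂ) ^ s) A :=
  (contDiffAt_abs_cpow hA s).comp A
    (contDiff_det (M := fun A : Fin n → Fin n → ℝ => Matrix.of A)
      (fun i j => contDiff_entry i j)).contDiffAt

theorem abs_cpow_mul {a b : ℝ} (s : ℂ) :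
    ((|a * b| : ℝ) : ℂ) ^ s = ((|a| : ℝ) : ℂ) ^ s * ((|b| : ℝ) : ℂ) ^ s := by
  rw [abs_mul, Complex.ofReal_mul, Complex.mul_cpow_ofReal_nonneg (abs_nonneg a) (abs_nonneg b)]

theorem abs_cpow_inv {a : ℝ} (s : ℂ) :
    ((|a⁻¹| : ℝ) : ℂ) ^ s = ((|a| : ℝ) : ℂ) ^ (-s) := by
  rw [abs_inv, Complex.ofReal_inv, Complex.inv_cpow, Complex.cpow_neg]
  rw [Complex.arg_ofReal_of_nonneg (abs_nonneg a)]
  exact Real.pi_pos.ne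

theorem sign_inv' (a : ℝ) : Real.sign a⁻¹ = Real.sign a := by
  rcases lt_trichotomy a 0 with h | h | h
  · rw [Real.sign_of_neg h, Real.sign_of_neg (inv_lt_zero.2 h)]
  · simp [h]
  · rw [Real.sign_of_pos h, Real.sign_of_pos (inv_pos.2 h)]

variable {k : ℕ}

theorem Pt_corner_ne_zero {p : GL (Fin (k + 1)) ℝ} (hp : p ∈ Pt k) :
    p (Fin.last k) (Fin.last k) ≠ 0 := by
  intro h0
  refine det_ne_zero' p (Matrix.det_eq_zero_of_column_eq_zero (Fin.last k) fun i => ?_)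
  by_cases hi : i = Fin.last k
  · rw [hi]; exact h0
  · exact hp i hi

theorem P_corner_ne_zero {p : GL (Fin (k + 1)) ℝ} (hp : p ∈ P k) : p 0 0 ≠ 0 := by
  intro h0
  refine det_ne_zero' p (Matrix.det_eq_zero_of_row_eq_zero 0 fun i => ?_)
  by_cases hi : i = 0
  · rw [hi]; exact h0
  · exact hp i hi

theorem Pt_det {p : GL (Fin (k + 1)) ℝ} (hp : p ∈ Pt k) :
    p.1.det = (p.1.submatrix Fin.castSucc Fin.castSucc).det * p (Fin.last k) (Fin.last k) := by
  rw [Matrix.det_succ_column p.1 (Fin.last k), Finset.sum_eq_single (Fin.last k)]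
  · rw [← two_mul, pow_mul]
    simp [mul_comm, Fin.succAbove_last]
  · intro i _ hi
    rw [show p.1 i (Fin.last k) = 0 from hp i hi]; simp
  · simp

theorem P_det {p : GL (Fin (k + 1)) ℝ} (hp : p ∈ P k) :
    p.1.det = p 0 0 * (p.1.submatrix Fin.succ Fin.succ).det := by
  rw [Matrix.det_succ_row p.1 0, Finset.sum_eq_single 0]
  · simp [Fin.succAbove_zero]
  · intro i _ hi
    rw [show p.1 0 i = 0 from hp i hi]; simp
  · simp

theorem chit_eq {p : GL (Fin (k + 1)) ℝ} (hp : p ∈ Pt k) (ε : ZMod 2) (μ : ℂ) :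
    chit k ε μ p = ((|p.1.det| : ℝ) : ℂ) ^ (μ / ((k : ℂ) + 1)) *
      ((|p (Fin.last k) (Fin.last k)| : ℝ) : ℂ) ^ (-μ) *
      ((Real.sign (p (Fin.last k) (Fin.last k)) : ℝ) : ℂ) ^ ε.val := by
  have ha : ((|p (Fin.last k) (Fin.last k)| : ℝ) : ℂ) ≠ 0 := by
    exact_mod_cast abs_ne_zero.2 (Pt_corner_ne_zero hp)
  have hk : (k : ℂ) + 1 ≠ 0 := by exact_mod_cast Nat.succ_ne_zero k
  rw [Pt_det hp, abs_cpow_mul, chit, mul_assoc _ (_ ^ (μ / _)), ← Complex.cpow_add _ _ ha]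
  congr 3
  field_simp
  ring

theorem chi_eq {p : GL (Fin (k + 1)) ℝ} (hp : p ∈ P k) (ε : ZMod 2) (μ : ℂ) :
    chi k ε μ p = ((|p.1.det| : ℝ) : ℂ) ^ (-μ / ((k : ℂ) + 1)) *
      ((|p 0 0| : ℝ) : ℂ) ^ μ * ((Real.sign (p 0 0) : ℝ) : ℂ) ^ ε.val := by
  have ha : ((|p 0 0| : ℝ) : ℂ) ≠ 0 := by
    exact_mod_cast abs_ne_zero.2 (P_corner_ne_zero hp)
  have hk : (k : ℂ) + 1 ≠ 0 := by exact_mod_cast Nat.succ_ne_zero k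
  have h1 : (k : ℂ) * μ / ((k : ℂ) + 1) = -μ / ((k : ℂ) + 1) + μ := by field_simp; ring
  rw [P_det hp, abs_cpow_mul, chi, h1, Complex.cpow_add _ _ ha]
  ring

theorem Pt_inv_corner {p : GL (Fin (k + 1)) ℝ} (hp : p ∈ Pt k) :
    p⁻¹ (Fin.last k) (Fin.last k) = (p (Fin.last k) (Fin.last k))⁻¹ := by
  refine eq_inv_of_mul_eq_one_left ?_
  have h := congrFun (congrFun (Units.inv_mul p) (Fin.last k)) (Fin.last k)
  rw [Matrix.mul_apply, Finset.sum_eq_single (Fin.last k), Matrix.one_apply_eq] at h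
  · exact h
  · intro l _ hl
    rw [show p.1 l (Fin.last k) = 0 from hp l hl, mul_zero]
  · simp

theorem P_inv_corner {p : GL (Fin (k + 1)) ℝ} (hp : p ∈ P k) : p⁻¹ 0 0 = (p 0 0)⁻¹ := by
  refine eq_inv_of_mul_eq_one_right ?_
  have h := congrFun (congrFun (Units.mul_inv p) 0) 0
  rw [Matrix.mul_apply, Finset.sum_eq_single 0, Matrix.one_apply_eq] at h
  · exact h
  · intro l _ hl
    rw [show p.1 0 l = 0 from hp l hl, zero_mul]
  · simp

theorem det_inv' {n : ℕ} (g : GL (Fin n) ℝ) : g⁻¹.1.det = g.1.det⁻¹ := by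
  refine eq_inv_of_mul_eq_one_left ?_
  rw [← Matrix.det_mul, Units.inv_mul, Matrix.det_one]

theorem exists_colExtension (φ : Test k) (ε : ZMod 2) (μ : ℂ) :
    ∃ f : SmoothSection (Pt k) (chit k ε μ), IsCellExtension colUnipotent φ f := by
  let f : GL (Fin (k + 1)) ℝ → ℂ := fun g =>
    ((|g.1.det| : ℝ) : ℂ) ^ (-(μ / ((k : ℂ) + 1))) *
      homog φ ε μ (g (Fin.last k) (Fin.last k)) (fun i => g i.castSucc (Fin.last k))
  have hsm : IsSmooth f := by
    refine isSmooth_of_formula (F := fun A =>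
      ((|(Matrix.of A).det| : ℝ) : ℂ) ^ (-(μ / ((k : ℂ) + 1))) *
      homog φ ε μ (A (Fin.last k) (Fin.last k)) (fun i => A i.castSucc (Fin.last k)))
      (fun A hA => ?_) (fun g => rfl)
    refine (contDiffAt_det_cpow _ hA).mul ?_
    refine ContDiffAt.comp (f := fun A : Fin (k + 1) → Fin (k + 1) → ℝ =>
      (A (Fin.last k) (Fin.last k), fun i : Fin k => A i.castSucc (Fin.last k)))
      A (contDiffAt_homog φ ε μ ?_) (by fun_prop)
    intro h0 h1
    refine hA (Matrix.det_eq_zero_of_column_eq_zero (Fin.last k) fun i => ?_)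
    refine Fin.lastCases h0 (fun i => ?_) i
    exact congrFun h1 i
  have heq : ∀ g, ∀ q ∈ Pt k, f (g * q) = chit k ε μ q⁻¹ * f g := by
    intro g q hq
    have hcol : ∀ i, (g * q) i (Fin.last k) = q (Fin.last k) (Fin.last k) * g i (Fin.last k) := by
      intro i
      change (g.1 * q.1) i (Fin.last k) = _
      rw [Matrix.mul_apply, Finset.sum_eq_single (Fin.last k), mul_comm]
      · intro l _ hl
        rw [show q.1 l (Fin.last k) = 0 from hq l hl, mul_zero]
      · simp
    have hdet : (g * q).1.det = g.1.det * q.1.det := Matrix.det_mul _ _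
    rw [chit_eq ((Pt k).inv_mem hq), Pt_inv_corner hq, det_inv', abs_cpow_inv, abs_cpow_inv,
      sign_inv', neg_neg]
    simp only [f]
    rw [hdet, abs_cpow_mul]
    simp only [hcol]
    rw [show (fun i : Fin k => q (Fin.last k) (Fin.last k) * g i.castSucc (Fin.last k)) =
      q (Fin.last k) (Fin.last k) • fun i : Fin k => g i.castSucc (Fin.last k) from rfl,
      homog_smul _ _ _ (Pt_corner_ne_zero hq)]
    ring
  refine ⟨⟨f, hsm, heq⟩, fun x => ?_, fun g hg => ?_⟩
  · change f (colUnipotent x) = φ x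
    have hd : (colUnipotent x).1.det = 1 := by
      change (colMatrix x).det = 1
      rw [Matrix.det_of_isUpperTriangular]
      · refine Finset.prod_eq_one fun i _ => ?_
        refine Fin.lastCases ?_ (fun i => ?_) i <;> simp [colMatrix, Fin.castSucc_ne_last]
      · intro i j hij
        have h1 : j < i := hij
        have h2 : j ≠ Fin.last k := (lt_of_lt_of_le h1 (Fin.le_last i)).ne
        simp [colMatrix, h2, h1.ne']
    have h1 : (colUnipotent x) (Fin.last k) (Fin.last k) = 1 := by
      change colMatrix x _ _ = 1
      simp [colMatrix]
    have h2 : (fun i : Fin k => (colUnipotent x) i.castSucc (Fin.last k)) = x := by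
      funext i
      change colMatrix x _ _ = x i
      simp [colMatrix]
    simp only [f]
    rw [hd, h1, h2, homog_one]
    simp
  · change f g = 0
    have h0 : g (Fin.last k) (Fin.last k) = 0 := by
      by_contra hne
      refine hg (fun i => (g (Fin.last k) (Fin.last k))⁻¹ * g i.castSucc (Fin.last k)) ?_
      intro j hj
      change (colMatrix (-(fun i : Fin k => (g (Fin.last k) (Fin.last k))⁻¹ *
        g i.castSucc (Fin.last k))) * g.1 : Matrix _ _ ℝ) j (Fin.last k) = 0
      obtain ⟨j, rfl⟩ := Fin.exists_castSucc_eq.2 hj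
      rw [Matrix.mul_apply, Fin.sum_univ_castSucc]
      simp [colMatrix, Fin.castSucc_ne_last]
      field_simp
      simp
    simp [f, h0, homog]

theorem exists_rowExtension (φ : Test k) (ε : ZMod 2) (μ : ℂ) :
    ∃ f : SmoothSection (P k) (chi k ε μ), IsCellExtension rowUnipotent φ f := by
  let f : GL (Fin (k + 1)) ℝ → ℂ := fun g =>
    ((|g.1.det| : ℝ) : ℂ) ^ (μ / ((k : ℂ) + 1)) *
      homog φ ε μ (g⁻¹ 0 0) (fun i => -g⁻¹ 0 i.rev.succ)
  have hsm : IsSmooth f := by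
    refine isSmooth_of_formula (F := fun A =>
      ((|(Matrix.of A).det| : ℝ) : ℂ) ^ (μ / ((k : ℂ) + 1)) *
      homog φ ε μ ((Matrix.of A)⁻¹ 0 0) (fun i => -(Matrix.of A)⁻¹ 0 i.rev.succ))
      (fun A hA => ?_) (fun g => ?_)
    · refine (contDiffAt_det_cpow _ hA).mul ?_
      have hinv : ∀ j, ContDiffAt ℝ ∞
          (fun A : Fin (k + 1) → Fin (k + 1) → ℝ => (Matrix.of A)⁻¹ 0 j) A := by
        intro j
        have h1 : ∀ A : Fin (k + 1) → Fin (k + 1) → ℝ, (Matrix.of A)⁻¹ 0 j =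
            (Matrix.of A).det⁻¹ * ((Matrix.of A).updateRow j (Pi.single 0 1)).det := by
          intro A
          rw [Matrix.inv_def, Matrix.smul_apply, Matrix.adjugate_apply, Ring.inverse_eq_inv',
            smul_eq_mul]
        simp only [h1]
        refine ContDiffAt.mul (ContDiffAt.inv ?_ hA) ?_
        · exact (contDiff_det (M := fun A : Fin (k + 1) → Fin (k + 1) → ℝ => Matrix.of A)
            (fun i j => contDiff_entry i j)).contDiffAt
        · refine (contDiff_det fun a b => ?_).contDiffAt
          by_cases hab : a = j
          · subst hab
            simp only [Matrix.updateRow_self]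
            exact contDiff_const
          · simp only [Matrix.updateRow_ne hab]
            exact contDiff_entry a b
      refine ContDiffAt.comp (f := fun A : Fin (k + 1) → Fin (k + 1) → ℝ =>
        ((Matrix.of A)⁻¹ 0 0, fun i : Fin k => -(Matrix.of A)⁻¹ 0 i.rev.succ))
        A (contDiffAt_homog φ ε μ ?_)
        ((hinv 0).prodMk (contDiffAt_pi.2 fun i => (hinv _).neg))
      intro h0 h1
      have hdi : ((Matrix.of A)⁻¹).det = 0 := by
        refine Matrix.det_eq_zero_of_row_eq_zero 0 fun i => ?_
        refine Fin.cases h0 (fun i => ?_) i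
        have := congrFun h1 i.rev
        simpa using this
      rw [Matrix.det_nonsing_inv, Ring.inverse_eq_inv'] at hdi
      exact hA (inv_eq_zero.1 hdi)
    · simp only [f]
      rw [Matrix.coe_units_inv]
      rfl
  have heq : ∀ g, ∀ q ∈ P k, f (g * q) = chi k ε μ q⁻¹ * f g := by
    intro g q hq
    have hqi := (P k).inv_mem hq
    have hrow : ∀ i, (g * q)⁻¹ 0 i = q⁻¹ 0 0 * g⁻¹ 0 i := by
      intro i
      rw [mul_inv_rev]
      change (q⁻¹.1 * g⁻¹.1) 0 i = _
      rw [Matrix.mul_apply, Finset.sum_eq_single 0]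
      · intro l _ hl
        rw [show q⁻¹.1 0 l = 0 from hqi l hl, zero_mul]
      · simp
    have hdet : (g * q).1.det = g.1.det * q.1.det := Matrix.det_mul _ _
    rw [chi_eq hqi, det_inv', abs_cpow_inv]
    simp only [f]
    rw [hdet, abs_cpow_mul]
    simp only [hrow]
    rw [show (fun i : Fin k => -(q⁻¹ 0 0 * g⁻¹ 0 i.rev.succ)) =
      q⁻¹ 0 0 • fun i : Fin k => -g⁻¹ 0 i.rev.succ from by
        funext i; simp,
      homog_smul _ _ _ (P_corner_ne_zero hqi), neg_div, neg_neg]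
    ring
  refine ⟨⟨f, hsm, heq⟩, fun x => ?_, fun g hg => ?_⟩
  · change f (rowUnipotent x) = φ x
    have hd : (rowUnipotent x).1.det = 1 := by
      change (rowMatrix x).det = 1
      rw [Matrix.det_of_isUpperTriangular]
      · refine Finset.prod_eq_one fun i _ => ?_
        refine Fin.cases ?_ (fun i => ?_) i <;> simp [rowMatrix, Fin.succ_ne_zero]
      · intro i j hij
        have h1 : j < i := hij
        have h2 : i ≠ 0 := (lt_of_le_of_lt (Fin.zero_le j) h1).ne'
        simp [rowMatrix, h2, h1.ne']
    have h1 : (rowUnipotent x)⁻¹ 0 0 = 1 := by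
      change rowMatrix (-x) _ _ = 1
      simp [rowMatrix]
    have h2 : (fun i : Fin k => -(rowUnipotent x)⁻¹ 0 i.rev.succ) = x := by
      funext i
      change -rowMatrix (-x) _ _ = x i
      simp [rowMatrix]
    simp only [f]
    rw [hd, h1, h2, homog_one]
    simp
  · change f g = 0
    have h0 : g⁻¹ 0 0 = 0 := by
      by_contra hne
      refine hg (fun i => -((g⁻¹ 0 0)⁻¹ * g⁻¹ 0 i.rev.succ)) ?_
      rw [← (P k).inv_mem_iff, mul_inv_rev, inv_inv]
      intro j hj
      change (g⁻¹.1 * rowMatrix (fun i : Fin k => -((g⁻¹ 0 0)⁻¹ * g⁻¹ 0 i.rev.succ)) :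
        Matrix _ _ ℝ) 0 j = 0
      generalize g⁻¹ = a at hne ⊢
      obtain ⟨j, rfl⟩ := Fin.exists_succ_eq.2 hj
      rw [Matrix.mul_apply, Fin.sum_univ_succ]
      simp [rowMatrix, Fin.succ_ne_zero]
      field_simp
      simp
    simp only [f, homog]
    rw [if_pos h0, mul_zero]

/-- The reflection of a test function. -/
def reflect (φ : Test k) : Test k where
  toFun x := φ (-x)
  contDiff' := φ.contDiff.comp contDiff_neg
  hasCompactSupport' := φ.hasCompactSupport.comp_homeomorph (Homeomorph.neg (Fin k → ℝ))
  tsupport_subset' := fun _ _ => trivial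

theorem exists_rowExtension_neg (φ : Test k) (ε : ZMod 2) (μ : ℂ) :
    ∃ f : SmoothSection (P k) (chi k ε μ), IsCellExtension (fun x => rowUnipotent (-x)) φ f := by
  obtain ⟨f, h1, h2⟩ := exists_rowExtension (reflect φ) ε μ
  refine ⟨f, fun x => ?_, fun g hg => h2 g fun x => ?_⟩
  · rw [h1]
    change φ (- -x) = φ x
    rw [neg_neg]
  · simpa using hg (-x)

theorem cellExtension_spec {n : ℕ} {Q : Subgroup (GL (Fin n) ℝ)} {χ : GL (Fin n) ℝ → ℂ}
    {u : (Fin k → ℝ) → GL (Fin n) ℝ} {φ : Test k}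
    (h : ∃ f : SmoothSection Q χ, IsCellExtension u φ f) :
    IsCellExtension u φ (cellExtension u φ : SmoothSection Q χ) := by
  unfold cellExtension
  rw [dif_pos h]
  exact h.choose_spec

end CellExtension

/-! ### The Eisenstein distributions -/

/-- The inclusion of `GL(n, ℤ)` into `GL(n, ℝ)`. -/
def intToReal (n : ℕ) : GL (Fin n) ℤ →* GL (Fin n) ℝ :=
  Matrix.GeneralLinearGroup.map (Int.castRingHom ℝ)

/-- `Γ₀(N)`: the last row is congruent to `(0, …, 0, *)` modulo `N`. -/
def Gamma0 (k N : ℕ) : Subgroup (GL (Fin (k + 1)) ℤ) :=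
  (rowSubgroup (ZMod N) (Fin.last k)).comap
    (Matrix.GeneralLinearGroup.map (Int.castRingHom (ZMod N)))

/-- `Γ̃₀(N)`: the first column is congruent to `(*, 0, …, 0)` modulo `N`. -/
def Gammat0 (k N : ℕ) : Subgroup (GL (Fin (k + 1)) ℤ) :=
  (colSubgroup (ZMod N) 0).comap (Matrix.GeneralLinearGroup.map (Int.castRingHom (ZMod N)))

/-- `Γ_∞ = Γ ∩ w P w⁻¹` for `Γ = Γ₀(N)` and `w = w_long`. -/
def GammaInf (k N : ℕ) : Subgroup (Gamma0 k N) :=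
  (P k).comap (((MulAut.conj (wLong (k + 1))⁻¹).toMonoidHom.comp (intToReal (k + 1))).comp
    (Gamma0 k N).subtype)

/-- `Γ̃_∞ = Γ̃ ∩ w P̃ w⁻¹` for `Γ̃ = Γ̃₀(N)` and `w = w_long`. -/
def GammatInf (k N : ℕ) : Subgroup (Gammat0 k N) :=
  (Pt k).comap (((MulAut.conj (wLong (k + 1))⁻¹).toMonoidHom.comp (intToReal (k + 1))).comp
    (Gammat0 k N).subtype)

/-- `α(γ) = ψ(γ_{nn})⁻¹`. -/
def alpha {k N : ℕ} (ψ : DirichletCharacter ℂ N) (γ : Gamma0 k N) : ℂ :=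
  (ψ ((γ.1 (Fin.last k) (Fin.last k) : ℤ) : ZMod N))⁻¹

/-- `α̃(γ) = ψ(γ_{11})`. -/
def alphat {k N : ℕ} (ψ : DirichletCharacter ℂ N) (γ : Gammat0 k N) : ℂ :=
  ψ ((γ.1 0 0 : ℤ) : ZMod N)

/-- `δ_∞ = ℓ(w_long) δ_e ∈ W_{ν,ε}^{-∞}`. -/
def deltaInf (k : ℕ) (ε : ZMod 2) (ν : ℂ) : Wdist k ε ν :=
  ell (wLong (k + 1)) (SmoothSection.evalAt _ _ 1)

/-- The corresponding Dirac distribution in `W̃_{ν,ε}^{-∞}`. -/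
def deltatInf (k : ℕ) (ε : ZMod 2) (ν : ℂ) : Wtdist k ε ν :=
  ell (wLong (k + 1)) (SmoothSection.evalAt _ _ 1)

/-- The summand `α(γ) ℓ(γ) δ_∞` of the Eisenstein series. When `ψ(-1) = (-1)^ε` it does not depend on
the choice of the representative `γ` of the coset in `Γ / Γ_∞`. -/
def eisensteinTerm (k N : ℕ) (ψ : DirichletCharacter ℂ N) (ε : ZMod 2) (ν : ℂ)
    (c : Gamma0 k N ⧸ GammaInf k N) : Wdist k ε ν :=
  alpha ψ c.out • ell (intToReal (k + 1) c.out.1) (deltaInf k ε ν)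

/-- The summand `α̃(γ) ℓ(γ) δ_∞̃` of the second Eisenstein series. -/
def eisensteintTerm (k N : ℕ) (ψ : DirichletCharacter ℂ N) (ε : ZMod 2) (ν : ℂ)
    (c : Gammat0 k N ⧸ GammatInf k N) : Wtdist k ε ν :=
  alphat ψ c.out • ell (intToReal (k + 1) c.out.1) (deltatInf k ε ν)

/-- `E_{ν,ψ} = L(ν + n/2, ψ) ∑_{γ ∈ Γ/Γ_∞} α(γ) ℓ(γ) δ_∞`, the sum being taken in the strong
topology of `W_{ν,ε}^{-∞}`. -/
def eisenstein (k N : ℕ) [NeZero N] (ψ : DirichletCharacter ℂ N) (ε : ZMod 2) (ν : ℂ) :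
    Wdist k ε ν :=
  DirichletCharacter.LFunction ψ (ν + rhoMir k) •
    ∑' c : Gamma0 k N ⧸ GammaInf k N, eisensteinTerm k N ψ ε ν c

/-- `Ẽ_{ν,ψ} = L(ν + n/2, ψ) ∑_{γ ∈ Γ̃/Γ̃_∞} α̃(γ) ℓ(γ) δ_∞̃`. -/
def eisensteint (k N : ℕ) [NeZero N] (ψ : DirichletCharacter ℂ N) (ε : ZMod 2) (ν : ℂ) :
    Wtdist k ε ν :=
  DirichletCharacter.LFunction ψ (ν + rhoMir k) •
    ∑' c : Gammat0 k N ⧸ GammatInf k N, eisensteintTerm k N ψ ε ν c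

/-! ### The explicit formulas -/

/-- `e(z) = exp(2πiz)`. -/
def eFun (z : ℂ) : ℂ := Complex.exp (2 * Real.pi * Complex.I * z)

/-- The finite Fourier transform `ψ̂(m) = ∑_{a mod N} ψ(a) e(a m / N)`. -/
def psiHat {N : ℕ} [NeZero N] (ψ : DirichletCharacter ℂ N) (m : ℤ) : ℂ :=
  ∑ a : ZMod N, ψ a * eFun ((a.val : ℂ) * m / N)

/-- `a_r = N^{-ν-n/2} ∑_{d > 0, d ∣ r_1, …, r_{n-1}} d^{-ν+n/2-1} ψ̂(-r_1/d)`. -/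
def aCoeff {k N : ℕ} [NeZero k] [NeZero N] (ψ : DirichletCharacter ℂ N) (ν : ℂ)
    (r : Fin k → ℤ) : ℂ :=
  (N : ℂ) ^ (-ν - rhoMir k) * ∑' d : {d : ℕ // 0 < d ∧ ∀ i, (d : ℤ) ∣ r i},
    ((d : ℕ) : ℂ) ^ (-ν + rhoMir k - 1) * psiHat ψ (-(r 0 / ((d : ℕ) : ℤ)))

/-- `c_r = N^{-(n-1)} ∑_{d > 0, d ∣ r_1, …, r_{n-1}} ψ(d) d^{-ν+n/2-1}`. -/
def cCoeff {k N : ℕ} [NeZero N] (ψ : DirichletCharacter ℂ N) (ν : ℂ) (r : Fin k → ℤ) : ℂ :=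
  1 / (N : ℂ) ^ k * ∑' d : {d : ℕ // 0 < d ∧ ∀ i, (d : ℤ) ∣ r i},
    ψ ((d : ℕ) : ZMod N) * ((d : ℕ) : ℂ) ^ (-ν + rhoMir k - 1)

end MirabolicEisenstein

end

open MirabolicEisenstein

noncomputable section

namespace MirabolicEisenstein

open MeasureTheory Set Filter
open scoped Matrix

/-! ### Summation over `ℤ^d` -/

/-! Everything reduces to one lattice sum. Up to a power of the determinant, a section `h` of the
bundle on `G / P̃` with parameter `-ν` is a function `lift h` of the last column: smooth on ℝⁿ minus
the origin, homogeneous of degree `-s` with `s = ν + n/2`, and of parity `ε` (`lift_lastCol`,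
`lift_scale`). A term of the series for Ẽ evaluates `lift h` at the first column of γ. Cosets
correspond to pairs `±w` of primitive vectors with all entries but the first divisible by `N`, and
the Dirichlet series of the L-factor supplies the positive multiples of `w`. Hence twice Ẽ is the
sum of `coef ψ v * lift h v` over ℤⁿ (`hasSum_coef_mul_lift`). Homogeneity bounds each term by a
continuous seminorm times `(1 + ‖v‖) ^ (-Re s)`, which gives strong convergence for `Re s > n`
(`summable_clm_of_seminorm`).

For the continuation, a radial bump function whose integral over dilations is one is inserted. The
lattice sum becomes the integral over `τ > 0` of `e^{-sτ} θ(e^{-τ})`, where `θ(t)` is a theta sum of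
the smooth, compactly supported function `localized h` (`hasSum_continued`). Poisson summation shows
that `θ(t)` is `c t^{-n} ∫ φ` up to `O(t^M)` for every `M`, with `φ = localized h` and `c = N^{-n} ∑
ψ(a)` (`norm_thetaRem_le`). The remainder integrates to an entire function, and the main term to `c
∫ φ / (s - n)`. No functional equation is needed. The constant `c` vanishes for nontrivial `ψ`; for
trivial `ψ` the residue is non-zero on a non-negative test function. Along a flat family, `lift`
depends on the parameter only through `exp (-s log |x|)` (`lift_flat`), so the pairing is
holomorphic off the pole.

On the open cell, the section extending `φ` lifts to the homogeneous function with values `φ (y /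
t)` up to the factor `|t|^{-s} sgn(t)^ε` (`lift_cellExtension`). The summand is even, so half of the
lattice suffices. The Fourier expansions are Poisson summation in all `n - 1` variables, or in the
first variable alone. It is applied for each fixed value of the remaining variables, and the results
are reassembled by absolute convergence (`hasSum_of_fiberwise`).

The automorphism `g ↦ w (gᵗ)⁻¹ w` exchanges `P` with `P̃`, Γ with Γ̃ and `r(-u)` with `c(u)`, fixes
`w` and preserves `O(n)`. It therefore carries all results from Ẽ to `E` (`eisenstein_eq_pullback`).
-/

theorem norm_intCast_pi {d : ℕ} (v : Fin d → ℤ) : ‖(fun i => (v i : ℝ))‖ = ‖v‖ := by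
  simp only [Pi.norm_def]
  congr 2

theorem summable_one_add_norm_rpow {d : ℕ} {p : ℝ} (hp : (d : ℝ) < p) :
    Summable fun v : Fin d → ℤ => (1 + ‖v‖) ^ (-p) := by
  classical
  let b := Pi.basisFun ℝ (Fin d)
  let L : Submodule ℤ (Fin d → ℝ) := Submodule.span ℤ (Set.range b)
  have hmem : ∀ v : Fin d → ℤ, (fun i => (v i : ℝ)) ∈ L := by
    intro v
    rw [b.mem_span_iff_repr_mem ℤ]
    intro i
    exact ⟨v i, by simp [b]⟩
  have hr : (-p) < -(Module.finrank ℤ L : ℝ) := by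
    rw [ZLattice.rank ℝ L]
    simpa using hp
  have h1 := ZLattice.summable_norm_rpow L (-p) hr
  have h2 := h1.comp_injective (i := fun v : Fin d → ℤ => (⟨_, hmem v⟩ : L)) (by
    intro v w hvw
    funext i
    have : ((v i : ℤ) : ℝ) = w i := congrFun (congrArg Subtype.val hvw) i
    exact_mod_cast this)
  -- Comparing `1 + ‖v‖` with `‖v‖` needs `v ≠ 0`, so it is made off a finite set.
  refine h2.of_norm_bounded_eventually (E := ℝ) ?_
  filter_upwards [(Set.finite_singleton (0 : Fin d → ℤ)).compl_mem_cofinite] with v hv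
  have hv' : 0 < ‖v‖ := norm_pos_iff.2 hv
  rw [Real.norm_of_nonneg (by positivity)]
  change _ ≤ ‖(fun i => (v i : ℝ))‖ ^ (-p)
  rw [norm_intCast_pi]
  exact Real.rpow_le_rpow_of_nonpos hv' (by linarith) (by linarith [(Nat.cast_nonneg d : (0:ℝ) ≤ d)])

theorem finite_norm_le {d : ℕ} (B : ℝ) : {m : Fin d → ℤ | ‖m‖ ≤ B}.Finite := by
  have : {m : Fin d → ℤ | ‖m‖ ≤ B} = Metric.closedBall 0 B := by ext; simp
  rw [this]
  exact (isCompact_closedBall _ _).finite_of_discrete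

/-! ### The exponential and the Fourier transform -/

/-- The Fourier transform on `ℝ^d`, with the sign convention of `eFun`. -/
def ft {d : ℕ} (f : (Fin d → ℝ) → ℂ) (ξ : Fin d → ℝ) : ℂ :=
  ∫ x : Fin d → ℝ, eFun (∑ i, (ξ i : ℂ) * (x i : ℂ)) * f x

theorem eFun_zero : eFun 0 = 1 := by simp [eFun]

theorem eFun_add (a b : ℂ) : eFun (a + b) = eFun a * eFun b := by
  rw [eFun, eFun, eFun, ← Complex.exp_add]; congr 1; ring

theorem eFun_int (m : ℤ) : eFun m = 1 := by
  rw [eFun, Complex.exp_eq_one_iff]; exact ⟨m, by ring⟩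

theorem norm_eFun_ofReal (t : ℝ) : ‖eFun (t : ℂ)‖ = 1 := by
  rw [eFun, show 2 * (Real.pi : ℂ) * Complex.I * t = ((2 * Real.pi * t : ℝ) : ℂ) * Complex.I by
    push_cast; ring, Complex.norm_exp_ofReal_mul_I]

theorem continuous_eFun : Continuous eFun := by unfold eFun; fun_prop

theorem norm_eFun_dot {d : ℕ} (ξ x : Fin d → ℝ) :
    ‖eFun (∑ i, (ξ i : ℂ) * (x i : ℂ))‖ = 1 := by
  rw [← norm_eFun_ofReal (∑ i, ξ i * x i)]; push_cast; rfl

/-- The dot product on `ℝ^d` as a continuous bilinear map. -/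
def dotCLM (d : ℕ) : (Fin d → ℝ) →L[ℝ] (Fin d → ℝ) →L[ℝ] ℝ :=
  ∑ i : Fin d, (ContinuousLinearMap.proj (R := ℝ) (φ := fun _ : Fin d => ℝ) i).smulRight
      (ContinuousLinearMap.proj (R := ℝ) (φ := fun _ : Fin d => ℝ) i)

theorem dotCLM_apply {d : ℕ} (x y : Fin d → ℝ) : dotCLM d x y = ∑ i, x i * y i := by
  simp [dotCLM]

/-- The library transform has the opposite sign in the exponent, hence the argument `-ξ`. This makes
its decay estimates available. -/
theorem ft_eq_fourierIntegral {d : ℕ} (f : (Fin d → ℝ) → ℂ) (ξ : Fin d → ℝ) :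
    ft f ξ = VectorFourier.fourierIntegral Real.fourierChar volume (dotCLM d).toLinearMap₁₂ f (-ξ) := by
  unfold ft VectorFourier.fourierIntegral
  refine integral_congr_ae (Eventually.of_forall fun x => ?_)
  have h : -((dotCLM d).toLinearMap₁₂ x (-ξ)) = ∑ i, x i * ξ i := by
    change -(dotCLM d x (-ξ)) = _
    rw [map_neg, neg_neg, dotCLM_apply]
  simp only [h]
  rw [Circle.smul_def, Real.fourierChar_apply, smul_eq_mul, eFun]
  congr 2
  push_cast
  rw [Finset.mul_sum, Finset.mul_sum, Finset.sum_mul]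
  refine Finset.sum_congr rfl fun i _ => by ring

theorem hasCompactSupport_of_norm {d : ℕ} {f : (Fin d → ℝ) → ℂ} {R : ℝ}
    (hR : ∀ x, R < ‖x‖ → f x = 0) : HasCompactSupport f :=
  HasCompactSupport.of_support_subset_isCompact (isCompact_closedBall 0 R) fun x hx => by
    by_contra h
    exact hx (hR x (by simpa using h))

theorem norm_iteratedFDeriv_eq_zero {d : ℕ} {f : (Fin d → ℝ) → ℂ} {R : ℝ}
    (hR : ∀ x, R < ‖x‖ → f x = 0) (j : ℕ) {x : Fin d → ℝ} (hx : R < ‖x‖) :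
    iteratedFDeriv ℝ j f x = 0 := by
  have h1 : tsupport f ⊆ Metric.closedBall 0 R :=
    closure_minimal (fun x hx => by
      by_contra h
      exact hx (hR x (by simpa using h))) Metric.isClosed_closedBall
  by_contra h
  have := h1 (support_iteratedFDeriv_subset (𝕜 := ℝ) j (Function.mem_support.2 h))
  rw [mem_closedBall_zero_iff] at this
  linarith

/-- Integration by parts trades `M` derivatives for `M` powers of the frequency, and the support in
a ball of radius `R` turns sup bounds into L¹ bounds. That `K` does not depend on `f` gives both
continuity in `f` and locally uniform bounds in a parameter. -/
theorem norm_ft_le (d M : ℕ) (R : ℝ) : ∃ K : ℝ, 0 ≤ K ∧ ∀ f : (Fin d → ℝ) → ℂ, ContDiff ℝ ∞ f →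
    (∀ x, R < ‖x‖ → f x = 0) → ∀ C : ℝ, (∀ j ≤ M, ∀ x, ‖iteratedFDeriv ℝ j f x‖ ≤ C) →
    ∀ ξ, ‖ft f ξ‖ ≤ K * C * (1 + ‖ξ‖) ^ (-(M : ℝ)) := by
  let V : ℝ := (volume (Metric.closedBall (0 : Fin d → ℝ) R)).toReal
  refine ⟨2 ^ M * (2 ^ M * ((M + 1) * V) + V), by positivity, fun f hf hR C hC ξ => ?_⟩
  have hC0 : 0 ≤ C := (norm_nonneg _).trans (hC 0 (Nat.zero_le _) 0)
  have hcs := hasCompactSupport_of_norm hR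
  have hInt : ∀ j : ℕ, Integrable fun x => ‖iteratedFDeriv ℝ j f x‖ := fun j =>
    ((hf.continuous_iteratedFDeriv (by exact_mod_cast le_top)).norm).integrable_of_hasCompactSupport
      (hcs.iteratedFDeriv (𝕜 := ℝ) j).norm
  have hI : ∀ j ≤ M, ∫ x, ‖iteratedFDeriv ℝ j f x‖ ≤ C * V := by
    intro j hj
    have h1 : ∫ x, ‖iteratedFDeriv ℝ j f x‖ =
        ∫ x in Metric.closedBall (0 : Fin d → ℝ) R, ‖iteratedFDeriv ℝ j f x‖ := by
      rw [setIntegral_eq_integral_of_forall_compl_eq_zero]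
      intro x hx
      rw [norm_iteratedFDeriv_eq_zero hR j (by simpa using hx), norm_zero]
    rw [h1]
    refine (le_abs_self _).trans ?_
    exact norm_setIntegral_le_of_norm_le_const (μ := volume)
      (s := Metric.closedBall (0 : Fin d → ℝ) R) (f := fun x => ‖iteratedFDeriv ℝ j f x‖)
      (isCompact_closedBall (0 : Fin d → ℝ) R).measure_lt_top fun x _ => by
        rw [norm_norm]; exact hC j hj x
  have hV : 0 ≤ V := ENNReal.toReal_nonneg
  have key : ∀ (m : ℕ), m ≤ M → ∀ v : Fin d → ℝ, |dotCLM d v (-ξ)| ^ m * ‖ft f ξ‖ ≤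
      ‖v‖ ^ m * (2 ^ m * ((m + 1) * (C * V))) := by
    intro m hm v
    have h := VectorFourier.pow_mul_norm_iteratedFDeriv_fourierIntegral_le (dotCLM d)
      (μ := volume) (K := 0) (N := ⊤) (f := f) hf (fun k n hk _ => by
        have : k = 0 := by simpa using hk
        subst this
        simpa using hInt n) (k := 0) (n := m) le_rfl le_top v (-ξ)
    rw [norm_iteratedFDeriv_zero, ← ft_eq_fourierIntegral] at h
    refine h.trans ?_
    simp only [zero_add, pow_zero, mul_one, Nat.cast_zero, mul_zero, mul_assoc]
    gcongr
    rw [Finset.sum_product]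
    simp only [Finset.range_one, Finset.sum_singleton, pow_zero, one_mul]
    refine (Finset.sum_le_card_nsmul _ _ (C * V) fun j hj => hI j ?_).trans ?_
    · have := Finset.mem_range.1 hj; omega
    · simp
  have h0 := key 0 (Nat.zero_le _) 0
  simp only [pow_zero, one_mul, Nat.cast_zero, zero_add] at h0
  have hM : ‖ξ‖ ^ M * ‖ft f ξ‖ ≤ 2 ^ M * ((M + 1) * (C * V)) := by
    rcases isEmpty_or_nonempty (Fin d) with he | he
    · have : ‖ξ‖ = 0 := by simp [Subsingleton.elim ξ 0]
      rw [this]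
      rcases Nat.eq_zero_or_pos M with rfl | hM
      · simpa using h0
      · rw [zero_pow hM.ne', zero_mul]; positivity
    · obtain ⟨i, hi⟩ : ∃ i, ‖ξ‖ = ‖ξ i‖ := by
        obtain ⟨i, _, hi⟩ := Finset.exists_mem_eq_sup Finset.univ Finset.univ_nonempty
          (fun i => ‖ξ i‖₊)
        exact ⟨i, by rw [Pi.norm_def, hi]; rfl⟩
      -- Differentiating along the coordinate where the sup norm of `ξ` is attained produces exactly
      -- `‖ξ‖ ^ M`.
      have h := key M le_rfl (Pi.single i 1)
      have h2 : dotCLM d (Pi.single i 1) (-ξ) = -ξ i := by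
        rw [dotCLM_apply]; simp [Pi.single_apply]
      rw [h2, abs_neg, Pi.norm_single, norm_one, one_pow, one_mul] at h
      rw [hi]; exact h
  have hpos : (0 : ℝ) < 1 + ‖ξ‖ := by positivity
  rw [Real.rpow_neg hpos.le, Real.rpow_natCast, ← div_eq_mul_inv, le_div_iff₀ (by positivity)]
  have h3 : (1 + ‖ξ‖) ^ M ≤ 2 ^ M * (1 + ‖ξ‖ ^ M) := by
    rcases le_total ‖ξ‖ 1 with h | h
    · calc (1 + ‖ξ‖) ^ M ≤ 2 ^ M := pow_le_pow_left₀ hpos.le (by linarith) _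
        _ ≤ 2 ^ M * (1 + ‖ξ‖ ^ M) := le_mul_of_one_le_right (by positivity)
          (by linarith [pow_nonneg (norm_nonneg ξ) M])
    · calc (1 + ‖ξ‖) ^ M ≤ (2 * ‖ξ‖) ^ M := pow_le_pow_left₀ hpos.le (by linarith) _
        _ = 2 ^ M * ‖ξ‖ ^ M := mul_pow _ _ _
        _ ≤ 2 ^ M * (1 + ‖ξ‖ ^ M) := by gcongr; linarith
  calc ‖ft f ξ‖ * (1 + ‖ξ‖) ^ M ≤ ‖ft f ξ‖ * (2 ^ M * (1 + ‖ξ‖ ^ M)) := by gcongr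
    _ = 2 ^ M * (‖ξ‖ ^ M * ‖ft f ξ‖ + ‖ft f ξ‖) := by ring
    _ ≤ 2 ^ M * (2 ^ M * ((M + 1) * (C * V)) + C * V) := by gcongr
    _ = _ := by ring


/-! ### Poisson summation on `ℝ^d` -/

theorem periodization_locallyFinite {d : ℕ} {f : (Fin d → ℝ) → ℂ} {R : ℝ}
    (hR : ∀ x, R < ‖x‖ → f x = 0) :
    LocallyFinite fun m : Fin d → ℤ =>
      Function.support fun x : Fin d → ℝ => f (x + fun i => (m i : ℝ)) := by
  intro x
  refine ⟨Metric.ball x 1, Metric.ball_mem_nhds x one_pos,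
    (finite_norm_le (R + ‖x‖ + 1)).subset ?_⟩
  rintro m ⟨y, hy, hy'⟩
  have h1 : ‖y + fun i => (m i : ℝ)‖ ≤ R := by
    by_contra h
    exact hy (hR _ (not_le.1 h))
  have h2 : ‖y‖ ≤ ‖x‖ + 1 := by
    have := norm_le_norm_add_norm_sub' y x
    rw [mem_ball_iff_norm] at hy'
    linarith
  have h3 : ‖fun i => (m i : ℝ)‖ ≤ ‖y + fun i => (m i : ℝ)‖ + ‖y‖ := by
    have := norm_sub_le (y + fun i => (m i : ℝ)) y
    rwa [add_sub_cancel_left] at this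
  rw [norm_intCast_pi] at h3
  change ‖m‖ ≤ _
  linarith

theorem continuous_periodization {d : ℕ} {f : (Fin d → ℝ) → ℂ} (hf : Continuous f) {R : ℝ}
    (hR : ∀ x, R < ‖x‖ → f x = 0) :
    Continuous fun x : Fin d → ℝ => ∑' m : Fin d → ℤ, f (x + fun i => (m i : ℝ)) := by
  have hl := periodization_locallyFinite hR
  have h1 : (fun x : Fin d → ℝ => ∑' m : Fin d → ℤ, f (x + fun i => (m i : ℝ))) =
      fun x => ∑ᶠ m : Fin d → ℤ, f (x + fun i => (m i : ℝ)) := by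
    funext x
    exact tsum_eq_finsum (hl.point_finite x)
  rw [h1]
  exact continuous_finsum (fun m => by fun_prop) hl

theorem mFourier_coe {d : ℕ} (n : Fin d → ℤ) (x : Fin d → ℝ) :
    UnitAddTorus.mFourier n (fun i => (x i : UnitAddCircle)) =
      eFun (∑ i, (n i : ℂ) * (x i : ℂ)) := by
  change ∏ i, fourier (n i) (x i : UnitAddCircle) = _
  simp only [fourier_coe_apply]
  rw [← Complex.exp_sum, eFun, Finset.mul_sum]
  congr 1
  refine Finset.sum_congr rfl fun i _ => ?_
  push_cast
  ring

/-- The integral translates of the half-open unit box tile ℝᵈ; this is the unfolding step of Poisson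
summation. -/
theorem hasSum_setIntegral_box {d : ℕ} {E : Type*} [NormedAddCommGroup E] [NormedSpace ℝ E]
    {g : (Fin d → ℝ) → E} (hg : Integrable g) :
    HasSum (fun m : Fin d → ℤ => ∫ x in {x : Fin d → ℝ | ∀ i, x i ∈ Ioc ((0 : Fin d → ℝ) i)
      ((0 : Fin d → ℝ) i + 1)}, g (x + fun i => (m i : ℝ))) (∫ x, g x) := by
  let S : (Fin d → ℤ) → Set (Fin d → ℝ) := fun m => {x | ∀ i, x i ∈ Ioc (m i : ℝ) (m i + 1)}
  have hSm : ∀ m, MeasurableSet (S m) := fun m =>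
    MeasurableSet.univ_pi' fun i => measurableSet_Ioc
  have hS : ⋃ m, S m = univ := by
    refine eq_univ_of_forall fun x => mem_iUnion.2 ⟨fun i => ⌈x i⌉ - 1, fun i => ?_⟩
    push_cast
    exact ⟨by linarith [Int.ceil_lt_add_one (x i)], by linarith [Int.le_ceil (x i)]⟩
  have hd : Pairwise (Function.onFun Disjoint S) := by
    intro m m' hmm
    refine Set.disjoint_left.2 fun x hx hx' => hmm (funext fun i => ?_)
    have h1 := hx i
    have h2 := hx' i
    have h3 : ((m i : ℤ) : ℝ) < m' i + 1 := h1.1.trans_le h2.2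
    have h4 : ((m' i : ℤ) : ℝ) < m i + 1 := h2.1.trans_le h1.2
    have h5 : m i < m' i + 1 := by exact_mod_cast h3
    have h6 : m' i < m i + 1 := by exact_mod_cast h4
    omega
  have h := hasSum_integral_iUnion (μ := volume) (f := g) hSm hd (by
    rw [hS]; exact hg.integrableOn)
  rw [hS, setIntegral_univ] at h
  refine h.congr_fun fun m => ?_
  have hp := (measurePreserving_add_right (volume : Measure (Fin d → ℝ))
    (fun i => (m i : ℝ))).setIntegral_preimage_emb
      (MeasurableEquiv.addRight (fun i => (m i : ℝ))).measurableEmbedding g (S m)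
  rw [← hp]
  congr 2
  ext x
  refine forall_congr' fun i => ?_
  simp only [Pi.zero_apply, zero_add, mem_Ioc, Pi.add_apply]
  constructor <;> rintro ⟨h1, h2⟩ <;> constructor <;> linarith

theorem eFun_dot_add_int {d : ℕ} (n m : Fin d → ℤ) (x : Fin d → ℝ) :
    eFun (∑ i, (n i : ℂ) * ((x + fun i => (m i : ℝ)) i : ℝ)) =
      eFun (∑ i, (n i : ℂ) * (x i : ℂ)) := by
  have : ∑ i, (n i : ℂ) * ((x + fun i => (m i : ℝ)) i : ℝ) =
      ∑ i, (n i : ℂ) * (x i : ℂ) + ((∑ i, n i * m i : ℤ) : ℂ) := by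
    push_cast
    rw [← Finset.sum_add_distrib]
    refine Finset.sum_congr rfl fun i _ => ?_
    simp [mul_add]
  rw [this, eFun_add, eFun_int, mul_one]

/-- Poisson summation for compactly supported continuous functions with summable Fourier
coefficients. -/
theorem hasSum_poisson {d : ℕ} {f : (Fin d → ℝ) → ℂ} (hf : Continuous f) {R : ℝ}
    (hR : ∀ x, R < ‖x‖ → f x = 0)
    (hs : Summable fun r : Fin d → ℤ => ft f fun i => (r i : ℝ)) (x : Fin d → ℝ) :
    HasSum (fun r : Fin d → ℤ => ft f (fun i => (r i : ℝ)) * eFun (-∑ i, (r i : ℂ) * (x i : ℂ)))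
      (∑' m : Fin d → ℤ, f (x + fun i => (m i : ℝ))) := by
  classical
  let per : (Fin d → ℝ) → ℂ := fun x => ∑' m : Fin d → ℤ, f (x + fun i => (m i : ℝ))
  have hper : Continuous per := continuous_periodization hf hR
  let π : (Fin d → ℝ) → UnitAddTorus (Fin d) := fun x i => (x i : UnitAddCircle)
  have hπ : IsOpenQuotientMap π :=
    IsOpenQuotientMap.piMap fun _ => QuotientAddGroup.isOpenQuotientMap_mk
  have hinv : ∀ y z, π y = π z → per y = per z := by
    intro y z hyz
    have h1 : ∀ i, ∃ m : ℤ, z i + m = y i := by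
      intro i
      have h2 : ((y i : ℝ) : UnitAddCircle) = (z i : ℝ) := congrFun hyz i
      rw [QuotientAddGroup.eq] at h2
      obtain ⟨m, hm⟩ := AddSubgroup.mem_zmultiples_iff.1 h2
      refine ⟨-m, ?_⟩
      simp only [zsmul_eq_mul, mul_one] at hm
      push_cast
      linarith
    choose m hm using h1
    have h3 : y = z + fun i => (m i : ℝ) := by funext i; exact (hm i).symm
    rw [h3]
    simp only [per]
    rw [← (Equiv.addLeft m).tsum_eq (fun m' : Fin d → ℤ => f (z + fun i => (m' i : ℝ)))]
    refine tsum_congr fun m' => ?_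
    congr 1
    funext i
    simp [add_assoc]
  -- The periodization descends to the torus through an arbitrary section of the quotient map;
  -- continuity follows because the quotient map is open and the periodization is constant on
  -- fibres.
  let F : C(UnitAddTorus (Fin d), ℂ) :=
    { toFun := fun t => per (Function.surjInv hπ.surjective t)
      continuous_toFun := by
        rw [hπ.isQuotientMap.continuous_iff]
        convert hper using 1
        funext y
        exact hinv _ _ (Function.surjInv_eq hπ.surjective _) }
  have hF : ∀ y, F (π y) = per y := fun y => hinv _ _ (Function.surjInv_eq hπ.surjective _)
  have hfi : Integrable f := hf.integrable_of_hasCompactSupport (hasCompactSupport_of_norm hR)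
  -- Unfolding: the exponential is ℤᵈ-periodic, so the coefficient of the periodization is an
  -- integral of `f` over all of ℝᵈ.
  have hcoef : ∀ n : Fin d → ℤ, UnitAddTorus.mFourierCoeff F n = ft f fun i => ((-n) i : ℝ) := by
    intro n
    rw [UnitAddTorus.mFourierCoeff_eq_integral _ _ 0]
    let g : (Fin d → ℝ) → ℂ := fun x => eFun (∑ i, ((-n) i : ℂ) * (x i : ℂ)) * f x
    have hg : Integrable g := by
      refine (hfi.norm).mono' ?_ (Eventually.of_forall fun y => ?_)
      · exact ((continuous_eFun.comp (by fun_prop)).mul hf).aestronglyMeasurable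
      · have := norm_eFun_dot (fun i => ((-n) i : ℝ)) y
        simp only [Complex.ofReal_intCast] at this
        rw [norm_mul, this, one_mul]
    have h1 := hasSum_setIntegral_box hg
    have h2 := hasSum_integral_of_summable_integral_norm
      (μ := volume.restrict {x : Fin d → ℝ | ∀ i, x i ∈ Ioc ((0 : Fin d → ℝ) i)
        ((0 : Fin d → ℝ) i + 1)})
      (F := fun (m : Fin d → ℤ) x => g (x + fun i => (m i : ℝ)))
      (fun m => (hg.comp_add_right _).integrableOn) (hasSum_setIntegral_box hg.norm).summable
    have h3 := h1.unique h2
    have h4 : (ft f fun i => ((-n) i : ℝ)) = ∫ x, g x := by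
      unfold ft
      simp [g]
    rw [h4, h3]
    refine integral_congr_ae (Eventually.of_forall fun y => ?_)
    simp only [g]
    have h5 : F (fun i => (y i : UnitAddCircle)) = per y := hF y
    simp only [eFun_dot_add_int]
    rw [h5, mFourier_coe, tsum_mul_left, smul_eq_mul]
  have hsum : Summable (UnitAddTorus.mFourierCoeff F) := by
    simp only [funext hcoef]
    exact ((Equiv.neg (Fin d → ℤ)).summable_iff
      (f := fun r : Fin d → ℤ => ft f fun i => (r i : ℝ))).2 hs
  have h := UnitAddTorus.hasSum_mFourier_series_apply_of_summable hsum (π x)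
  rw [hF] at h
  rw [← (Equiv.neg (Fin d → ℤ)).hasSum_iff]
  convert h using 1
  funext r
  rw [hcoef, mFourier_coe, smul_eq_mul]
  simp [Function.comp]

theorem exists_bound_iteratedFDeriv {d : ℕ} {f : (Fin d → ℝ) → ℂ} (hf : ContDiff ℝ ∞ f)
    (hc : HasCompactSupport f) (M : ℕ) : ∃ C, ∀ j ≤ M, ∀ x, ‖iteratedFDeriv ℝ j f x‖ ≤ C := by
  have h : ∀ j : ℕ, ∃ C, ∀ x, ‖iteratedFDeriv ℝ j f x‖ ≤ C := fun j =>
    (hc.iteratedFDeriv (𝕜 := ℝ) j).exists_bound_of_continuous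
      (hf.continuous_iteratedFDeriv (by exact_mod_cast le_top))
  choose C hC using h
  refine ⟨∑ j ∈ Finset.range (M + 1), C j, fun j hj x => (hC j x).trans ?_⟩
  exact Finset.single_le_sum (f := C) (fun i _ => (norm_nonneg _).trans (hC i 0))
    (Finset.mem_range.2 (by omega))

theorem exists_norm_ft_le {d : ℕ} {f : (Fin d → ℝ) → ℂ} (hf : ContDiff ℝ ∞ f)
    (hc : HasCompactSupport f) (M : ℕ) :
    ∃ C, 0 ≤ C ∧ ∀ ξ, ‖ft f ξ‖ ≤ C * (1 + ‖ξ‖) ^ (-(M : ℝ)) := by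
  obtain ⟨R, hR⟩ := hc.isCompact.isBounded.exists_norm_le
  obtain ⟨K, hK, h⟩ := norm_ft_le d M R
  obtain ⟨C, hC⟩ := exists_bound_iteratedFDeriv hf hc M
  refine ⟨K * C, mul_nonneg hK ((norm_nonneg _).trans (hC 0 (Nat.zero_le _) 0)), h f hf ?_ C hC⟩
  intro x hx
  by_contra h0
  exact absurd (hR x (subset_tsupport f h0)) (not_le.2 hx)

theorem ft_comp_smul {d : ℕ} (f : (Fin d → ℝ) → ℂ) {a : ℝ} (ha : 0 < a) (ξ : Fin d → ℝ) :
    ft (fun x => f (a • x)) ξ = ((a ^ d)⁻¹ : ℝ) * ft f (a⁻¹ • ξ) := by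
  have h := Measure.integral_comp_smul (volume : Measure (Fin d → ℝ))
    (fun x => eFun (∑ i, ((a⁻¹ • ξ) i : ℂ) * (x i : ℂ)) * f x) a
  rw [Module.finrank_fin_fun, abs_of_pos (by positivity), Complex.real_smul] at h
  unfold ft
  rw [← h]
  refine integral_congr_ae (Eventually.of_forall fun x => ?_)
  have ha' : (a : ℂ) ≠ 0 := by exact_mod_cast ha.ne'
  simp only
  congr 2
  refine Finset.sum_congr rfl fun i _ => ?_
  simp only [Pi.smul_apply, smul_eq_mul]
  push_cast
  field_simp

/-- Rescaling the frequency by `a⁻¹` costs only the constant `(1 + a) ^ M`, because `(1 + t / a) (1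
+ a) ≥ 1 + t`. -/
theorem one_add_div_rpow_le {a t M : ℝ} (ha : 0 < a) (ht : 0 ≤ t) (hM : 0 ≤ M) :
    (1 + a⁻¹ * t) ^ (-M) ≤ (1 + a) ^ M * (1 + t) ^ (-M) := by
  have h1 : (1 + t) / (1 + a) ≤ 1 + a⁻¹ * t := by
    rw [div_le_iff₀ (by positivity)]
    have : a⁻¹ * a = 1 := inv_mul_cancel₀ ha.ne'
    have h2 : 0 ≤ a⁻¹ * t := by positivity
    nlinarith
  calc (1 + a⁻¹ * t) ^ (-M) ≤ ((1 + t) / (1 + a)) ^ (-M) :=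
        Real.rpow_le_rpow_of_nonpos (by positivity) h1 (by linarith)
    _ = (1 + a) ^ M * (1 + t) ^ (-M) := by
        rw [Real.div_rpow (by positivity) (by positivity), Real.rpow_neg (by positivity : 0 ≤ 1 + a)]
        field_simp

/-- Poisson summation over a scaled and shifted lattice. -/
theorem hasSum_poisson_smul {d : ℕ} {f : (Fin d → ℝ) → ℂ} (hf : ContDiff ℝ ∞ f)
    (hc : HasCompactSupport f) {a : ℝ} (ha : 0 < a) (x : Fin d → ℝ) :
    HasSum (fun r : Fin d → ℤ => ((a ^ d)⁻¹ : ℝ) * ft f (a⁻¹ • fun i => (r i : ℝ)) *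
        eFun (-∑ i, (r i : ℂ) * (x i : ℂ)))
      (∑' m : Fin d → ℤ, f (a • (x + fun i => (m i : ℝ)))) := by
  obtain ⟨R, hR⟩ := hc.isCompact.isBounded.exists_norm_le
  obtain ⟨C, hC0, hC⟩ := exists_norm_ft_le hf hc (d + 1)
  have h := hasSum_poisson (f := fun x => f (a • x)) (hf.continuous.comp (by fun_prop))
    (R := R / a) (fun y hy => by
      by_contra h0
      have := hR _ (subset_tsupport f h0)
      rw [norm_smul, Real.norm_of_nonneg ha.le] at this
      rw [div_lt_iff₀ ha] at hy
      linarith) ?_ x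
  · simpa only [ft_comp_smul f ha] using h
  · simp only [ft_comp_smul f ha]
    refine Summable.mul_left _ ?_
    refine Summable.of_norm_bounded (g := fun r : Fin d → ℤ =>
      C * ((1 + a) ^ ((d + 1 : ℕ) : ℝ) * (1 + ‖r‖) ^ (-((d + 1 : ℕ) : ℝ))))
      (((summable_one_add_norm_rpow (by push_cast; linarith)).mul_left _).mul_left _) fun r => ?_
    refine (hC _).trans ?_
    rw [norm_smul, norm_intCast_pi, Real.norm_of_nonneg (by positivity)]
    gcongr
    exact one_add_div_rpow_le ha (norm_nonneg _) (by positivity)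

/-! ### Theta sums attached to a Dirichlet character -/

section Theta

variable {d N : ℕ} [NeZero d] [NeZero N] (ψ : DirichletCharacter ℂ N)

open Classical in
/-- The weight `ψ(v_0)` on the vectors of `ℤ^d` all of whose other entries are divisible by `N`. -/
def coef (v : Fin d → ℤ) : ℂ :=
  if ∀ i, i ≠ 0 → (N : ℤ) ∣ v i then ψ ((v 0 : ℤ) : ZMod N) else 0

theorem norm_coef_le (v : Fin d → ℤ) : ‖coef ψ v‖ ≤ 1 := by
  unfold coef
  split_ifs
  · exact ψ.norm_le_one _
  · simp

/-- The sum of `coef v * f (t v)` over the lattice. -/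
def thetaSum (f : (Fin d → ℝ) → ℂ) (t : ℝ) : ℂ :=
  ∑' v : Fin d → ℤ, coef ψ v * f (t • fun i => (v i : ℝ))

/-- The lattice vector with residue class `a` of the `0`-th entry and quotient vector `m`. -/
def residueVec (p : ZMod N × (Fin d → ℤ)) : Fin d → ℤ :=
  fun i => (if i = 0 then (p.1.val : ℤ) else 0) + N * p.2 i

theorem residueVec_injective : Function.Injective (residueVec (d := d) (N := N)) := by
  rintro ⟨a, m⟩ ⟨b, l⟩ h
  have hN : (N : ℤ) ≠ 0 := by exact_mod_cast NeZero.ne N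
  have h0 := congrFun h 0
  simp only [residueVec, if_true] at h0
  have hab : a = b := by
    have := congrArg (Int.cast : ℤ → ZMod N) h0
    simpa using this
  subst hab
  congr 1
  funext i
  have := congrFun h i
  simp only [residueVec, add_right_inj] at this
  exact mul_left_cancel₀ hN this

theorem coef_residueVec (p : ZMod N × (Fin d → ℤ)) : coef ψ (residueVec p) = ψ p.1 := by
  unfold coef
  rw [if_pos]
  · simp [residueVec]
  · intro i hi
    simp [residueVec, hi]

theorem coef_eq_zero {v : Fin d → ℤ} (hv : v ∉ range (residueVec (d := d) (N := N))) :
    coef ψ v = 0 := by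
  unfold coef
  rw [if_neg]
  intro h
  refine hv ⟨(((v 0 : ℤ) : ZMod N), fun i => v i / N), ?_⟩
  funext i
  by_cases hi : i = 0
  · subst hi
    simp only [residueVec, if_true, ZMod.val_intCast]
    exact Int.emod_add_mul_ediv _ _
  · simp only [residueVec, if_neg hi, zero_add]
    exact Int.mul_ediv_cancel' (h i hi)

theorem finite_support_comp_smul {f : (Fin d → ℝ) → ℂ} (hc : HasCompactSupport f) {t : ℝ}
    (ht : 0 < t) : (Function.support fun v : Fin d → ℤ => f (t • fun i => (v i : ℝ))).Finite := by
  obtain ⟨R, hR⟩ := hc.isCompact.isBounded.exists_norm_le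
  refine (finite_norm_le (R / t)).subset fun v hv => ?_
  have := hR _ (subset_tsupport f hv)
  rw [norm_smul, norm_intCast_pi, Real.norm_of_nonneg ht.le] at this
  change ‖v‖ ≤ _
  rw [le_div_iff₀ ht]
  linarith

theorem summable_thetaSum {f : (Fin d → ℝ) → ℂ} (hc : HasCompactSupport f) {t : ℝ} (ht : 0 < t) :
    Summable fun v : Fin d → ℤ => coef ψ v * f (t • fun i => (v i : ℝ)) :=
  summable_of_hasFiniteSupport ((finite_support_comp_smul hc ht).subset fun _ hv =>
    right_ne_zero_of_mul hv)

/-- Sorting by the residue class of the `0`-th entry makes the weight constant on each class and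
leaves a sum over a shifted, scaled copy of ℤᵈ, to which Poisson summation applies. -/
theorem thetaSum_eq_residues {f : (Fin d → ℝ) → ℂ} (hc : HasCompactSupport f) {t : ℝ}
    (ht : 0 < t) : thetaSum ψ f t = ∑ a : ZMod N, ψ a * ∑' m : Fin d → ℤ,
      f ((t * N) • ((fun i => if i = 0 then (a.val : ℝ) / N else 0) + fun i => (m i : ℝ))) := by
  have hN : (N : ℝ) ≠ 0 := by exact_mod_cast NeZero.ne N
  have hvec : ∀ p : ZMod N × (Fin d → ℤ), (t • fun i => (residueVec p i : ℝ)) =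
      (t * N) • ((fun i => if i = 0 then (p.1.val : ℝ) / N else 0) + fun i => (p.2 i : ℝ)) := by
    intro p
    funext i
    simp only [residueVec, Pi.smul_apply, Pi.add_apply, smul_eq_mul]
    split_ifs
    · push_cast; field_simp
    · push_cast; ring
  have h1 : thetaSum ψ f t = ∑' p : ZMod N × (Fin d → ℤ),
      ψ p.1 * f ((t * N) • ((fun i => if i = 0 then (p.1.val : ℝ) / N else 0) +
        fun i => (p.2 i : ℝ))) := by
    unfold thetaSum
    rw [← (residueVec_injective (d := d) (N := N)).tsum_eq]
    · simp only [coef_residueVec, hvec]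
    · intro v hv
      by_contra h
      exact hv (by simp [coef_eq_zero ψ h])
  have hs : Summable fun p : ZMod N × (Fin d → ℤ) =>
      ψ p.1 * f ((t * N) • ((fun i => if i = 0 then (p.1.val : ℝ) / N else 0) +
        fun i => (p.2 i : ℝ))) := by
    have := (summable_thetaSum ψ hc ht).comp_injective (residueVec_injective (d := d) (N := N))
    simpa only [Function.comp_def, coef_residueVec, hvec] using this
  rw [h1, hs.tsum_prod, tsum_fintype]
  simp only [tsum_mul_left]

/-- Poisson summation for theta sums. -/
theorem hasSum_thetaSum {f : (Fin d → ℝ) → ℂ} (hf : ContDiff ℝ ∞ f) (hc : HasCompactSupport f)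
    {t : ℝ} (ht : 0 < t) :
    HasSum (fun r : Fin d → ℤ => (((t * N) ^ d)⁻¹ : ℝ) * psiHat ψ (-r 0) *
      ft f ((t * N)⁻¹ • fun i => (r i : ℝ))) (thetaSum ψ f t) := by
  have hN : (0 : ℝ) < N := by exact_mod_cast NeZero.pos N
  rw [thetaSum_eq_residues ψ hc ht]
  have h := hasSum_sum (s := Finset.univ) fun (a : ZMod N) _ =>
    (hasSum_poisson_smul hf hc (mul_pos ht hN)
      (fun i => if i = 0 then (a.val : ℝ) / N else 0)).mul_left (ψ a)
  refine h.congr_fun fun r => ?_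
  rw [psiHat, Finset.mul_sum, Finset.sum_mul]
  refine Finset.sum_congr rfl fun a _ => ?_
  have : -∑ i, (r i : ℂ) * ((if i = 0 then (a.val : ℝ) / N else 0 : ℝ) : ℂ) =
      (a.val : ℂ) * ((-r 0 : ℤ) : ℂ) / N := by
    rw [Finset.sum_eq_single 0]
    · rw [if_pos rfl]; push_cast; ring
    · intro i _ hi; simp [hi]
    · simp
  rw [this]
  ring

theorem norm_psiHat_le (m : ℤ) : ‖psiHat ψ m‖ ≤ N := by
  unfold psiHat
  refine (norm_sum_le _ _).trans ?_
  refine (Finset.sum_le_card_nsmul _ _ 1 fun a _ => ?_).trans (by simp [ZMod.card])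
  rw [norm_mul, show ((a.val : ℂ) * m / N) = (((a.val : ℝ) * m / N : ℝ) : ℂ) by push_cast; rfl,
    norm_eFun_ofReal, mul_one]
  exact ψ.norm_le_one a

/-! ### Main term and remainder of a theta sum -/

variable (d) in
/-- The coefficient of the main term of a theta sum. -/
def thetaConst : ℂ := (N : ℂ) ^ (-(d : ℤ)) * ∑ a : ZMod N, ψ a

/-- The theta sum minus its main term. -/
def thetaRem (f : (Fin d → ℝ) → ℂ) (t : ℝ) : ℂ :=
  thetaSum ψ f t - thetaConst d ψ * ((t ^ d)⁻¹ : ℝ) * ∫ x, f x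

theorem ft_zero (f : (Fin d → ℝ) → ℂ) : ft f 0 = ∫ x, f x := by
  simp [ft, eFun_zero]

/-- In the Poisson expansion the frequency `0` is the main term. Every other frequency has norm at
least `1 / (t N)`, where decay of order `d + 1 + M` outweighs the covolume factor `t ^ (-d)`. -/
theorem norm_thetaRem_le (M : ℕ) (R : ℝ) : ∃ K : ℝ, 0 ≤ K ∧ ∀ f : (Fin d → ℝ) → ℂ,
    ContDiff ℝ ∞ f → (∀ x, R < ‖x‖ → f x = 0) → ∀ C : ℝ,
    (∀ j ≤ d + 1 + M, ∀ x, ‖iteratedFDeriv ℝ j f x‖ ≤ C) →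
    ∀ t, 0 < t → t ≤ 1 → ‖thetaRem ψ f t‖ ≤ K * C * t ^ M := by
  classical
  obtain ⟨K, hK, h⟩ := norm_ft_le d (d + 1 + M) R
  have hN : (0 : ℝ) < N := by exact_mod_cast NeZero.pos N
  let P : ℝ := ((d + 1 + M : ℕ) : ℝ)
  have hP : (d : ℝ) < P := by simp only [P]; push_cast; linarith [(Nat.cast_nonneg M : (0:ℝ) ≤ M)]
  let S : ℝ := ∑' r : Fin d → ℤ, (1 + ‖r‖) ^ (-P)
  have hS : 0 ≤ S := tsum_nonneg fun r => by positivity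
  refine ⟨(N ^ d : ℝ)⁻¹ * N * K * (2 * N) ^ (d + 1 + M) * S, by positivity,
    fun f hf hR C hC t ht ht1 => ?_⟩
  have hC0 : 0 ≤ C := (norm_nonneg _).trans (hC 0 (Nat.zero_le _) 0)
  have hc := hasCompactSupport_of_norm hR
  have hsum := hasSum_thetaSum ψ hf hc ht
  have hrem : HasSum (fun r : Fin d → ℤ => if r = 0 then 0 else (((t * N) ^ d)⁻¹ : ℝ) *
      psiHat ψ (-r 0) * ft f ((t * N)⁻¹ • fun i => (r i : ℝ))) (thetaRem ψ f t) := by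
    -- Replacing the term at frequency zero by zero subtracts exactly the main term from the theta
    -- sum.
    have h1 := hsum.update 0 0
    have h2 : (0 : ℂ) - (((t * N) ^ d)⁻¹ : ℝ) * psiHat ψ (-(0 : Fin d → ℤ) 0) *
        ft f ((t * N)⁻¹ • fun i => (((0 : Fin d → ℤ) i : ℤ) : ℝ)) + thetaSum ψ f t =
        thetaRem ψ f t := by
      have h3 : ((t * N)⁻¹ • fun i => (((0 : Fin d → ℤ) i : ℤ) : ℝ)) = (0 : Fin d → ℝ) := by
        funext i; simp
      rw [h3, ft_zero, thetaRem, thetaConst, psiHat]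
      simp only [Pi.zero_apply, neg_zero, Int.cast_zero, mul_zero, zero_div, eFun_zero, mul_one]
      rw [mul_pow, mul_inv]
      push_cast
      rw [zpow_neg, zpow_natCast]
      ring
    rw [h2] at h1
    refine h1.congr_fun fun r => ?_
    by_cases hr : r = 0
    · subst hr; simp
    · simp [hr]
  have hb : ∀ r : Fin d → ℤ, ‖(if r = 0 then 0 else (((t * N) ^ d)⁻¹ : ℝ) *
      psiHat ψ (-r 0) * ft f ((t * N)⁻¹ • fun i => (r i : ℝ)) : ℂ)‖ ≤
      ((t * N) ^ d)⁻¹ * N * (K * C * (2 * (t * N)) ^ (d + 1 + M)) * (1 + ‖r‖) ^ (-P) := by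
    intro r
    split_ifs with hr
    · rw [norm_zero]; positivity
    · have hr1 : 1 ≤ ‖r‖ := by
        by_contra hlt
        refine hr (funext fun i => ?_)
        have h1 := (norm_le_pi_norm r i).trans_lt (not_le.1 hlt)
        have h2 : ‖((r i : ℤ))‖ = |((r i : ℤ) : ℝ)| := rfl
        rw [h2] at h1
        have h3 : |r i| < 1 := by exact_mod_cast h1
        simpa using Int.abs_lt_one_iff.1 h3
      rw [norm_mul, norm_mul, Complex.norm_real, Real.norm_of_nonneg (by positivity), mul_assoc,
        mul_assoc, mul_assoc]
      have h4 : ‖(t * N)⁻¹ • fun i => (r i : ℝ)‖ = (t * N)⁻¹ * ‖r‖ := by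
        rw [norm_smul, norm_intCast_pi, Real.norm_of_nonneg (by positivity)]
      have h5 := h f hf hR C hC ((t * N)⁻¹ • fun i => (r i : ℝ))
      have h6 : (1 + ‖(t * N)⁻¹ • fun i => (r i : ℝ)‖) ^ (-P) ≤
          (2 * (t * N)) ^ (d + 1 + M) * (1 + ‖r‖) ^ (-P) := by
        -- Since `‖r‖ ≥ 1`, one has `1 + ‖r‖ ≤ 2 ‖r‖`; this is the source of the factor 2 in the
        -- constant.
        have h7 : (1 + ‖r‖) / (2 * (t * N)) ≤ 1 + ‖(t * N)⁻¹ • fun i => (r i : ℝ)‖ := by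
          rw [h4, div_le_iff₀ (by positivity)]
          have : (t * N)⁻¹ * (t * N) = 1 := inv_mul_cancel₀ (by positivity)
          have h8 : 0 < t * N := by positivity
          nlinarith
        refine (Real.rpow_le_rpow_of_nonpos (by positivity) h7
          (by simp only [P]; linarith [(Nat.cast_nonneg (d + 1 + M) : (0:ℝ) ≤ _)])).trans_eq ?_
        rw [Real.div_rpow (by positivity) (by positivity),
          Real.rpow_neg (by positivity : 0 ≤ 2 * (t * N)), Real.rpow_natCast]
        field_simp
      gcongr
      · exact norm_psiHat_le ψ _
      · refine h5.trans ?_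
        rw [mul_assoc (K * C)]
        exact mul_le_mul_of_nonneg_left h6 (by positivity)
  have hsumb := (summable_one_add_norm_rpow hP).mul_left
    (((t * N) ^ d)⁻¹ * N * (K * C * (2 * (t * N)) ^ (d + 1 + M)))
  have hle := tsum_of_norm_bounded hsumb.hasSum hb
  rw [hrem.tsum_eq, tsum_mul_left] at hle
  refine hle.trans ?_
  change ((t * N) ^ d)⁻¹ * N * (K * C * (2 * (t * N)) ^ (d + 1 + M)) * S ≤ _
  have h9 : ((t * N) ^ d)⁻¹ * N * (K * C * (2 * (t * N)) ^ (d + 1 + M)) * S =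
      ((N ^ d : ℝ)⁻¹ * N * K * (2 * N) ^ (d + 1 + M) * S) * C * t ^ (M + 1) := by
    -- Of the `d + 1 + M` powers of `t`, `d` cancel the covolume; the one beyond `M` is dropped at
    -- the end using `t ≤ 1`.
    have : (2 * (t * N)) ^ (d + 1 + M) = (2 * N) ^ (d + 1 + M) * (t ^ d * t ^ (M + 1)) := by
      rw [← pow_add, show d + (M + 1) = d + 1 + M by ring, ← mul_pow]; ring
    rw [this, mul_pow, mul_inv]
    field_simp
  rw [h9]
  refine mul_le_mul_of_nonneg_left ?_ (by positivity)
  rw [pow_succ]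
  exact mul_le_of_le_one_right (by positivity) ht1

end Theta

/-! ### Holomorphic dependence of integrals on a parameter -/

/-- By Cauchy's estimate, a bound for `f` on the unit ball bounds its derivative on the ball of
radius `1/2`, so no separate hypothesis on derivatives is needed. -/
theorem differentiable_integral_of_locally_bounded {α : Type*} [MeasurableSpace α] {μ : Measure α}
    {f : ℂ → α → ℂ} (hm : ∀ s, AEStronglyMeasurable (f s) μ)
    (hd : ∀ᵐ a ∂μ, Differentiable ℂ fun s => f s a)
    (hb : ∀ s₀, ∃ bound : α → ℝ, Integrable bound μ ∧
      ∀ᵐ a ∂μ, ∀ s ∈ Metric.closedBall s₀ 1, ‖f s a‖ ≤ bound a) :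
    Differentiable ℂ fun s => ∫ a, f s a ∂μ := by
  intro s₀
  obtain ⟨bound, hInt, hbd⟩ := hb s₀
  refine (hasDerivAt_integral_of_dominated_loc_of_deriv_le (s := Metric.ball s₀ (1 / 2))
    (F := f) (F' := fun s a => deriv (fun s => f s a) s) (bound := fun a => bound a / (1 / 2))
    (Metric.ball_mem_nhds _ (by norm_num)) (Eventually.of_forall hm)
    ?_ ?_ ?_ (hInt.div_const _) ?_).2.differentiableAt
  · refine hInt.mono' (hm s₀) ?_
    filter_upwards [hbd] with a ha
    exact ha s₀ (Metric.mem_closedBall_self (by norm_num))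
  -- The derivative at `s₀` is measurable as a pointwise limit of difference quotients along `1 / (n
  -- + 1)`.
  · refine aestronglyMeasurable_of_tendsto_ae atTop
      (f := fun (n : ℕ) a => ((1 / ((n : ℂ) + 1)))⁻¹ • (f (s₀ + 1 / ((n : ℂ) + 1)) a - f s₀ a))
      (fun n => AEStronglyMeasurable.const_smul
        ((hm (s₀ + 1 / ((n : ℂ) + 1))).sub (hm s₀)) ((1 / ((n : ℂ) + 1)))⁻¹) ?_
    filter_upwards [hd] with a ha
    have h1 := hasDerivAt_iff_tendsto_slope_zero.1 (ha s₀).hasDerivAt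
    refine h1.comp (tendsto_nhdsWithin_iff.2 ⟨?_, Eventually.of_forall fun n => ?_⟩)
    · exact tendsto_one_div_add_atTop_nhds_zero_nat
    · have : (n : ℂ) + 1 ≠ 0 := by exact_mod_cast Nat.succ_ne_zero n
      simpa using this
  · filter_upwards [hd, hbd] with a ha hb' s hs
    refine Complex.norm_deriv_le_of_forall_mem_sphere_norm_le (by norm_num)
      ha.diffContOnCl fun z hz => hb' z ?_
    rw [Metric.mem_closedBall]
    have h1 := Metric.mem_ball.1 hs
    have h2 := Metric.mem_sphere.1 hz
    linarith [dist_triangle z s s₀]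
  · filter_upwards [hd] with a ha s _
    exact (ha s).hasDerivAt

/-! ### A smooth radial cut-off -/

/-- Half of the logarithm of the sum of squares, i.e. the logarithm of the Euclidean norm. -/
def logNorm {d : ℕ} (x : Fin d → ℝ) : ℝ := Real.log (∑ i, x i ^ 2) / 2

/-- A bump function on the line supported in `(-2, -1)`. -/
def lineBump : ContDiffBump (-(3 / 2) : ℝ) := ⟨1 / 4, 1 / 2, by norm_num, by norm_num⟩

/-- The bump function normalised to have integral one. -/
def unitBump (t : ℝ) : ℝ := lineBump.normed volume t

theorem contDiff_unitBump : ContDiff ℝ ∞ unitBump := lineBump.contDiff_normed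

theorem unitBump_nonneg (t : ℝ) : 0 ≤ unitBump t := lineBump.nonneg_normed t

theorem integral_unitBump : ∫ t, unitBump t = 1 := lineBump.integral_normed

theorem unitBump_ne_zero_iff {t : ℝ} : unitBump t ≠ 0 ↔ -2 < t ∧ t < -1 := by
  have h : t ∈ Function.support (lineBump.normed volume) ↔ t ∈ Metric.ball (-(3 / 2) : ℝ) (1 / 2) := by
    rw [lineBump.support_normed_eq]; rfl
  rw [Metric.mem_ball, Real.dist_eq, abs_lt] at h
  refine h.trans ⟨fun h => ⟨?_, ?_⟩, fun h => ⟨?_, ?_⟩⟩ <;> linarith [h.1, h.2]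

theorem unitBump_eq_zero {t : ℝ} (h : -1 ≤ t) : unitBump t = 0 := by
  by_contra h0
  linarith [(unitBump_ne_zero_iff.1 h0).2]

theorem integrable_unitBump : Integrable unitBump :=
  lineBump.integrable_normed

section Cut

variable {d : ℕ}

/-- The radial cut-off, supported in the annulus `e⁻² < |x| < e⁻¹`. -/
def cut (x : Fin d → ℝ) : ℝ := unitBump (logNorm x)

theorem sum_sq_pos {x : Fin d → ℝ} (hx : x ≠ 0) : 0 < ∑ i, x i ^ 2 := by
  obtain ⟨i, hi⟩ := Function.ne_iff.1 hx
  exact Finset.sum_pos' (fun i _ => sq_nonneg _) ⟨i, Finset.mem_univ _, by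
    have : x i ≠ 0 := hi
    positivity⟩

theorem logNorm_nonneg_of_one_le {x : Fin d → ℝ} {i : Fin d} (hi : 1 ≤ |x i|) : 0 ≤ logNorm x := by
  refine div_nonneg (Real.log_nonneg ?_) (by norm_num)
  calc (1 : ℝ) ≤ x i ^ 2 := by rw [← sq_abs]; nlinarith
    _ ≤ ∑ i, x i ^ 2 := Finset.single_le_sum (f := fun i => x i ^ 2)
      (fun i _ => sq_nonneg _) (Finset.mem_univ i)

/-- Non-zero integral vectors have norm at least one, and at the origin the default `Real.log 0 = 0`
applies. The bump, supported to the left of `-1`, is thus traversed completely as `τ` runs over the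
positive half-line. -/
theorem logNorm_intCast_nonneg (v : Fin d → ℤ) : 0 ≤ logNorm fun i => (v i : ℝ) := by
  by_cases hv : v = 0
  · simp [hv, logNorm]
  · obtain ⟨i, hi⟩ := Function.ne_iff.1 hv
    refine logNorm_nonneg_of_one_le (i := i) ?_
    exact_mod_cast Int.one_le_abs hi

theorem logNorm_exp_smul {v : Fin d → ℝ} (hv : v ≠ 0) (τ : ℝ) :
    logNorm (Real.exp τ • v) = logNorm v + τ := by
  have h1 : ∑ i, (Real.exp τ • v) i ^ 2 = Real.exp (2 * τ) * ∑ i, v i ^ 2 := by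
    rw [Finset.mul_sum]
    refine Finset.sum_congr rfl fun i _ => ?_
    rw [Pi.smul_apply, smul_eq_mul, mul_pow, ← Real.exp_nat_mul]; norm_num
  rw [logNorm, h1, Real.log_mul (Real.exp_pos _).ne' (sum_sq_pos hv).ne', Real.log_exp, logNorm]
  ring

/-- The default `Real.log 0 = 0` places the origin outside the support of the bump. -/
theorem cut_zero : cut (0 : Fin d → ℝ) = 0 :=
  unitBump_eq_zero (by simp [logNorm])

theorem cut_nonneg (x : Fin d → ℝ) : 0 ≤ cut x := unitBump_nonneg _

theorem cut_eq_zero_of_norm {x : Fin d → ℝ} (hx : 1 < ‖x‖) : cut x = 0 := by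
  obtain ⟨i, hi⟩ : ∃ i, 1 < ‖x i‖ := by
    by_contra h
    push Not at h
    exact absurd ((pi_norm_le_iff_of_nonneg zero_le_one).2 h) (not_le.2 hx)
  exact unitBump_eq_zero (by linarith [logNorm_nonneg_of_one_le (i := i) (x := x) hi.le])

theorem contDiffAt_logNorm {x : Fin d → ℝ} (hx : x ≠ 0) :
    ContDiffAt ℝ ∞ (logNorm : (Fin d → ℝ) → ℝ) x := by
  unfold logNorm
  have h : ContDiff ℝ ∞ fun x : Fin d → ℝ => ∑ i, x i ^ 2 := by fun_prop
  exact (h.contDiffAt.log (sum_sq_pos hx).ne').div_const _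

theorem cut_eventually_zero : ∀ᶠ x : Fin d → ℝ in 𝓝 0, cut x = 0 := by
  -- The exponent `-4` is twice the left end `-2` of the support of the bump, as `logNorm` halves
  -- the logarithm of the sum of squares.
  have h : ∀ᶠ x : Fin d → ℝ in 𝓝 0, ∑ i, x i ^ 2 < Real.exp (-4) := by
    have hc : Continuous fun x : Fin d → ℝ => ∑ i, x i ^ 2 := by fun_prop
    refine (isOpen_lt hc continuous_const).mem_nhds ?_
    simp [Real.exp_pos]
  filter_upwards [h] with x hx
  by_cases h0 : x = 0
  · rw [h0, cut_zero]
  · by_contra h1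
    have h2 := (unitBump_ne_zero_iff.1 h1).1
    have h3 : Real.log (∑ i, x i ^ 2) < -4 := by
      rw [Real.log_lt_iff_lt_exp (sum_sq_pos h0)]; exact hx
    rw [logNorm] at h2
    linarith

theorem contDiff_cut : ContDiff ℝ ∞ (cut : (Fin d → ℝ) → ℝ) := by
  rw [contDiff_iff_contDiffAt]
  intro x
  by_cases hx : x = 0
  · subst hx
    exact contDiffAt_const.congr_of_eventuallyEq cut_eventually_zero
  · exact contDiff_unitBump.contDiffAt.comp x (contDiffAt_logNorm hx)

end Cut

/-! ### The continuation -/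

section Continuation

variable {d N : ℕ} [NeZero d] [NeZero N] (ψ : DirichletCharacter ℂ N)

/-- The analytically continued lattice sum attached to the localised function `φ`. -/
def continued (s : ℂ) (φ : (Fin d → ℝ) → ℂ) : ℂ :=
  1 / 2 * ((∫ τ in Ioi (0 : ℝ), Complex.exp (-s * τ) * thetaRem ψ φ (Real.exp (-τ))) +
    thetaConst d ψ * (∫ x, φ x) / (s - d))

theorem thetaSum_eq_sum {φ : (Fin d → ℝ) → ℂ} {R : ℝ} (hR : ∀ x, R < ‖x‖ → φ x = 0) {t₀ t : ℝ}
    (ht₀ : 0 < t₀) (ht : t₀ ≤ t) :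
    thetaSum ψ φ t = ∑ v ∈ (finite_norm_le (d := d) (|R| / t₀)).toFinset,
      coef ψ v * φ (t • fun i => (v i : ℝ)) := by
  refine tsum_eq_sum fun v hv => ?_
  rw [hR, mul_zero]
  have h1 : |R| / t₀ < ‖v‖ := by simpa using hv
  rw [norm_smul, norm_intCast_pi, Real.norm_of_nonneg (ht₀.le.trans ht)]
  rw [div_lt_iff₀ ht₀] at h1
  have : ‖v‖ * t₀ ≤ t * ‖v‖ := by rw [mul_comm]; gcongr
  linarith [le_abs_self R]

/-- While `exp (-τ)` stays bounded below, compact support leaves a fixed finite set of lattice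
vectors, so near each `τ₀` the theta sum is a finite sum of continuous functions. -/
theorem continuous_thetaRem_exp {φ : (Fin d → ℝ) → ℂ} (hφ : Continuous φ) {R : ℝ}
    (hR : ∀ x, R < ‖x‖ → φ x = 0) : Continuous fun τ : ℝ => thetaRem ψ φ (Real.exp (-τ)) := by
  unfold thetaRem
  refine Continuous.sub ?_ ?_
  · rw [continuous_iff_continuousAt]
    intro τ₀
    have h : ContinuousAt (fun τ : ℝ =>
        ∑ v ∈ (finite_norm_le (d := d) (|R| / Real.exp (-(τ₀ + 1)))).toFinset,
          coef ψ v * φ (Real.exp (-τ) • fun i => (v i : ℝ))) τ₀ := by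
      refine Continuous.continuousAt ?_
      fun_prop
    refine h.congr ?_
    filter_upwards [Iio_mem_nhds (show τ₀ < τ₀ + 1 by linarith)] with τ hτ
    exact (thetaSum_eq_sum ψ hR (Real.exp_pos _)
      (Real.exp_le_exp.2 (by linarith [show τ < τ₀ + 1 from hτ]))).symm
  · refine Continuous.mul (continuous_const.mul ?_) continuous_const
    refine Complex.continuous_ofReal.comp (Continuous.inv₀ (by fun_prop) fun τ => ?_)
    positivity

/-- A decay of order `M ≥ 1 - Re s` in `t = exp (-τ)` absorbs the growth of `exp (-s τ)` and still
leaves an integrable `exp (-τ)`. -/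
theorem norm_exp_mul_thetaRem_le (s : ℂ) {K C : ℝ} {M : ℕ} {φ : (Fin d → ℝ) → ℂ}
    (h : ∀ t, 0 < t → t ≤ 1 → ‖thetaRem ψ φ t‖ ≤ K * C * t ^ M)
    (hKC : 0 ≤ K * C) (hM : 1 - s.re ≤ M) {τ : ℝ} (hτ : 0 < τ) :
    ‖Complex.exp (-s * τ) * thetaRem ψ φ (Real.exp (-τ))‖ ≤ K * C * Real.exp (-1 * τ) := by
  have h1 : ‖Complex.exp (-s * τ)‖ = Real.exp (-s.re * τ) := by
    rw [Complex.norm_exp]; simp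
  have h2 := h (Real.exp (-τ)) (Real.exp_pos _) (Real.exp_le_one_iff.2 (by linarith))
  rw [norm_mul, h1]
  calc Real.exp (-s.re * τ) * ‖thetaRem ψ φ (Real.exp (-τ))‖
      ≤ Real.exp (-s.re * τ) * (K * C * Real.exp (-τ) ^ M) := by gcongr
    _ = K * C * Real.exp (-s.re * τ + M * -τ) := by
        rw [← Real.exp_nat_mul, Real.exp_add]; ring
    _ ≤ K * C * Real.exp (-1 * τ) := by
        refine mul_le_mul_of_nonneg_left (Real.exp_le_exp.2 ?_) hKC
        nlinarith

theorem integrableOn_exp_mul_thetaRem (s : ℂ) {φ : (Fin d → ℝ) → ℂ} (hφ : ContDiff ℝ ∞ φ) {R : ℝ}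
    (hR : ∀ x, R < ‖x‖ → φ x = 0) :
    IntegrableOn (fun τ : ℝ => Complex.exp (-s * τ) * thetaRem ψ φ (Real.exp (-τ))) (Ioi 0) := by
  obtain ⟨M, hM⟩ := exists_nat_ge (1 - s.re)
  obtain ⟨K, hK, h⟩ := norm_thetaRem_le (d := d) ψ M R
  obtain ⟨C, hC⟩ := exists_bound_iteratedFDeriv hφ (hasCompactSupport_of_norm hR) (d + 1 + M)
  have hC0 : 0 ≤ C := (norm_nonneg _).trans (hC 0 (Nat.zero_le _) 0)
  refine Integrable.mono' ((exp_neg_integrableOn_Ioi 0 one_pos).const_mul (K * C)) ?_ ?_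
  · exact ((by fun_prop : Continuous fun τ : ℝ => Complex.exp (-s * τ)).mul
      (continuous_thetaRem_exp ψ hφ.continuous hR)).aestronglyMeasurable
  · refine (ae_restrict_iff' measurableSet_Ioi).2 (Eventually.of_forall fun τ hτ => ?_)
    exact norm_exp_mul_thetaRem_le ψ s (h φ hφ hR C hC) (by positivity) hM hτ

theorem norm_continued_le (s : ℂ) (R : ℝ) : ∃ (M : ℕ) (K : ℝ), 0 ≤ K ∧ ∀ φ : (Fin d → ℝ) → ℂ,
    ContDiff ℝ ∞ φ → (∀ x, R < ‖x‖ → φ x = 0) → ∀ C : ℝ,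
    (∀ j ≤ M, ∀ x, ‖iteratedFDeriv ℝ j φ x‖ ≤ C) → ‖continued ψ s φ‖ ≤ K * C := by
  obtain ⟨M, hM⟩ := exists_nat_ge (1 - s.re)
  obtain ⟨K, hK, h⟩ := norm_thetaRem_le (d := d) ψ M R
  obtain ⟨K', hK', h'⟩ := norm_ft_le d 0 R
  let I : ℝ := ∫ τ in Ioi (0 : ℝ), Real.exp (-1 * τ)
  -- No condition `s ≠ d` is needed: there the pole term and its bound are both zero by the
  -- convention for division by zero.
  refine ⟨d + 1 + M, K * I + ‖thetaConst d ψ‖ * K' / ‖s - d‖, ?_, fun φ hφ hR C hC => ?_⟩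
  · have : 0 ≤ I := integral_nonneg fun τ => (Real.exp_pos _).le
    positivity
  have hC0 : 0 ≤ C := (norm_nonneg _).trans (hC 0 (Nat.zero_le _) 0)
  have h1 : ‖∫ τ in Ioi (0 : ℝ), Complex.exp (-s * τ) * thetaRem ψ φ (Real.exp (-τ))‖ ≤
      K * C * I := by
    rw [← integral_const_mul]
    refine norm_integral_le_of_norm_le ((exp_neg_integrableOn_Ioi 0 one_pos).const_mul (K * C)) ?_
    refine (ae_restrict_iff' measurableSet_Ioi).2 (Eventually.of_forall fun τ hτ => ?_)
    exact norm_exp_mul_thetaRem_le ψ s (h φ hφ hR C hC) (by positivity) hM hτ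
  have h2 : ‖∫ x, φ x‖ ≤ K' * C := by
    have := h' φ hφ hR C (fun j hj => hC j (by omega)) 0
    rw [ft_zero] at this
    simpa using this
  unfold continued
  rw [norm_mul]
  have h3 : ‖(1 / 2 : ℂ)‖ ≤ 1 := by norm_num
  refine (mul_le_of_le_one_left (norm_nonneg _) h3).trans ((norm_add_le _ _).trans ?_)
  rw [norm_div, norm_mul]
  calc _ ≤ K * C * I + ‖thetaConst d ψ‖ * (K' * C) / ‖s - d‖ := by gcongr
    _ = _ := by ring

theorem thetaRem_add {φ φ' : (Fin d → ℝ) → ℂ} (hφ : Continuous φ) (hφ' : Continuous φ')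
    (hc : HasCompactSupport φ) (hc' : HasCompactSupport φ') {t : ℝ} (ht : 0 < t) :
    thetaRem ψ (φ + φ') t = thetaRem ψ φ t + thetaRem ψ φ' t := by
  unfold thetaRem thetaSum
  simp only [Pi.add_apply, mul_add]
  rw [(summable_thetaSum ψ hc ht).tsum_add (summable_thetaSum ψ hc' ht),
    integral_add (hφ.integrable_of_hasCompactSupport hc) (hφ'.integrable_of_hasCompactSupport hc')]
  ring

theorem thetaRem_smul (c : ℂ) (φ : (Fin d → ℝ) → ℂ) (t : ℝ) :
    thetaRem ψ (c • φ) t = c * thetaRem ψ φ t := by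
  unfold thetaRem thetaSum
  simp only [Pi.smul_apply, smul_eq_mul, integral_const_mul, mul_left_comm _ c]
  rw [tsum_mul_left]
  ring

theorem continued_add (s : ℂ) {φ φ' : (Fin d → ℝ) → ℂ} (hφ : ContDiff ℝ ∞ φ)
    (hφ' : ContDiff ℝ ∞ φ') {R : ℝ} (hR : ∀ x, R < ‖x‖ → φ x = 0)
    (hR' : ∀ x, R < ‖x‖ → φ' x = 0) :
    continued ψ s (φ + φ') = continued ψ s φ + continued ψ s φ' := by
  have hc := hasCompactSupport_of_norm hR
  have hc' := hasCompactSupport_of_norm hR'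
  unfold continued
  simp only [thetaRem_add ψ hφ.continuous hφ'.continuous hc hc' (Real.exp_pos _), mul_add]
  rw [integral_add (integrableOn_exp_mul_thetaRem ψ s hφ hR)
    (integrableOn_exp_mul_thetaRem ψ s hφ' hR'), integral_add'
    (hφ.continuous.integrable_of_hasCompactSupport hc)
    (hφ'.continuous.integrable_of_hasCompactSupport hc')]
  ring

theorem continued_smul (s c : ℂ) (φ : (Fin d → ℝ) → ℂ) :
    continued ψ s (c • φ) = c * continued ψ s φ := by
  unfold continued
  simp only [thetaRem_smul, mul_left_comm _ c, Pi.smul_apply, smul_eq_mul, integral_const_mul]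
  ring

/-- In the region of absolute convergence the continuation is the lattice sum. -/
theorem hasSum_continued {s : ℂ} (hs : (d : ℝ) < s.re) {H : (Fin d → ℝ) → ℂ} (h0 : H 0 = 0)
    (hH : ∀ (τ : ℝ) x, H (Real.exp τ • x) = Complex.exp (-s * τ) * H x)
    (hsm : ContDiff ℝ ∞ fun x => (cut x : ℂ) * H x)
    (hsum : Summable fun v : Fin d → ℤ => coef ψ v * H fun i => (v i : ℝ)) :
    HasSum (fun v : Fin d → ℤ => coef ψ v * H fun i => (v i : ℝ))
      (2 * continued ψ s fun x => (cut x : ℂ) * H x) := by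
  set φ : (Fin d → ℝ) → ℂ := fun x => (cut x : ℂ) * H x with hφ
  have hR : ∀ x, 1 < ‖x‖ → φ x = 0 := fun x hx => by simp [hφ, cut_eq_zero_of_norm hx]
  have hb : ∀ a : ℝ, Integrable fun τ : ℝ => unitBump (a - τ) := fun a =>
    integrable_unitBump.comp_sub_left a
  -- The integrand vanishes for `τ ≤ 0`, since then the argument of the bump is at least `0`. The
  -- half-line integral is therefore the full integral, which is one.
  have hbi : ∀ v : Fin d → ℤ, ∫ τ in Ioi (0 : ℝ), unitBump (logNorm (fun i => (v i : ℝ)) - τ) = 1 := by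
    intro v
    rw [setIntegral_eq_integral_of_forall_compl_eq_zero, integral_sub_left_eq_self,
      integral_unitBump]
    intro τ hτ
    refine unitBump_eq_zero ?_
    have : τ ≤ 0 := by simpa using hτ
    linarith [logNorm_intCast_nonneg v]
  -- Homogeneity of degree `-s` moves the dilation by `exp (-τ)` from the bump to the whole
  -- localised function, at the price of `exp (-s τ)`.
  have hterm : ∀ (v : Fin d → ℤ) (τ : ℝ), coef ψ v * H (fun i => (v i : ℝ)) *
      (unitBump (logNorm (fun i => (v i : ℝ)) - τ) : ℂ) =
      Complex.exp (-s * τ) * (coef ψ v * φ (Real.exp (-τ) • fun i => (v i : ℝ))) := by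
    intro v τ
    by_cases hv : (fun i => (v i : ℝ)) = 0
    · rw [hv]; simp [hφ, h0]
    · simp only [hφ]
      rw [hH, cut, logNorm_exp_smul hv, ← sub_eq_add_neg]
      have : Complex.exp (-s * τ) * Complex.exp (-s * ((-τ : ℝ) : ℂ)) = 1 := by
        rw [← Complex.exp_add]; push_cast; ring_nf; simp
      linear_combination (-coef ψ v * H (fun i => (v i : ℝ)) *
        (unitBump (logNorm (fun i => (v i : ℝ)) - τ) : ℂ)) * this
  have h1 := hasSum_integral_of_summable_integral_norm (μ := volume.restrict (Ioi (0 : ℝ)))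
    (F := fun (v : Fin d → ℤ) τ => coef ψ v * H (fun i => (v i : ℝ)) *
      (unitBump (logNorm (fun i => (v i : ℝ)) - τ) : ℂ))
    (fun v => ((hb _).ofReal.const_mul _).integrableOn) (by
      refine hsum.norm.congr fun v => ?_
      simp only [norm_mul _ (Complex.ofReal _), Complex.norm_real,
        Real.norm_of_nonneg (unitBump_nonneg _)]
      rw [integral_const_mul, hbi, mul_one])
  have h2 : ∀ v : Fin d → ℤ, ∫ τ in Ioi (0 : ℝ), coef ψ v * H (fun i => (v i : ℝ)) *
      (unitBump (logNorm (fun i => (v i : ℝ)) - τ) : ℂ) =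
      coef ψ v * H (fun i => (v i : ℝ)) := by
    intro v
    rw [integral_const_mul, integral_complex_ofReal, hbi]; simp
  simp only [h2] at h1
  simp only [hterm, tsum_mul_left] at h1
  suffices h : 2 * continued ψ s φ = ∫ τ in Ioi (0 : ℝ), Complex.exp (-s * τ) *
      ∑' v : Fin d → ℤ, coef ψ v * φ (Real.exp (-τ) • fun i => (v i : ℝ)) by
    rw [h]; exact h1
  have h3 : ∀ τ : ℝ, Complex.exp (-s * τ) *
      ∑' v : Fin d → ℤ, coef ψ v * φ (Real.exp (-τ) • fun i => (v i : ℝ)) =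
      Complex.exp (-s * τ) * thetaRem ψ φ (Real.exp (-τ)) +
      thetaConst d ψ * (∫ x, φ x) * Complex.exp (((d : ℂ) - s) * τ) := by
    intro τ
    have h4 : (((Real.exp (-τ) ^ d)⁻¹ : ℝ) : ℂ) = Complex.exp (d * τ) := by
      rw [← Real.exp_nat_mul, ← Real.exp_neg]; push_cast; congr 1; ring
    rw [thetaRem, h4, thetaSum, sub_mul, sub_eq_add_neg (↑d * (τ : ℂ)), Complex.exp_add]
    ring_nf
  simp only [h3]
  -- For `Re s > d` the exponential of the main term is integrable on the half-line, with integral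
  -- `1 / (s - d)`.
  have hre : ((d : ℂ) - s).re < 0 := by simp; linarith
  rw [integral_add (integrableOn_exp_mul_thetaRem ψ s hsm hR)
    ((integrableOn_exp_mul_complex_Ioi hre 0).const_mul _), integral_const_mul,
    integral_exp_mul_complex_Ioi hre, continued]
  have hne : s - d ≠ 0 := fun h => by
    have := congrArg Complex.re h
    simp at this; linarith
  have hne' : (d : ℂ) - s ≠ 0 := fun h => hne (by linear_combination -h)
  simp only [Complex.ofReal_zero, mul_zero, Complex.exp_zero]
  field_simp
  rw [show (d : ℂ) - s = -(s - d) by ring]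
  field_simp
  ring

/-! ### Holomorphic families of localised functions -/

/-- A family of localised functions that is smooth in all variables, holomorphic in the parameter
and supported in the unit ball. -/
structure IsAdmissible (Φ : ℂ → (Fin d → ℝ) → ℂ) : Prop where
  contDiff : ContDiff ℝ ∞ fun p : ℂ × (Fin d → ℝ) => Φ p.1 p.2
  holo : ∀ x, Differentiable ℂ fun s => Φ s x
  support : ∀ s x, 1 < ‖x‖ → Φ s x = 0

theorem IsAdmissible.contDiff_right {Φ : ℂ → (Fin d → ℝ) → ℂ} (h : IsAdmissible Φ) (s : ℂ) :
    ContDiff ℝ ∞ (Φ s) :=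
  h.contDiff.comp (contDiff_const.prodMk contDiff_id)

/-- Derivatives in `x` alone are joint derivatives composed with the inclusion of the second factor.
The joint ones are continuous, hence bounded on the compact product of the parameter ball with the
unit ball, and outside the unit ball everything vanishes. -/
theorem IsAdmissible.exists_bound {Φ : ℂ → (Fin d → ℝ) → ℂ} (h : IsAdmissible Φ) (s₀ : ℂ) (M : ℕ) :
    ∃ C, 0 ≤ C ∧ ∀ s ∈ Metric.closedBall s₀ 1, ∀ j ≤ M, ∀ x,
      ‖iteratedFDeriv ℝ j (Φ s) x‖ ≤ C := by
  let f : ℂ × (Fin d → ℝ) → ℂ := fun p => Φ p.1 p.2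
  let ι := ContinuousLinearMap.inr ℝ ℂ (Fin d → ℝ)
  have hcpt : IsCompact (Metric.closedBall s₀ 1 ×ˢ Metric.closedBall (0 : Fin d → ℝ) 1) :=
    (isCompact_closedBall _ _).prod (isCompact_closedBall _ _)
  have h1 : ∀ j : ℕ, ∃ C, ∀ s ∈ Metric.closedBall s₀ 1, ∀ x,
      ‖iteratedFDeriv ℝ j (Φ s) x‖ ≤ C := by
    intro j
    obtain ⟨C, hC⟩ := hcpt.exists_bound_of_continuousOn
      ((h.contDiff.continuous_iteratedFDeriv (m := j) (by exact_mod_cast le_top)).continuousOn)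
    refine ⟨C * ‖ι‖ ^ j, fun s hs x => ?_⟩
    have hC0 : 0 ≤ C := (norm_nonneg _).trans
      (hC (s₀, 0) ⟨Metric.mem_closedBall_self (by norm_num), Metric.mem_closedBall_self (by norm_num)⟩)
    by_cases hx : ‖x‖ ≤ 1
    · have h2 : Φ s = (fun p => f ((s, 0) + p)) ∘ ι := by
        funext y; simp [f, ι]
      have h3 : ContDiff ℝ ∞ fun p => f ((s, 0) + p) := h.contDiff.comp (by fun_prop)
      rw [h2, ι.iteratedFDeriv_comp_right h3 x (i := j) (by exact_mod_cast le_top),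
        iteratedFDeriv_comp_add_left]
      refine (ContinuousMultilinearMap.norm_compContinuousLinearMap_le _ _).trans ?_
      rw [Finset.prod_const, Finset.card_univ, Fintype.card_fin]
      refine mul_le_mul_of_nonneg_right (hC _ ?_) (by positivity)
      simpa [ι] using ⟨hs, hx⟩
    · rw [norm_iteratedFDeriv_eq_zero (h.support s) j (not_le.1 hx), norm_zero]
      positivity
  choose C hC using h1
  have hC0 : ∀ j, 0 ≤ C j := fun j =>
    (norm_nonneg _).trans (hC j s₀ (Metric.mem_closedBall_self (by norm_num)) 0)
  refine ⟨∑ j ∈ Finset.range (M + 1), C j, Finset.sum_nonneg fun j _ => hC0 j,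
    fun s hs j hj x => (hC j s hs x).trans ?_⟩
  exact Finset.single_le_sum (f := C) (fun i _ => hC0 i) (Finset.mem_range.2 (by omega))

theorem IsAdmissible.differentiable_integral {Φ : ℂ → (Fin d → ℝ) → ℂ} (h : IsAdmissible Φ) :
    Differentiable ℂ fun s => ∫ x, Φ s x := by
  refine differentiable_integral_of_locally_bounded
    (fun s => (h.contDiff_right s).continuous.aestronglyMeasurable)
    (Eventually.of_forall h.holo) fun s₀ => ?_
  obtain ⟨C, hC0, hC⟩ := h.exists_bound s₀ 0
  refine ⟨(Metric.closedBall (0 : Fin d → ℝ) 1).indicator fun _ => C, ?_,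
    Eventually.of_forall fun x s hs => ?_⟩
  · exact (integrableOn_const (isCompact_closedBall (0 : Fin d → ℝ) 1).measure_lt_top.ne).integrable_indicator
      Metric.isClosed_closedBall.measurableSet
  · by_cases hx : ‖x‖ ≤ 1
    · rw [indicator_of_mem (by simpa using hx)]
      have := hC s hs 0 le_rfl x
      rwa [norm_iteratedFDeriv_zero] at this
    · rw [h.support s x (not_le.1 hx), norm_zero]
      exact indicator_nonneg (fun _ _ => hC0) _

theorem IsAdmissible.differentiable_thetaRem {Φ : ℂ → (Fin d → ℝ) → ℂ} (h : IsAdmissible Φ)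
    {t : ℝ} (ht : 0 < t) : Differentiable ℂ fun s => thetaRem ψ (Φ s) t := by
  unfold thetaRem
  refine Differentiable.sub ?_ (h.differentiable_integral.const_mul _)
  simp only [fun s => thetaSum_eq_sum ψ (h.support s) ht le_rfl]
  exact Differentiable.fun_sum fun v _ => (h.holo _).const_mul _

theorem IsAdmissible.differentiable_mellin {Φ : ℂ → (Fin d → ℝ) → ℂ} (h : IsAdmissible Φ) :
    Differentiable ℂ fun s => ∫ τ in Ioi (0 : ℝ), Complex.exp (-s * τ) *
      thetaRem ψ (Φ s) (Real.exp (-τ)) := by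
  refine differentiable_integral_of_locally_bounded
    (fun s => (integrableOn_exp_mul_thetaRem ψ s (h.contDiff_right s) (h.support s)).1)
    (Eventually.of_forall fun τ => ?_) fun s₀ => ?_
  · exact Differentiable.mul (by fun_prop) (h.differentiable_thetaRem ψ (Real.exp_pos _))
  -- On the unit ball around `s₀` the real part drops by at most one, so this `M` serves for all `s`
  -- there.
  · obtain ⟨M, hM⟩ := exists_nat_ge (2 - s₀.re)
    obtain ⟨K, hK, h1⟩ := norm_thetaRem_le (d := d) ψ M 1
    obtain ⟨C, hC0, hC⟩ := h.exists_bound s₀ (d + 1 + M)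
    refine ⟨fun τ => K * C * Real.exp (-1 * τ),
      (exp_neg_integrableOn_Ioi 0 one_pos).const_mul (K * C),
      (ae_restrict_iff' measurableSet_Ioi).2 (Eventually.of_forall fun τ hτ s hs => ?_)⟩
    refine norm_exp_mul_thetaRem_le ψ s
      (h1 (Φ s) (h.contDiff_right s) (h.support s) C (hC s hs)) (by positivity) ?_ hτ
    have h2 : |(s - s₀).re| ≤ 1 := (Complex.abs_re_le_norm _).trans (mem_closedBall_iff_norm.1 hs)
    rw [Complex.sub_re, abs_le] at h2
    linarith

theorem IsAdmissible.differentiableOn_continued {Φ : ℂ → (Fin d → ℝ) → ℂ} (h : IsAdmissible Φ) :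
    DifferentiableOn ℂ (fun s => continued ψ s (Φ s)) {(d : ℂ)}ᶜ := by
  unfold continued
  refine DifferentiableOn.const_mul ((h.differentiable_mellin ψ).differentiableOn.add ?_) _
  refine DifferentiableOn.div (h.differentiable_integral.const_mul _).differentiableOn
    (by fun_prop) fun s hs => sub_ne_zero.2 hs

theorem thetaConst_eq_zero (hψ : ψ ≠ 1) : thetaConst d ψ = 0 := by
  rw [thetaConst, MulChar.sum_eq_zero_of_ne_one hψ, mul_zero]

theorem IsAdmissible.differentiable_continued {Φ : ℂ → (Fin d → ℝ) → ℂ} (h : IsAdmissible Φ)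
    (hψ : ψ ≠ 1) : Differentiable ℂ fun s => continued ψ s (Φ s) := by
  unfold continued
  simp only [thetaConst_eq_zero ψ hψ, zero_mul, zero_div, add_zero]
  exact (h.differentiable_mellin ψ).const_mul _

theorem IsAdmissible.tendsto_continued {Φ : ℂ → (Fin d → ℝ) → ℂ} (h : IsAdmissible Φ) :
    Tendsto (fun s => (s - d) * continued ψ s (Φ s)) (𝓝[≠] (d : ℂ))
      (𝓝 (1 / 2 * thetaConst d ψ * ∫ x, Φ d x)) := by
  -- With the factor `s - d` cleared, the expression is continuous at `d`; its value there is the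
  -- residue.
  have h1 : Continuous fun s => (s - d) * (1 / 2 * (∫ τ in Ioi (0 : ℝ), Complex.exp (-s * τ) *
      thetaRem ψ (Φ s) (Real.exp (-τ)))) + 1 / 2 * thetaConst d ψ * ∫ x, Φ s x :=
    ((continuous_id.sub continuous_const).mul
      (continuous_const.mul (h.differentiable_mellin ψ).continuous)).add
      (continuous_const.mul h.differentiable_integral.continuous)
  have h2 := (h1.tendsto (d : ℂ)).mono_left (nhdsWithin_le_nhds (s := {(d : ℂ)}ᶜ))
  rw [sub_self, zero_mul, zero_add] at h2
  refine h2.congr' ?_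
  filter_upwards [self_mem_nhdsWithin] with s hs
  have : s - d ≠ 0 := sub_ne_zero.2 hs
  rw [continued]
  field_simp

end Continuation

/-! ### Continuous seminorms on spaces of smooth sections -/

theorem exists_seminorm_finset {E ι : Type*} [AddCommGroup E] [Module ℂ E] [TopologicalSpace E]
    (s : Finset ι) {p : ι → E → ℝ}
    (h : ∀ i ∈ s, ∃ q : Seminorm ℂ E, Continuous q ∧ ∀ f, p i f ≤ q f) :
    ∃ q : Seminorm ℂ E, Continuous q ∧ ∀ i ∈ s, ∀ f, p i f ≤ q f := by
  classical
  induction s using Finset.induction_on with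
  | empty => exact ⟨0, continuous_const, by simp⟩
  | insert a s ha ih =>
    obtain ⟨q, hq, hq'⟩ := ih fun i hi => h i (Finset.mem_insert_of_mem hi)
    obtain ⟨r, hr, hr'⟩ := h a (Finset.mem_insert_self _ _)
    refine ⟨r + q, hr.add hq, fun i hi f => ?_⟩
    rw [_root_.add_apply]
    rcases Finset.mem_insert.1 hi with rfl | hi
    · exact (hr' f).trans (le_add_of_nonneg_right (apply_nonneg q f))
    · exact (hq' i hi f).trans (le_add_of_nonneg_left (apply_nonneg r f))

theorem natCast_le_infty (m : ℕ) : (m : WithTop ℕ∞) ≤ ∞ := by exact_mod_cast le_top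

section Sections

variable {n : ℕ} {Q : Subgroup (GL (Fin n) ℝ)} {χ : GL (Fin n) ℝ → ℂ}

/-- The seminorm is the sup norm of the `j`-th jet over `K`, which is continuous because the
topology of the section space is induced from compact convergence of jets. -/
theorem exists_seminorm_jet {K : Set (Fin n → Fin n → ℝ)} (hK : IsCompact K)
    (hK' : K ⊆ invertibleSet n) (j : ℕ) :
    ∃ q : Seminorm ℂ (SmoothSection Q χ), Continuous q ∧
      ∀ f : SmoothSection Q χ, ∀ A ∈ K, ‖iteratedFDeriv ℝ j (zeroExt f) A‖ ≤ q f := by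
  let L : Set (invertibleSet n) := Subtype.val ⁻¹' K
  have hL : IsCompact L := by
    rw [Subtype.isCompact_iff, Subtype.image_preimage_coe, inter_eq_right.2 hK']
    exact hK
  have : CompactSpace L := isCompact_iff_compactSpace.1 hL
  let nrm : C((Fin n → Fin n → ℝ) [×j]→L[ℝ] ℂ, ℝ) := ⟨fun T => ‖T‖, continuous_norm⟩
  let G : SmoothSection Q χ → C(L, ℝ) := fun f =>
    nrm.comp ((SmoothSection.jets Q χ f j).restrict L)
  have hG : Continuous G := (ContinuousMap.continuous_postcomp nrm).comp
    ((ContinuousMap.continuous_restrict L).comp (SmoothSection.continuous_jet j))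
  have hGf : ∀ f x, G f x = ‖SmoothSection.jets Q χ f j x‖ := fun f x => rfl
  have hle : ∀ f x, G f x ≤ ‖G f‖ := fun f x =>
    (le_abs_self _).trans (ContinuousMap.norm_coe_le_norm (G f) x)
  let q : Seminorm ℂ (SmoothSection Q χ) := Seminorm.ofSMulLE (fun f => ‖G f‖)
    (by
      refine norm_eq_zero.2 (ContinuousMap.ext fun x => ?_)
      rw [hGf, map_zero]
      exact norm_zero)
    (fun f g => (ContinuousMap.norm_le _ (by positivity)).2 fun x => by
      rw [hGf, norm_norm, map_add]
      exact (norm_add_le _ _).trans (add_le_add (hle f x) (hle g x)))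
    (fun c f => (ContinuousMap.norm_le _ (by positivity)).2 fun x => by
      rw [hGf, norm_norm, map_smul]
      exact (norm_smul_le c (SmoothSection.jets Q χ f j x)).trans
        (mul_le_mul_of_nonneg_left (hle f x) (norm_nonneg c)))
  exact ⟨q, continuous_norm.comp hG, fun f A hA => hle f ⟨⟨A, hK' hA⟩, hA⟩⟩

/-- Derivatives of smooth pull-backs are controlled by continuous seminorms. -/
theorem exists_seminorm_pullback {E : Type*} [NormedAddCommGroup E] [NormedSpace ℝ E] {U : Set E}
    (hU : IsOpen U) {A : E → Fin n → Fin n → ℝ} (hA : ContDiffOn ℝ ∞ A U)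
    (hAU : MapsTo A U (invertibleSet n)) {a : E → ℂ} (ha : ContDiffOn ℝ ∞ a U) {V : Set E}
    (hV : IsCompact V) (hVU : V ⊆ U) (j : ℕ) :
    ∃ q : Seminorm ℂ (SmoothSection Q χ), Continuous q ∧ ∀ f : SmoothSection Q χ, ∀ x ∈ V,
      ‖iteratedFDeriv ℝ j (fun x => a x * zeroExt f (A x)) x‖ ≤ q f := by
  -- The bound is taken at least one so that each positive power `D ^ m` dominates `D`, as the
  -- estimate for iterated derivatives of a composition requires.
  have bnd : ∀ {F : Type} [NormedAddCommGroup F] [NormedSpace ℝ F] (g : E → F),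
      ContDiffOn ℝ ∞ g U → ∃ D : ℝ, 1 ≤ D ∧ ∀ i ≤ j, ∀ x ∈ V,
        ‖iteratedFDerivWithin ℝ i g U x‖ ≤ D := by
    intro F _ _ g hg
    have h1 : ∀ i : ℕ, ∃ C, ∀ x ∈ V, ‖iteratedFDerivWithin ℝ i g U x‖ ≤ C := fun i =>
      hV.exists_bound_of_continuousOn
        ((hg.continuousOn_iteratedFDerivWithin (by exact_mod_cast le_top) hU.uniqueDiffOn).mono hVU)
    choose C hC using h1
    refine ⟨1 + ∑ i ∈ Finset.range (j + 1), |C i|, ?_, fun i hi x hx => ?_⟩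
    · have := Finset.sum_nonneg fun i (_ : i ∈ Finset.range (j + 1)) => abs_nonneg (C i)
      linarith
    · have := Finset.single_le_sum (f := fun i => |C i|) (fun i _ => abs_nonneg _)
        (Finset.mem_range.2 (show i < j + 1 by omega))
      linarith [hC i x hx, le_abs_self (C i)]
  obtain ⟨Da, hDa1, hDa⟩ := bnd a ha
  obtain ⟨D, hD1, hD⟩ := bnd A hA
  have hK : IsCompact (A '' V) := hV.image_of_continuousOn (hA.continuousOn.mono hVU)
  have hK' : A '' V ⊆ invertibleSet n := by
    rintro _ ⟨x, hx, rfl⟩; exact hAU (hVU hx)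
  -- One seminorm is to control all orders up to `j`. It dominates suprema over `V`, whose
  -- finiteness is supplied again by `exists_seminorm_jet` below.
  obtain ⟨q, hq, hq'⟩ := exists_seminorm_finset (E := SmoothSection Q χ) (Finset.range (j + 1))
    (p := fun i f => ⨆ x : V, ‖iteratedFDeriv ℝ i (zeroExt f) (A x)‖) (by
      intro i _
      obtain ⟨q, hq, h⟩ := exists_seminorm_jet (Q := Q) (χ := χ) hK hK' i
      exact ⟨q, hq, fun f => Real.iSup_le (fun x => h f _ ⟨x, x.2, rfl⟩) (apply_nonneg q f)⟩)
  have hq'' : ∀ i ≤ j, ∀ f : SmoothSection Q χ, ∀ x ∈ V,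
      ‖iteratedFDeriv ℝ i (zeroExt f) (A x)‖ ≤ q f := by
    intro i hi f x hx
    obtain ⟨r, _, h⟩ := exists_seminorm_jet (Q := Q) (χ := χ) hK hK' i
    refine le_trans ?_ (hq' i (Finset.mem_range.2 (by omega)) f)
    refine le_ciSup (f := fun x : V => ‖iteratedFDeriv ℝ i (zeroExt f) (A x)‖) ?_ ⟨x, hx⟩
    exact ⟨r f, by rintro _ ⟨y, rfl⟩; exact h f _ ⟨y, y.2, rfl⟩⟩
  let c : NNReal := ∑ i ∈ Finset.range (j + 1),
    ((j.choose i : NNReal) * Da.toNNReal * ((j - i).factorial * D.toNNReal ^ (j - i)))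
  refine ⟨c • q, ?_, fun f x hx => ?_⟩
  · exact hq.const_smul c
  have hxU := hVU hx
  rw [← iteratedFDerivWithin_of_isOpen j hU hxU]
  have hcomp : ContDiffOn ℝ ∞ (zeroExt f ∘ A) U := ContDiffOn.comp f.smooth hA hAU
  refine (norm_iteratedFDerivWithin_mul_le ha hcomp hU.uniqueDiffOn hxU
    (n := j) (by exact_mod_cast le_top)).trans ?_
  rw [_root_.smul_apply, NNReal.smul_def, smul_eq_mul]
  simp only [c]
  push_cast
  rw [Finset.sum_mul]
  refine Finset.sum_le_sum fun i hi => ?_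
  have hij : i ≤ j := by have := Finset.mem_range.1 hi; omega
  have h1 : ‖iteratedFDerivWithin ℝ (j - i) (zeroExt f ∘ A) U x‖ ≤
      (j - i).factorial * q f * D ^ (j - i) := by
    refine norm_iteratedFDerivWithin_comp_le (N := ∞) f.smooth hA (natCast_le_infty _)
      (isOpen_invertibleSet n).uniqueDiffOn hU.uniqueDiffOn hAU hxU (fun m hm => ?_)
      fun m hm1 hm => ?_
    · rw [iteratedFDerivWithin_of_isOpen m (isOpen_invertibleSet n) (hAU hxU)]
      exact hq'' m (by omega) f x hx
    · exact (hD m (by omega) x hx).trans (le_self_pow₀ hD1 (by omega))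
  rw [Real.coe_toNNReal _ (zero_le_one.trans hDa1), Real.coe_toNNReal _ (zero_le_one.trans hD1)]
  calc _ ≤ (j.choose i : ℝ) * Da * ((j - i).factorial * q f * D ^ (j - i)) := by
        gcongr
        exact hDa i hij x hx
    _ = _ := by ring

end Sections

/-! ### Matrices with a prescribed last column -/

section LastColumn

variable {k : ℕ}

/-- The last column of a matrix. -/
def lastCol (g : GL (Fin (k + 1)) ℝ) : Fin (k + 1) → ℝ := fun i => g i (Fin.last k)

theorem lastCol_ne_zero (g : GL (Fin (k + 1)) ℝ) : lastCol g ≠ 0 := fun h =>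
  det_ne_zero' g (Matrix.det_eq_zero_of_column_eq_zero (Fin.last k) fun i => congrFun h i)

theorem lastCol_mul (g h : GL (Fin (k + 1)) ℝ) : lastCol (g * h) = g.1.mulVec (lastCol h) := by
  funext i
  change (g.1 * h.1) i (Fin.last k) = _
  rw [Matrix.mul_apply]; rfl

/-- The diagonal matrix with entries `1, …, 1, a`. -/
def lastScale (a : ℝ) (ha : a ≠ 0) : GL (Fin (k + 1)) ℝ :=
  Matrix.GeneralLinearGroup.mkOfDetNeZero
    (Matrix.diagonal (Function.update (fun _ => (1 : ℝ)) (Fin.last k) a)) (by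
      rw [Matrix.det_diagonal, Finset.prod_update_of_mem (Finset.mem_univ _)]
      simpa using ha)

theorem lastScale_val (a : ℝ) (ha : a ≠ 0) : (lastScale (k := k) a ha).1 =
    Matrix.diagonal (Function.update (fun _ => (1 : ℝ)) (Fin.last k) a) := rfl

theorem lastScale_mem (a : ℝ) (ha : a ≠ 0) : lastScale a ha ∈ Pt k := fun j hj => by
  change (lastScale (k := k) a ha).1 j (Fin.last k) = 0
  rw [lastScale_val, Matrix.diagonal_apply_ne _ hj]

theorem det_lastScale (a : ℝ) (ha : a ≠ 0) : (lastScale (k := k) a ha).1.det = a := by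
  rw [lastScale_val, Matrix.det_diagonal, Finset.prod_update_of_mem (Finset.mem_univ _)]
  simp

theorem lastScale_corner (a : ℝ) (ha : a ≠ 0) :
    (lastScale (k := k) a ha) (Fin.last k) (Fin.last k) = a := by
  rw [lastScale_val]; simp

theorem lastCol_mul_of_mem (g : GL (Fin (k + 1)) ℝ) {q : GL (Fin (k + 1)) ℝ} (hq : q ∈ Pt k) :
    lastCol (g * q) = q (Fin.last k) (Fin.last k) • lastCol g := by
  funext i
  change (g.1 * q.1) i (Fin.last k) = _
  rw [Matrix.mul_apply, Finset.sum_eq_single (Fin.last k)]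
  · rw [mul_comm]; rfl
  · intro l _ hl
    rw [show q.1 l (Fin.last k) = 0 from hq l hl, mul_zero]
  · simp

/-- A unit vector extends to an orthonormal basis. The representative must be orthogonal because
flatness of a family only says something on `O(n)`. -/
theorem exists_orthogonal_lastCol {x : Fin (k + 1) → ℝ} (hx : ∑ i, x i ^ 2 = 1) :
    ∃ g : GL (Fin (k + 1)) ℝ, g.1 ∈ Matrix.orthogonalGroup (Fin (k + 1)) ℝ ∧ lastCol g = x := by
  let e : EuclideanSpace ℝ (Fin (k + 1)) := WithLp.toLp 2 x
  have he : ‖e‖ = 1 := by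
    rw [EuclideanSpace.norm_eq]
    simp only [e, Real.norm_eq_abs, sq_abs, hx, Real.sqrt_one]
  obtain ⟨b, hb⟩ := Orthonormal.exists_orthonormalBasis_extension_of_card_eq (𝕜 := ℝ)
    (E := EuclideanSpace ℝ (Fin (k + 1))) (ι := Fin (k + 1)) (by simp)
    (v := fun _ => e) (s := {Fin.last k}) (by
      rw [orthonormal_iff_ite]
      rintro ⟨i, hi⟩ ⟨j, hj⟩
      have hij : i = j := by rw [show i = Fin.last k from hi, show j = Fin.last k from hj]
      subst hij
      simp [he])
  let M : Matrix (Fin (k + 1)) (Fin (k + 1)) ℝ := Matrix.of fun i j => b j i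
  have hM : Mᵀ * M = 1 := by
    ext i j
    have h1 := orthonormal_iff_ite.1 b.orthonormal i j
    rw [Matrix.mul_apply, Matrix.one_apply, ← h1, PiLp.inner_apply]
    refine Finset.sum_congr rfl fun l _ => ?_
    simp [M, mul_comm]
  have hM' : M * Mᵀ = 1 := mul_eq_one_comm.1 hM
  refine ⟨⟨M, Mᵀ, hM', hM⟩, (Matrix.mem_orthogonalGroup_iff _ _).2 hM', ?_⟩
  funext i
  change b (Fin.last k) i = x i
  rw [hb (Fin.last k) rfl]

theorem abs_det_orthogonal {g : GL (Fin (k + 1)) ℝ}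
    (hg : g.1 ∈ Matrix.orthogonalGroup (Fin (k + 1)) ℝ) : |g.1.det| = 1 := by
  have h := congrArg Matrix.det ((Matrix.mem_orthogonalGroup_iff _ _).1 hg)
  rw [Matrix.det_mul, Matrix.det_transpose, Matrix.det_one] at h
  have h2 : g.1.det * g.1.det = 1 := h
  rcases mul_self_eq_one_iff.1 h2 with h3 | h3 <;> simp [h3]

theorem exp_logNorm_smul {d : ℕ} {x : Fin d → ℝ} (hx : x ≠ 0) :
    ∑ i, (Real.exp (-logNorm x) • x) i ^ 2 = 1 := by
  have h1 : ∑ i, (Real.exp (-logNorm x) • x) i ^ 2 = Real.exp (-(2 * logNorm x)) * ∑ i, x i ^ 2 := by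
    rw [Finset.mul_sum]
    refine Finset.sum_congr rfl fun i _ => ?_
    rw [Pi.smul_apply, smul_eq_mul, mul_pow, ← Real.exp_nat_mul]; congr 2; push_cast; ring
  rw [h1, logNorm, mul_div_cancel₀ _ two_ne_zero, Real.exp_neg, Real.exp_log (sum_sq_pos hx),
    inv_mul_cancel₀ (sum_sq_pos hx).ne']

theorem exists_lastCol {x : Fin (k + 1) → ℝ} (hx : x ≠ 0) :
    ∃ g : GL (Fin (k + 1)) ℝ, lastCol g = x := by
  obtain ⟨o, _, ho⟩ := exists_orthogonal_lastCol (exp_logNorm_smul hx)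
  refine ⟨o * lastScale (Real.exp (logNorm x)) (Real.exp_pos _).ne', ?_⟩
  rw [lastCol_mul_of_mem _ (lastScale_mem _ _), lastScale_corner, ho, smul_smul, ← Real.exp_add]
  simp

end LastColumn

/-! ### Sections as homogeneous functions -/

section Lift

variable {k : ℕ} {ε : ZMod 2} {μ : ℂ}

open Classical in
/-- The homogeneous function of the last column attached to a smooth section. -/
def lift (h : SmoothSection (Pt k) (chit k ε μ)) (x : Fin (k + 1) → ℝ) : ℂ :=
  if hx : x = 0 then 0 else
    ((|(exists_lastCol hx).choose.1.det| : ℝ) : ℂ) ^ (μ / ((k : ℂ) + 1)) *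
      h (exists_lastCol hx).choose

theorem lift_zero (h : SmoothSection (Pt k) (chit k ε μ)) : lift h 0 = 0 := by simp [lift]

theorem mem_Pt_of_lastCol_eq {g g' : GL (Fin (k + 1)) ℝ} (h : lastCol g' = lastCol g) :
    g⁻¹ * g' ∈ Pt k ∧ (g⁻¹ * g') (Fin.last k) (Fin.last k) = 1 := by
  have h1 : lastCol (g⁻¹ * g') = lastCol (1 : GL (Fin (k + 1)) ℝ) := by
    rw [lastCol_mul, h, ← lastCol_mul, inv_mul_cancel]
  refine ⟨fun j hj => ?_, ?_⟩
  · have := congrFun h1 j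
    simp only [lastCol] at this
    rw [this]
    exact Matrix.one_apply_ne hj
  · have := congrFun h1 (Fin.last k)
    simp only [lastCol] at this
    rw [this]
    exact Matrix.one_apply_eq _

/-- Two matrices with equal last column differ by some `q` in `P̃` with corner entry one. On such
`q` the character is a pure power of `|det q|`, which the prefactor cancels, so the value does not
depend on the chosen matrix. -/
theorem lift_lastCol (h : SmoothSection (Pt k) (chit k ε μ)) (g : GL (Fin (k + 1)) ℝ) :
    lift h (lastCol g) = ((|g.1.det| : ℝ) : ℂ) ^ (μ / ((k : ℂ) + 1)) * h g := by
  have hx := lastCol_ne_zero g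
  rw [lift, dif_neg hx]
  have hspec := (exists_lastCol hx).choose_spec
  generalize (exists_lastCol hx).choose = g' at hspec
  obtain ⟨hq, hq1⟩ := mem_Pt_of_lastCol_eq hspec
  set q := g⁻¹ * g' with hqdef
  have hg' : g' = g * q := by rw [hqdef, mul_inv_cancel_left]
  have hdet : (g * q).1.det = g.1.det * q.1.det := Matrix.det_mul _ _
  have hne : ((|q.1.det| : ℝ) : ℂ) ≠ 0 := by exact_mod_cast abs_ne_zero.2 (det_ne_zero' q)
  rw [hg', h.equivariant g hq, chit_eq ((Pt k).inv_mem hq), Pt_inv_corner hq, hq1, det_inv',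
    abs_cpow_inv, hdet, abs_cpow_mul, Complex.cpow_neg]
  simp only [inv_one, abs_one, Complex.ofReal_one, Complex.one_cpow, Real.sign_one, one_pow, mul_one]
  have h2 : ((|q.1.det| : ℝ) : ℂ) ^ (μ / ((k : ℂ) + 1)) ≠ 0 := by
    simp [Complex.cpow_eq_zero_iff, hne]
  field_simp

theorem lift_of_eq (h : SmoothSection (Pt k) (chit k ε μ)) {g : GL (Fin (k + 1)) ℝ}
    {x : Fin (k + 1) → ℝ} (hg : lastCol g = x) :
    lift h x = ((|g.1.det| : ℝ) : ℂ) ^ (μ / ((k : ℂ) + 1)) * h g := hg ▸ lift_lastCol h g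

theorem lift_add (h h' : SmoothSection (Pt k) (chit k ε μ)) : lift (h + h') = lift h + lift h' := by
  funext x
  by_cases hx : x = 0
  · subst hx; simp [lift_zero]
  · obtain ⟨g, hg⟩ := exists_lastCol hx
    rw [Pi.add_apply, lift_of_eq _ hg, lift_of_eq _ hg, lift_of_eq _ hg, ← mul_add]
    rfl

theorem lift_smul (c : ℂ) (h : SmoothSection (Pt k) (chit k ε μ)) : lift (c • h) = c • lift h := by
  funext x
  by_cases hx : x = 0
  · subst hx; simp [lift_zero]
  · obtain ⟨g, hg⟩ := exists_lastCol hx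
    rw [Pi.smul_apply, lift_of_eq _ hg, lift_of_eq _ hg, smul_eq_mul, mul_left_comm]
    rfl

/-- Right multiplication by `diag(1, …, 1, a)`, an element of `P̃`, scales the last column; the
determinant powers cancel and leave only the corner part of the character. -/
theorem lift_scale (h : SmoothSection (Pt k) (chit k ε μ)) {a : ℝ} (ha : a ≠ 0)
    (x : Fin (k + 1) → ℝ) : lift h (a • x) =
      ((|a| : ℝ) : ℂ) ^ μ * ((Real.sign a : ℝ) : ℂ) ^ ε.val * lift h x := by
  by_cases hx : x = 0
  · subst hx; simp [lift_zero]
  obtain ⟨g, hg⟩ := exists_lastCol hx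
  have hq := lastScale_mem (k := k) a ha
  have h1 : lastCol (g * lastScale a ha) = a • x := by
    rw [lastCol_mul_of_mem _ hq, lastScale_corner, hg]
  have hdet : (g * lastScale a ha).1.det = g.1.det * a := by
    have := Matrix.det_mul g.1 (lastScale (k := k) a ha).1
    rwa [det_lastScale] at this
  have hne : ((|a| : ℝ) : ℂ) ≠ 0 := by exact_mod_cast abs_ne_zero.2 ha
  rw [lift_of_eq _ h1, lift_of_eq _ hg, h.equivariant g hq, chit_eq ((Pt k).inv_mem hq),
    Pt_inv_corner hq, lastScale_corner, det_inv', det_lastScale, hdet, abs_cpow_mul, abs_cpow_inv,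
    abs_cpow_inv, sign_inv', neg_neg, Complex.cpow_neg]
  have h2 : ((|a| : ℝ) : ℂ) ^ (μ / ((k : ℂ) + 1)) ≠ 0 := by simp [Complex.cpow_eq_zero_iff, hne]
  field_simp

theorem lift_exp_smul (h : SmoothSection (Pt k) (chit k ε μ)) (τ : ℝ) (x : Fin (k + 1) → ℝ) :
    lift h (Real.exp τ • x) = Complex.exp (μ * τ) * lift h x := by
  rw [lift_scale h (Real.exp_pos τ).ne', Real.sign_of_pos (Real.exp_pos τ),
    abs_of_pos (Real.exp_pos τ), Complex.cpow_def_of_ne_zero (by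
      exact_mod_cast (Real.exp_pos τ).ne'), ← Complex.ofReal_log (Real.exp_pos τ).le, Real.log_exp]
  simp [mul_comm]

theorem lift_orthogonal (h : SmoothSection (Pt k) (chit k ε μ)) {g : GL (Fin (k + 1)) ℝ}
    (hg : g.1 ∈ Matrix.orthogonalGroup (Fin (k + 1)) ℝ) : lift h (lastCol g) = h g := by
  rw [lift_lastCol, abs_det_orthogonal hg]; simp

theorem lastCol_wLong_mul (g : GL (Fin (k + 1)) ℝ) (i : Fin (k + 1)) :
    lastCol (wLong (k + 1) * g) i = lastCol g i.rev := by
  change ((wLong (k + 1)).1 * g.1) i (Fin.last k) = _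
  rw [Matrix.mul_apply, Finset.sum_eq_single i.rev]
  · simp [wLong, lastCol]
  · intro l _ hl
    simp [wLong, hl]
  · simp

theorem wLong_mul_self (n : ℕ) : wLong n * wLong n = 1 := Units.ext (antidiagonal_mul_self n)

theorem wLong_inv (n : ℕ) : (wLong n)⁻¹ = wLong n := inv_eq_of_mul_eq_one_right (wLong_mul_self n)

theorem abs_det_wLong (n : ℕ) : |(wLong n).1.det| = 1 := by
  have h := congrArg Matrix.det (antidiagonal_mul_self n)
  rw [Matrix.det_mul, Matrix.det_one] at h
  rcases mul_self_eq_one_iff.1 h with h3 | h3 <;>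
  · change |(Matrix.of fun i j : Fin n => if j = i.rev then (1 : ℝ) else 0).det| = 1
    simp [h3]

theorem lift_translate_wLong (h : SmoothSection (Pt k) (chit k ε μ)) (x : Fin (k + 1) → ℝ) :
    lift (SmoothSection.translate (wLong (k + 1))⁻¹ h) x = lift h fun i => x i.rev := by
  by_cases hx : x = 0
  · subst hx
    rw [lift_zero]
    exact (lift_zero h).symm
  obtain ⟨g, hg⟩ := exists_lastCol hx
  have h1 : lastCol (wLong (k + 1) * g) = fun i => x i.rev := by
    funext i; rw [lastCol_wLong_mul, hg]
  have hdet : |(wLong (k + 1) * g).1.det| = |g.1.det| := by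
    have : (wLong (k + 1) * g).1.det = (wLong (k + 1)).1.det * g.1.det := Matrix.det_mul _ _
    rw [this, abs_mul, abs_det_wLong, one_mul]
  rw [lift_of_eq _ hg, lift_of_eq _ h1, hdet]
  congr 1

/-! ### Smoothness and seminorm bounds for lifts -/

/-- The matrix `g` with its last column replaced by `x`. -/
def replaceLast (g : GL (Fin (k + 1)) ℝ) (x : Fin (k + 1) → ℝ) : Fin (k + 1) → Fin (k + 1) → ℝ :=
  fun i j => if j = Fin.last k then x i else g i j

theorem contDiff_replaceLast (g : GL (Fin (k + 1)) ℝ) : ContDiff ℝ ∞ (replaceLast g) := by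
  refine contDiff_pi.2 fun i => contDiff_pi.2 fun j => ?_
  unfold replaceLast
  by_cases hj : j = Fin.last k
  · simp only [hj, if_true]; fun_prop
  · simp only [hj, if_false]; fun_prop

theorem replaceLast_lastCol (g : GL (Fin (k + 1)) ℝ) :
    replaceLast g (lastCol g) = fun i j => g i j := by
  funext i j
  unfold replaceLast lastCol
  split_ifs with h
  · rw [h]
  · rfl

/-- Varying only the last column of a fixed matrix is a smooth local section of the map to the last
column, so regularity of `h` on the group passes to `lift h`. -/
theorem lift_eq_replaceLast (h : SmoothSection (Pt k) (chit k ε μ)) (g : GL (Fin (k + 1)) ℝ)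
    {x : Fin (k + 1) → ℝ} (hx : replaceLast g x ∈ invertibleSet (k + 1)) :
    lift h x = ((|(Matrix.of (replaceLast g x)).det| : ℝ) : ℂ) ^ (μ / ((k : ℂ) + 1)) *
      zeroExt h (replaceLast g x) := by
  have hx' : (Matrix.of (replaceLast g x)).det ≠ 0 := hx
  have h1 : lastCol (Matrix.GeneralLinearGroup.mkOfDetNeZero _ hx') = x := by
    funext i
    change replaceLast g x i (Fin.last k) = x i
    simp [replaceLast]
  rw [lift_of_eq h h1, zeroExt, dif_pos hx']
  rfl

/-- Around a non-zero vector there is an open set on which `replaceLast g` is invertible. -/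
theorem isOpen_replaceLast (g : GL (Fin (k + 1)) ℝ) :
    IsOpen (replaceLast g ⁻¹' invertibleSet (k + 1)) :=
  (isOpen_invertibleSet (k + 1)).preimage (contDiff_replaceLast g).continuous

theorem contDiffOn_det_replaceLast (g : GL (Fin (k + 1)) ℝ) (s : ℂ) :
    ContDiffOn ℝ ∞ (fun x => ((|(Matrix.of (replaceLast g x)).det| : ℝ) : ℂ) ^ s)
      (replaceLast g ⁻¹' invertibleSet (k + 1)) := fun _ hx =>
  ((contDiffAt_det_cpow s hx).comp _ (contDiff_replaceLast g).contDiffAt).contDiffWithinAt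

/-- Near each non-zero vector, `replaceLast` presents the lift as a smooth pull-back, to which
`exists_seminorm_pullback` applies; compactness of `K` leaves finitely many such neighbourhoods. -/
theorem exists_seminorm_mul_lift {c : (Fin (k + 1) → ℝ) → ℂ} (hc : ContDiff ℝ ∞ c)
    {K : Set (Fin (k + 1) → ℝ)} (hK : IsCompact K) (h0 : (0 : Fin (k + 1) → ℝ) ∉ K) (j : ℕ) :
    ∃ q : Seminorm ℂ (SmoothSection (Pt k) (chit k ε μ)), Continuous q ∧
      ∀ h : SmoothSection (Pt k) (chit k ε μ), ∀ x ∈ K,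
        ‖iteratedFDeriv ℝ j (fun x => c x * lift h x) x‖ ≤ q h := by
  refine hK.induction_on (p := fun S => ∃ q : Seminorm ℂ (SmoothSection (Pt k) (chit k ε μ)),
    Continuous q ∧ ∀ h : SmoothSection (Pt k) (chit k ε μ), ∀ x ∈ S,
        ‖iteratedFDeriv ℝ j (fun x => c x * lift h x) x‖ ≤ q h) ?_ ?_ ?_ ?_
  · exact ⟨0, continuous_const, by simp⟩
  · rintro S T hST ⟨q, hq, h⟩
    exact ⟨q, hq, fun f x hx => h f x (hST hx)⟩
  · rintro S T ⟨q, hq, h⟩ ⟨q', hq', h'⟩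
    refine ⟨q + q', hq.add hq', fun f x hx => ?_⟩
    rw [_root_.add_apply]
    rcases hx with hx | hx
    · exact (h f x hx).trans (le_add_of_nonneg_right (apply_nonneg q' f))
    · exact (h' f x hx).trans (le_add_of_nonneg_left (apply_nonneg q f))
  · intro x₀ hx₀
    have hne : x₀ ≠ 0 := fun h => h0 (h ▸ hx₀)
    obtain ⟨g, hg⟩ := exists_lastCol hne
    have hU := isOpen_replaceLast g
    have hmem : x₀ ∈ replaceLast g ⁻¹' invertibleSet (k + 1) := by
      rw [mem_preimage, ← hg, replaceLast_lastCol]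
      exact det_ne_zero' g
    obtain ⟨V, hV, hVU, hVc⟩ := local_compact_nhds (hU.mem_nhds hmem)
    obtain ⟨q, hq, h⟩ := exists_seminorm_pullback (Q := Pt k) (χ := chit k ε μ) hU
      (contDiff_replaceLast g).contDiffOn (mapsTo_preimage _ _)
      (hc.contDiffOn.mul (contDiffOn_det_replaceLast g (μ / ((k : ℂ) + 1)))) hVc hVU j
    refine ⟨V, mem_nhdsWithin_of_mem_nhds hV, q, hq, fun f x hx => ?_⟩
    refine le_trans (le_of_eq ?_) (h f x hx)
    congr 1
    refine Filter.EventuallyEq.eq_of_nhds (Filter.EventuallyEq.iteratedFDeriv ℝ ?_ j)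
    filter_upwards [hU.mem_nhds (hVU hx)] with y hy
    rw [lift_eq_replaceLast f g hy, mul_assoc]

theorem contDiffAt_lift (h : SmoothSection (Pt k) (chit k ε μ)) {x : Fin (k + 1) → ℝ} (hx : x ≠ 0) :
    ContDiffAt ℝ ∞ (lift h) x := by
  obtain ⟨g, hg⟩ := exists_lastCol hx
  have hU := isOpen_replaceLast g
  have hmem : x ∈ replaceLast g ⁻¹' invertibleSet (k + 1) := by
    rw [mem_preimage, ← hg, replaceLast_lastCol]
    exact det_ne_zero' g
  have h1 := ((contDiffOn_det_replaceLast g (μ / ((k : ℂ) + 1))).contDiffAt (hU.mem_nhds hmem)).mul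
    ((h.smooth.contDiffAt hmem).comp x (contDiff_replaceLast g).contDiffAt)
  refine h1.congr_of_eventuallyEq ?_
  filter_upwards [hU.mem_nhds hmem] with y hy
  exact lift_eq_replaceLast h g hy

/-- The localisation of a section to an annulus. -/
def localized (h : SmoothSection (Pt k) (chit k ε μ)) (x : Fin (k + 1) → ℝ) : ℂ :=
  (cut x : ℂ) * lift h x

theorem contDiff_ofReal_cut {d : ℕ} : ContDiff ℝ ∞ fun x : Fin d → ℝ => (cut x : ℂ) :=
  Complex.ofRealCLM.contDiff.comp contDiff_cut

theorem contDiff_localized (h : SmoothSection (Pt k) (chit k ε μ)) :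
    ContDiff ℝ ∞ (localized h) := by
  rw [contDiff_iff_contDiffAt]
  intro x
  by_cases hx : x = 0
  · subst hx
    refine (contDiffAt_const (c := (0 : ℂ))).congr_of_eventuallyEq ?_
    filter_upwards [cut_eventually_zero] with y hy
    simp [localized, hy]
  · exact contDiff_ofReal_cut.contDiffAt.mul (contDiffAt_lift h hx)

theorem localized_support (h : SmoothSection (Pt k) (chit k ε μ)) (x : Fin (k + 1) → ℝ)
    (hx : 1 < ‖x‖) : localized h x = 0 := by
  simp [localized, cut_eq_zero_of_norm hx]

theorem exists_seminorm_localized (M : ℕ) :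
    ∃ q : Seminorm ℂ (SmoothSection (Pt k) (chit k ε μ)), Continuous q ∧
      ∀ h : SmoothSection (Pt k) (chit k ε μ), ∀ j ≤ M, ∀ x,
        ‖iteratedFDeriv ℝ j (localized h) x‖ ≤ q h := by
  have hcs : HasCompactSupport (cut : (Fin (k + 1) → ℝ) → ℝ) :=
    HasCompactSupport.of_support_subset_isCompact (isCompact_closedBall 0 1) fun x hx => by
      by_contra h
      exact hx (cut_eq_zero_of_norm (by simpa using h))
  have h0 : (0 : Fin (k + 1) → ℝ) ∉ tsupport (cut : (Fin (k + 1) → ℝ) → ℝ) := by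
    rw [notMem_tsupport_iff_eventuallyEq]
    exact cut_eventually_zero
  have key : ∀ j : ℕ, ∃ q : Seminorm ℂ (SmoothSection (Pt k) (chit k ε μ)), Continuous q ∧
      ∀ h : SmoothSection (Pt k) (chit k ε μ), ∀ x,
        ‖iteratedFDeriv ℝ j (localized h) x‖ ≤ q h := by
    intro j
    obtain ⟨q, hq, h⟩ := exists_seminorm_mul_lift (ε := ε) (μ := μ) contDiff_ofReal_cut
      hcs.isCompact h0 j
    refine ⟨q, hq, fun f x => ?_⟩
    by_cases hx : x ∈ tsupport (cut : (Fin (k + 1) → ℝ) → ℝ)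
    · exact h f x hx
    · have h1 : localized f =ᶠ[𝓝 x] fun _ => 0 := by
        filter_upwards [notMem_tsupport_iff_eventuallyEq.1 hx] with y hy
        simp [localized, hy]
      rw [(h1.iteratedFDeriv ℝ j).eq_of_nhds]
      refine le_trans (le_of_eq ?_) (apply_nonneg q f)
      rw [norm_eq_zero]
      exact congrFun iteratedFDeriv_fun_zero x
  induction M with
  | zero =>
    obtain ⟨q, hq, h⟩ := key 0
    exact ⟨q, hq, fun f j hj x => by rw [Nat.le_zero.1 hj]; exact h f x⟩
  | succ M ih =>
    obtain ⟨q, hq, h⟩ := key (M + 1)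
    obtain ⟨q', hq', h'⟩ := ih
    refine ⟨q + q', hq.add hq', fun f j hj x => ?_⟩
    rw [_root_.add_apply]
    rcases Nat.lt_or_ge M j with hj' | hj'
    · rw [show j = M + 1 by omega]
      exact (h f x).trans (le_add_of_nonneg_right (apply_nonneg q' f))
    · exact (h' f j hj' x).trans (le_add_of_nonneg_left (apply_nonneg q f))

/-- The Euclidean unit sphere is compact and avoids the origin, so a seminorm bounds the lift there;
homogeneity extends the bound to all non-zero vectors. -/
theorem exists_seminorm_lift :
    ∃ q : Seminorm ℂ (SmoothSection (Pt k) (chit k ε μ)), Continuous q ∧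
      ∀ h : SmoothSection (Pt k) (chit k ε μ), ∀ x, x ≠ 0 →
        ‖lift h x‖ ≤ Real.exp (μ.re * logNorm x) * q h := by
  let S : Set (Fin (k + 1) → ℝ) := {x | ∑ i, x i ^ 2 = 1}
  have hS : IsCompact S := by
    refine (isCompact_closedBall (0 : Fin (k + 1) → ℝ) 1).of_isClosed_subset
      (isClosed_eq (by fun_prop) continuous_const) fun x hx => ?_
    rw [mem_closedBall_zero_iff, pi_norm_le_iff_of_nonneg zero_le_one]
    intro i
    have h1 : x i ^ 2 ≤ 1 := (Finset.single_le_sum (f := fun i => x i ^ 2)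
      (fun i _ => sq_nonneg _) (Finset.mem_univ i)).trans_eq hx
    rw [Real.norm_eq_abs]
    exact (sq_le_one_iff_abs_le_one _).1 h1
  obtain ⟨q, hq, h⟩ := exists_seminorm_mul_lift (ε := ε) (μ := μ) (contDiff_const (c := (1 : ℂ)))
    hS (by simp [S]) 0
  refine ⟨q, hq, fun f x hx => ?_⟩
  have h1 := h f _ (exp_logNorm_smul hx)
  rw [norm_iteratedFDeriv_zero, one_mul, lift_exp_smul, norm_mul, Complex.norm_exp] at h1
  have h2 : (μ * ((-logNorm x : ℝ) : ℂ)).re = -(μ.re * logNorm x) := by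
    rw [Complex.re_mul_ofReal]; ring
  rw [h2, Real.exp_neg, inv_mul_le_iff₀ (Real.exp_pos _)] at h1
  exact h1

end Lift

/-! ### Continuous functionals bounded by seminorms -/

section Functionals

variable {E : Type*} [AddCommGroup E] [Module ℂ E] [TopologicalSpace E] [IsTopologicalAddGroup E]
  [ContinuousSMul ℂ E]

theorem continuous_of_norm_le (T : E →ₗ[ℂ] ℂ) {q : Seminorm ℂ E} (hq : Continuous q) {K : ℝ}
    (hT : ∀ f, ‖T f‖ ≤ K * q f) : Continuous T := by
  refine continuous_of_continuousAt_zero T ?_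
  rw [ContinuousAt, map_zero]
  refine squeeze_zero_norm hT ?_
  have : Continuous fun f => K * q f := continuous_const.mul hq
  simpa using this.tendsto (0 : E)

theorem bounded_of_isVonNBounded {B : Set E} (hB : Bornology.IsVonNBounded ℂ B) {q : Seminorm ℂ E}
    (hq : Continuous q) : ∃ M : ℝ, ∀ f ∈ B, q f ≤ M := by
  have h1 : q.ball 0 1 ∈ 𝓝 (0 : E) := Seminorm.ball_mem_nhds hq one_pos
  obtain ⟨r, hr, h⟩ := (hB h1).exists_pos
  refine ⟨r, fun f hf => ?_⟩
  obtain ⟨y, hy, rfl⟩ := h (r : ℂ) (by simp [abs_of_pos hr]) hf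
  have h2 : q y < 1 := by simpa [Seminorm.mem_ball] using hy
  change q ((r : ℂ) • y) ≤ r
  rw [map_smul_eq_mul]
  simp only [Complex.norm_real, Real.norm_eq_abs, abs_of_pos hr]
  nlinarith

/-- A continuous seminorm is bounded on each von Neumann bounded set, so the Weierstrass test gives
uniform convergence there, which is convergence in the strong topology. -/
theorem summable_clm_of_seminorm {ι : Type*} {T : ι → E →L[ℂ] ℂ} {a : ι → ℝ} (ha : Summable a)
    {q : Seminorm ℂ E} (hq : Continuous q) (hT : ∀ i f, ‖T i f‖ ≤ a i * q f) : Summable T := by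
  have hs : ∀ f, Summable fun i => T i f := fun f =>
    Summable.of_norm_bounded (ha.mul_right (q f)) fun i => hT i f
  let L : E →ₗ[ℂ] ℂ :=
    { toFun := fun f => ∑' i, T i f
      map_add' := fun f g => by simp only [map_add]; exact (hs f).tsum_add (hs g)
      map_smul' := fun c f => by
        simp only [map_smul, smul_eq_mul, RingHom.id_apply]; exact tsum_mul_left }
  have hL : ∀ f, ‖L f‖ ≤ (∑' i, a i) * q f := fun f => by
    rw [← tsum_mul_right]
    exact tsum_of_norm_bounded (ha.mul_right (q f)).hasSum fun i => hT i f
  refine ⟨⟨L, continuous_of_norm_le L hq hL⟩, ?_⟩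
  refine (UniformConvergenceCLM.tendsto_iff_tendstoUniformlyOn (σ := RingHom.id ℂ) (F := ℂ)
    (𝔖 := {S : Set E | Bornology.IsVonNBounded ℂ S})).2 fun B hB => ?_
  obtain ⟨M, hM⟩ := bounded_of_isVonNBounded hB hq
  have h1 := tendstoUniformlyOn_tsum (f := fun i f => T i f) (u := fun i => |a i| * M)
    (ha.abs.mul_right M) (s := B) fun i f hf =>
      (hT i f).trans (mul_le_mul (le_abs_self _) (hM f hf) (apply_nonneg q f) (abs_nonneg _))
  refine h1.congr ?_
  filter_upwards with t f hf
  exact (_root_.sum_apply t T f).symm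

theorem hasSum_clm_apply {ι : Type*} {T : ι → E →L[ℂ] ℂ} (hT : Summable T) (f : E) :
    HasSum (fun i => T i f) ((∑' i, T i) f) := by
  let e : (E →L[ℂ] ℂ) →+ ℂ := { toFun := fun T => T f, map_zero' := rfl, map_add' := fun _ _ => rfl }
  exact hT.hasSum.map e (continuous_eval_const f)

end Functionals

/-! ### The continued functional and its residue -/

section Continued

variable {k N : ℕ} [NeZero N] (ψ : DirichletCharacter ℂ N) {ε : ZMod 2} {μ : ℂ}

theorem localized_add (h h' : SmoothSection (Pt k) (chit k ε μ)) :
    localized (h + h') = localized h + localized h' := by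
  funext x
  simp [localized, lift_add, mul_add]

theorem localized_smul (c : ℂ) (h : SmoothSection (Pt k) (chit k ε μ)) :
    localized (c • h) = c • localized h := by
  funext x
  simp [localized, lift_smul, mul_left_comm]

theorem hasCompactSupport_localized (h : SmoothSection (Pt k) (chit k ε μ)) :
    HasCompactSupport (localized h) := hasCompactSupport_of_norm (localized_support h)

theorem integrable_localized (h : SmoothSection (Pt k) (chit k ε μ)) :
    Integrable (localized h) :=
  (contDiff_localized h).continuous.integrable_of_hasCompactSupport (hasCompactSupport_localized h)

variable (ε) in
/-- The continued lattice sum, as a linear functional on sections. -/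
def continuedLin (ν : ℂ) : Wt k ε (-ν) →ₗ[ℂ] ℂ where
  toFun h := continued ψ (ν + rhoMir k) (localized h)
  map_add' h h' := by
    rw [localized_add]
    exact continued_add ψ _ (contDiff_localized h) (contDiff_localized h') (localized_support h)
      (localized_support h')
  map_smul' c h := by rw [localized_smul]; exact continued_smul ψ _ c _

variable (ε) in
/-- The continued lattice sum, as a distribution section. -/
def continuedDist (ν : ℂ) : Wtdist k ε ν where
  toLinearMap := continuedLin ψ ε ν
  cont := by
    obtain ⟨M, K, hK, h⟩ := norm_continued_le (d := k + 1) ψ (ν + rhoMir k) 1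
    obtain ⟨q, hq, h'⟩ := exists_seminorm_localized (k := k) (ε := ε) (μ := -ν - rhoMir k) M
    exact continuous_of_norm_le (K := K) (continuedLin ψ ε ν) hq fun f =>
      h _ (contDiff_localized f) (localized_support f) _ (h' f)

variable (ε) in
/-- The residue of the continued lattice sum, as a linear functional on sections. -/
def residueLin (ν : ℂ) : Wt k ε (-ν) →ₗ[ℂ] ℂ where
  toFun h := 1 / 2 * thetaConst (k + 1) ψ * ∫ x, localized h x
  map_add' h h' := by
    rw [localized_add, ← mul_add]
    congr 1
    exact integral_add (integrable_localized h) (integrable_localized h')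
  map_smul' c h := by
    rw [localized_smul]
    simp only [Pi.smul_apply, smul_eq_mul, integral_const_mul, RingHom.id_apply]
    ring

variable (ε) in
/-- The residue of the continued lattice sum at `ν = n / 2`, as a distribution section. -/
def residueDist (ν : ℂ) : Wtdist k ε ν where
  toLinearMap := residueLin ψ ε ν
  cont := by
    obtain ⟨K, hK, h⟩ := norm_ft_le (k + 1) 0 1
    obtain ⟨q, hq, h'⟩ := exists_seminorm_localized (k := k) (ε := ε) (μ := -ν - rhoMir k) 0
    refine continuous_of_norm_le (K := ‖1 / 2 * thetaConst (k + 1) ψ‖ * K) (residueLin ψ ε ν) hq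
      fun f => ?_
    change ‖1 / 2 * thetaConst (k + 1) ψ * ∫ x, localized f x‖ ≤ _
    have := h (localized f) (contDiff_localized f) (localized_support f) _ (h' f) 0
    rw [ft_zero] at this
    rw [norm_mul, mul_assoc]
    gcongr
    simpa using this

theorem continuedDist_apply (ν : ℂ) (h : Wt k ε (-ν)) :
    continuedDist ψ ε ν h = continued ψ (ν + rhoMir k) (localized h) := rfl

theorem residueDist_apply (ν : ℂ) (h : Wt k ε (-ν)) :
    residueDist ψ ε ν h = 1 / 2 * thetaConst (k + 1) ψ * ∫ x, localized h x := rfl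

theorem rhoMir_add_rhoMir (k : ℕ) : rhoMir k + rhoMir k = ((k + 1 : ℕ) : ℂ) := by
  rw [rhoMir]; push_cast; ring

theorem IsAdmissible.differentiableOn_continued_add {Φ : ℂ → (Fin (k + 1) → ℝ) → ℂ}
    (h : IsAdmissible Φ) {S : Set ℂ} (hS : S = {rhoMir k}ᶜ ∨ (ψ ≠ 1 ∧ S = Set.univ)) :
    DifferentiableOn ℂ (fun ν => continued ψ (ν + rhoMir k) (Φ (ν + rhoMir k))) S := by
  have ha : Differentiable ℂ fun ν : ℂ => ν + rhoMir k := by fun_prop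
  rcases hS with rfl | ⟨hψ, rfl⟩
  · refine (h.differentiableOn_continued ψ).comp ha.differentiableOn fun ν hν => ?_
    rw [← rhoMir_add_rhoMir]
    simpa using hν
  · exact ((h.differentiable_continued ψ hψ).comp ha).differentiableOn

theorem IsAdmissible.tendsto_continued_add {Φ : ℂ → (Fin (k + 1) → ℝ) → ℂ} (h : IsAdmissible Φ) :
    Tendsto (fun ν => (ν - rhoMir k) * continued ψ (ν + rhoMir k) (Φ (ν + rhoMir k)))
      (𝓝[≠] rhoMir k) (𝓝 (1 / 2 * thetaConst (k + 1) ψ * ∫ x, Φ (rhoMir k + rhoMir k) x)) := by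
  have h1 := h.tendsto_continued ψ
  rw [← rhoMir_add_rhoMir] at h1
  have h2 : Tendsto (fun ν : ℂ => ν + rhoMir k) (𝓝[≠] rhoMir k) (𝓝[≠] (rhoMir k + rhoMir k)) := by
    refine tendsto_nhdsWithin_of_tendsto_nhds_of_eventually_within _ ?_ ?_
    · exact ((continuous_id.add continuous_const).tendsto _).mono_left nhdsWithin_le_nhds
    · filter_upwards [self_mem_nhdsWithin] with ν hν
      simpa using hν
  refine (h1.comp h2).congr fun ν => ?_
  simp only [Function.comp]
  ring

/-- The second alternative is for cells: the logarithm of a coordinate is singular on a hyperplane,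
but the function it multiplies vanishes nearby. The origin itself is removed by the cut-off. -/
theorem isAdmissible_cut_mul {d : ℕ} {l : (Fin d → ℝ) → ℝ} {H : (Fin d → ℝ) → ℂ}
    (h : ∀ x, x ≠ 0 → (ContDiffAt ℝ ∞ l x ∧ ContDiffAt ℝ ∞ H x) ∨ H =ᶠ[𝓝 x] 0) :
    IsAdmissible fun s x => (cut x : ℂ) * (Complex.exp (-s * l x) * H x) where
  contDiff := by
    rw [contDiff_iff_contDiffAt]
    rintro ⟨s, x⟩
    have hsnd : Tendsto (Prod.snd : ℂ × (Fin d → ℝ) → _) (𝓝 (s, x)) (𝓝 x) := continuousAt_snd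
    by_cases hx : x = 0
    · subst hx
      refine (contDiffAt_const (c := (0 : ℂ))).congr_of_eventuallyEq ?_
      filter_upwards [hsnd.eventually cut_eventually_zero] with p hp
      simp [hp]
    · rcases h x hx with ⟨hl, hH⟩ | h0
      · have hl' : ContDiffAt ℝ ∞ (fun p : ℂ × (Fin d → ℝ) => ((l p.2 : ℝ) : ℂ)) (s, x) :=
          Complex.ofRealCLM.contDiff.contDiffAt.comp (s, x) (hl.comp (s, x) contDiffAt_snd)
        have hH' : ContDiffAt ℝ ∞ (fun p : ℂ × (Fin d → ℝ) => H p.2) (s, x) :=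
          hH.comp (s, x) contDiffAt_snd
        exact (contDiff_ofReal_cut.contDiffAt.comp (s, x) contDiffAt_snd).mul
          (((contDiffAt_fst.neg).mul hl').cexp.mul hH')
      · refine (contDiffAt_const (c := (0 : ℂ))).congr_of_eventuallyEq ?_
        filter_upwards [hsnd.eventually h0] with p hp
        have hp' : H p.2 = 0 := hp
        simp [hp']
  holo x := by fun_prop
  support s x hx := by simp [cut_eq_zero_of_norm hx]

/-- On unit vectors the lift is a value of `h ν` on `O(n)`, which does not depend on `ν`;
homogeneity does the rest. The reference parameter `-rhoMir k` is the one for which the lift has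
degree zero. -/
theorem lift_flat {h : (ν : ℂ) → Wt k ε (-ν)} (hh : IsFlat h) (ν : ℂ) (x : Fin (k + 1) → ℝ) :
    lift (h ν) x = Complex.exp (-(ν + rhoMir k) * logNorm x) * lift (h (-rhoMir k)) x := by
  by_cases hx : x = 0
  · subst hx; simp [lift_zero]
  obtain ⟨g, hg, hgx⟩ := exists_orthogonal_lastCol (exp_logNorm_smul hx)
  have h1 : ∀ ν, lift (h ν) x = Complex.exp ((-ν - rhoMir k) * logNorm x) * h ν g := by
    intro ν
    have h2 : x = Real.exp (logNorm x) • lastCol g := by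
      rw [hgx, smul_smul, ← Real.exp_add]; simp
    nth_rewrite 1 [h2]
    rw [lift_exp_smul, lift_orthogonal _ hg]
  rw [h1, h1, hh ν (-rhoMir k) g hg]
  rw [← mul_assoc, ← Complex.exp_add]
  ring_nf

theorem isAdmissible_flat {h : (ν : ℂ) → Wt k ε (-ν)} :
    IsAdmissible fun s x => (cut x : ℂ) *
      (Complex.exp (-s * logNorm x) * lift (h (-rhoMir k)) x) :=
  isAdmissible_cut_mul fun _ hx => Or.inl ⟨contDiffAt_logNorm hx, contDiffAt_lift _ hx⟩

theorem localized_flat {h : (ν : ℂ) → Wt k ε (-ν)} (hh : IsFlat h) (ν : ℂ) :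
    localized (h ν) = fun x => (cut x : ℂ) *
      (Complex.exp (-(ν + rhoMir k) * logNorm x) * lift (h (-rhoMir k)) x) := by
  funext x
  rw [localized, lift_flat hh]

theorem isHolomorphicFamily_continuedDist {S : Set ℂ}
    (hS : S = {rhoMir k}ᶜ ∨ (ψ ≠ 1 ∧ S = Set.univ)) :
    IsHolomorphicFamily S (fun ν => continuedDist (k := k) ψ ε ν) := by
  intro h hh
  refine ((isAdmissible_flat (h := h)).differentiableOn_continued_add ψ hS).congr fun ν _ => ?_
  rw [continuedDist_apply, localized_flat hh]

theorem tendsto_continuedDist (h : (ν : ℂ) → Wt k ε (-ν)) (hh : IsFlat h) :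
    Tendsto (fun ν => (ν - rhoMir k) * continuedDist ψ ε ν (h ν)) (𝓝[≠] rhoMir k)
      (𝓝 (residueDist ψ ε (rhoMir k) (h (rhoMir k)))) := by
  have := (isAdmissible_flat (h := h)).tendsto_continued_add ψ
  rw [residueDist_apply, localized_flat hh]
  refine this.congr fun ν => ?_
  rw [continuedDist_apply, localized_flat hh]

end Continued

/-! ### Sections supported in the open cell -/

section Cell

variable {k N : ℕ} [NeZero N] (ψ : DirichletCharacter ℂ N) {ε : ZMod 2} {μ : ℂ}

theorem lastCol_colUnipotent (x : Fin k → ℝ) :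
    lastCol (colUnipotent x) = Fin.snoc (α := fun _ => ℝ) x 1 := by
  funext i
  change colMatrix x i (Fin.last k) = _
  simp [colMatrix]

theorem det_colUnipotent (x : Fin k → ℝ) : (colUnipotent x).1.det = 1 := by
  change (colMatrix x).det = 1
  rw [Matrix.det_of_isUpperTriangular]
  · refine Finset.prod_eq_one fun i _ => ?_
    refine Fin.lastCases ?_ (fun i => ?_) i <;> simp [colMatrix, Fin.castSucc_ne_last]
  · intro i j hij
    have h1 : j < i := hij
    have h2 : j ≠ Fin.last k := (lt_of_lt_of_le h1 (Fin.le_last i)).ne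
    simp [colMatrix, h2, h1.ne']

/-- A vector with last entry `t ≠ 0` is `t` times the last column of a matrix `colUnipotent y`. If
the last entry is zero, a matrix with this last column lies outside the cell and the section
vanishes at it. -/
theorem lift_cellExtension (φ : Test k) (x : Fin (k + 1) → ℝ) :
    lift (cellExtension colUnipotent φ : SmoothSection (Pt k) (chit k ε μ)) x =
      homog φ ε μ (x (Fin.last k)) fun i => x i.castSucc := by
  obtain ⟨h1, h2⟩ := cellExtension_spec (exists_colExtension φ ε μ)
  generalize (cellExtension colUnipotent φ : SmoothSection (Pt k) (chit k ε μ)) = f at h1 h2 ⊢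
  by_cases ht : x (Fin.last k) = 0
  · rw [homog, if_pos ht]
    by_cases hx : x = 0
    · rw [hx, lift_zero]
    · obtain ⟨g, hg⟩ := exists_lastCol hx
      rw [lift_of_eq f hg, h2 g, mul_zero]
      intro y hy
      have h3 := Pt_corner_ne_zero hy
      refine h3 ?_
      have h4 : ((colUnipotent y)⁻¹ * g) (Fin.last k) (Fin.last k) =
          ∑ j, colMatrix (-y) (Fin.last k) j * x j := by
        rw [← hg]
        exact Matrix.mul_apply
      rw [h4, Fin.sum_univ_castSucc, ht]
      simp [colMatrix, Fin.castSucc_ne_last, (Fin.castSucc_ne_last _).symm]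
  · rw [homog, if_neg ht]
    set y : Fin k → ℝ := (x (Fin.last k))⁻¹ • fun i => x i.castSucc with hy
    have h3 : x = x (Fin.last k) • lastCol (colUnipotent y) := by
      rw [lastCol_colUnipotent]
      funext i
      refine Fin.lastCases ?_ (fun i => ?_) i
      · simp
      · simp only [Pi.smul_apply, Fin.snoc_castSucc, hy, smul_eq_mul]
        field_simp
    nth_rewrite 1 [h3]
    rw [lift_scale f ht, lift_lastCol, det_colUnipotent, h1]
    simp

/-- This isolates the dependence on the degree in one exponential, so that restrictions to a cell
have the shape required by `isAdmissible_cut_mul`. -/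
theorem homog_eq_exp (φ : Test k) (ε : ZMod 2) (μ : ℂ) (t : ℝ) (y : Fin k → ℝ) :
    homog φ ε μ t y = Complex.exp (μ * Real.log t) * homog φ ε 0 t y := by
  unfold homog
  split_ifs with ht
  · simp
  · have ht' : ((|t| : ℝ) : ℂ) ≠ 0 := by exact_mod_cast abs_ne_zero.2 ht
    rw [Complex.cpow_zero, Complex.cpow_def_of_ne_zero ht', ← Complex.ofReal_log (abs_nonneg t),
      Real.log_abs]
    ring_nf

theorem homog_eventually_zero (φ : Test k) (ε : ZMod 2) (μ : ℂ) {z : ℝ × (Fin k → ℝ)}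
    (ht : z.1 = 0) (hz : z.2 ≠ 0) : ∀ᶠ w in 𝓝 z, homog φ ε μ w.1 w.2 = 0 := by
  obtain ⟨R, hR⟩ := φ.hasCompactSupport.isCompact.isBounded.exists_norm_le
  have h1 : ∀ᶠ w : ℝ × (Fin k → ℝ) in 𝓝 z, |w.1| * (|R| + 1) < ‖w.2‖ := by
    refine IsOpen.mem_nhds (isOpen_lt (by fun_prop) (by fun_prop)) ?_
    change |z.1| * (|R| + 1) < ‖z.2‖
    rw [ht]; simpa using norm_pos_iff.2 hz
  filter_upwards [h1] with w hw
  unfold homog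
  split_ifs with h0
  · rfl
  · have : w.1⁻¹ • w.2 ∉ tsupport φ := by
      intro hmem
      have h2 := hR _ hmem
      have h3 : 0 < |w.1| := abs_pos.2 h0
      rw [norm_smul, norm_inv, Real.norm_eq_abs, inv_mul_le_iff₀ h3] at h2
      nlinarith [le_abs_self R]
    rw [image_eq_zero_of_notMem_tsupport this, mul_zero]

/-- Splitting off the last coordinate. -/
def splitLast (k : ℕ) (x : Fin (k + 1) → ℝ) : ℝ × (Fin k → ℝ) :=
  (x (Fin.last k), fun i => x i.castSucc)

theorem contDiff_splitLast : ContDiff ℝ ∞ (splitLast k) := by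
  unfold splitLast
  fun_prop

theorem splitLast_snd_ne_zero {x : Fin (k + 1) → ℝ} (hx : x ≠ 0) (h : (splitLast k x).1 = 0) :
    (splitLast k x).2 ≠ 0 := by
  intro h2
  refine hx (funext fun i => ?_)
  refine Fin.lastCases h (fun i => ?_) i
  exact congrFun h2 i

/-- The permutation `σ` allows one proof for both the series (identity) and its `w`-translate
(reversal of coordinates). -/
theorem isAdmissible_cell (φ : Test k) (σ : Equiv.Perm (Fin (k + 1))) :
    IsAdmissible fun s (x : Fin (k + 1) → ℝ) => (cut x : ℂ) *
      (Complex.exp (-s * Real.log (splitLast k (x ∘ σ)).1) *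
        homog φ ε 0 (splitLast k (x ∘ σ)).1 (splitLast k (x ∘ σ)).2) := by
  refine isAdmissible_cut_mul (l := fun x => Real.log (splitLast k (x ∘ σ)).1)
    (H := fun x => homog φ ε 0 (splitLast k (x ∘ σ)).1 (splitLast k (x ∘ σ)).2) fun x hx => ?_
  have hx' : x ∘ σ ≠ 0 := by
    intro h0
    refine hx (funext fun i => ?_)
    have := congrFun h0 (σ.symm i)
    simpa using this
  have hsm : ContDiff ℝ ∞ fun x : Fin (k + 1) → ℝ => splitLast k (x ∘ σ) :=
    contDiff_splitLast.comp (contDiff_pi.2 fun i => contDiff_apply ℝ ℝ (σ i))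
  by_cases ht : (splitLast k (x ∘ σ)).1 = 0
  · refine Or.inr ?_
    exact hsm.continuous.continuousAt.eventually
      (homog_eventually_zero φ ε 0 ht (splitLast_snd_ne_zero hx' ht))
  · refine Or.inl ⟨?_, ?_⟩
    · exact (Real.contDiffAt_log.2 ht).comp x (contDiff_fst.comp hsm).contDiffAt
    · exact (contDiffAt_homog φ ε 0 fun h => absurd h ht).comp x hsm.contDiffAt

theorem localized_cellExtension (φ : Test k) (ν : ℂ) :
    localized (cellExtension colUnipotent φ : Wt k ε (-ν)) = fun x => (cut x : ℂ) *
      (Complex.exp (-(ν + rhoMir k) * Real.log (splitLast k (x ∘ Equiv.refl _)).1) *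
        homog φ ε 0 (splitLast k (x ∘ Equiv.refl _)).1 (splitLast k (x ∘ Equiv.refl _)).2) := by
  funext x
  rw [localized, lift_cellExtension, homog_eq_exp, ← neg_add']
  rfl

theorem localized_translate_cellExtension (φ : Test k) (ν : ℂ) :
    localized (SmoothSection.translate (wLong (k + 1))⁻¹
      (cellExtension colUnipotent φ : Wt k ε (-ν))) = fun x => (cut x : ℂ) *
      (Complex.exp (-(ν + rhoMir k) * Real.log (splitLast k (x ∘ Fin.revPerm)).1) *
        homog φ ε 0 (splitLast k (x ∘ Fin.revPerm)).1 (splitLast k (x ∘ Fin.revPerm)).2) := by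
  funext x
  rw [localized, lift_translate_wLong, lift_cellExtension, homog_eq_exp, ← neg_add']
  rfl

theorem isHolomorphicOnCell_continuedDist {S : Set ℂ}
    (hS : S = {rhoMir k}ᶜ ∨ (ψ ≠ 1 ∧ S = Set.univ)) :
    IsHolomorphicOnCell S (colUnipotent (k := k)) (fun ν => continuedDist (k := k) ψ ε ν) := by
  intro φ
  refine ((isAdmissible_cell (ε := ε) φ (Equiv.refl _)).differentiableOn_continued_add ψ hS).congr
    fun ν _ => ?_
  rw [restrict, continuedDist_apply, localized_cellExtension]

theorem isHolomorphicOnCell_ell_continuedDist {S : Set ℂ}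
    (hS : S = {rhoMir k}ᶜ ∨ (ψ ≠ 1 ∧ S = Set.univ)) :
    IsHolomorphicOnCell S (colUnipotent (k := k))
      (fun ν => ell (wLong (k + 1)) (continuedDist (k := k) ψ ε ν)) := by
  intro φ
  refine ((isAdmissible_cell (ε := ε) φ Fin.revPerm).differentiableOn_continued_add ψ hS).congr
    fun ν _ => ?_
  change continuedDist ψ ε ν (SmoothSection.translate _ _) = _
  rw [continuedDist_apply, localized_translate_cellExtension]

theorem tendsto_restrict_continuedDist (φ : Test k) :
    Tendsto (fun ν => (ν - rhoMir k) * restrict colUnipotent (continuedDist ψ ε ν) φ)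
      (𝓝[≠] rhoMir k) (𝓝 (restrict colUnipotent (residueDist ψ ε (rhoMir k)) φ)) := by
  have := (isAdmissible_cell (ε := ε) φ (Equiv.refl _)).tendsto_continued_add ψ
  rw [restrict, residueDist_apply, localized_cellExtension]
  refine this.congr fun ν => ?_
  rw [restrict, continuedDist_apply, localized_cellExtension]

theorem tendsto_restrict_ell_continuedDist (φ : Test k) :
    Tendsto (fun ν => (ν - rhoMir k) *
        restrict colUnipotent (ell (wLong (k + 1)) (continuedDist ψ ε ν)) φ)
      (𝓝[≠] rhoMir k)
      (𝓝 (restrict colUnipotent (ell (wLong (k + 1)) (residueDist ψ ε (rhoMir k))) φ)) := by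
  have := (isAdmissible_cell (ε := ε) φ Fin.revPerm).tendsto_continued_add ψ
  change Tendsto _ _ (𝓝 (residueDist ψ ε (rhoMir k) (SmoothSection.translate _ _)))
  rw [residueDist_apply, localized_translate_cellExtension]
  refine this.congr fun ν => ?_
  change _ = _ * continuedDist ψ ε ν (SmoothSection.translate _ _)
  rw [continuedDist_apply, localized_translate_cellExtension]

/-! ### The residue does not vanish -/

theorem thetaConst_one_ne_zero (d : ℕ) : thetaConst d (1 : DirichletCharacter ℂ N) ≠ 0 := by
  classical
  have hN : (N : ℂ) ≠ 0 := by exact_mod_cast NeZero.ne N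
  refine mul_ne_zero (zpow_ne_zero _ hN) ?_
  rw [MulChar.sum_one_eq_card_units]
  exact_mod_cast Fintype.card_ne_zero

variable (k) in
/-- A non-negative test function which does not vanish at the origin. -/
def bumpTest : Test k where
  toFun x := ((⟨1, 2, one_pos, one_lt_two⟩ : ContDiffBump (0 : Fin k → ℝ)) x : ℂ)
  contDiff' := Complex.ofRealCLM.contDiff.comp (ContDiffBump.contDiff _)
  hasCompactSupport' := (ContDiffBump.hasCompactSupport _).comp_left Complex.ofReal_zero
  tsupport_subset' := fun _ _ => trivial

theorem bumpTest_eq (x : Fin k → ℝ) :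
    bumpTest k x = ((⟨1, 2, one_pos, one_lt_two⟩ : ContDiffBump (0 : Fin k → ℝ)) x : ℂ) := rfl

theorem homog_bumpTest_nonneg (m t : ℝ) (y : Fin k → ℝ) :
    ∃ r : ℝ, 0 ≤ r ∧ homog (bumpTest k) 0 m t y = r := by
  unfold homog
  split_ifs with ht
  · exact ⟨0, le_rfl, by simp⟩
  · refine ⟨|t| ^ m * (⟨1, 2, one_pos, one_lt_two⟩ : ContDiffBump (0 : Fin k → ℝ)) (t⁻¹ • y),
      mul_nonneg (Real.rpow_nonneg (abs_nonneg t) m) (ContDiffBump.nonneg _), ?_⟩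
    rw [bumpTest_eq, ← Complex.ofReal_cpow (abs_nonneg t)]
    simp

theorem homog_bumpTest_ne_zero (m : ℂ) {t : ℝ} (ht : t ≠ 0) :
    homog (bumpTest k) 0 m t 0 ≠ 0 := by
  have ht' : ((|t| : ℝ) : ℂ) ≠ 0 := by exact_mod_cast abs_ne_zero.2 ht
  unfold homog
  rw [if_neg ht, bumpTest_eq, smul_zero, ContDiffBump.one_of_mem_closedBall _ (by simp)]
  simp [Complex.cpow_eq_zero_iff, ht]

theorem integral_ne_zero_of_nonneg {d : ℕ} {f : (Fin d → ℝ) → ℂ} (hf : Continuous f)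
    (hc : HasCompactSupport f) (h : ∀ x, ∃ r : ℝ, 0 ≤ r ∧ f x = r) {x₀ : Fin d → ℝ}
    (hx₀ : f x₀ ≠ 0) : ∫ x, f x ≠ 0 := by
  choose r hr hfr using h
  have hre : r = fun x => (f x).re := by funext x; rw [hfr]; simp
  have h1 : Continuous r := by rw [hre]; fun_prop
  have h2 : HasCompactSupport r := by rw [hre]; exact hc.comp_left (g := Complex.re) rfl
  have h3 : r x₀ ≠ 0 := by
    intro h0
    exact hx₀ (by rw [hfr, h0]; simp)
  have h4 := h1.integral_pos_of_hasCompactSupport_nonneg_nonzero (μ := volume) h2 hr h3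
  simp only [hfr]
  rw [integral_complex_ofReal]
  exact_mod_cast h4.ne'

/-- The point has logarithmic norm `-3/2`, the centre of the bump. -/
theorem exists_cut_ne_zero (i : Fin (k + 1)) :
    cut (Pi.single i (Real.exp (-(3 / 2)))) ≠ 0 := by
  unfold cut
  rw [unitBump_ne_zero_iff]
  have : logNorm (Pi.single i (Real.exp (-(3 / 2))) : Fin (k + 1) → ℝ) = -(3 / 2) := by
    unfold logNorm
    rw [Finset.sum_eq_single i (fun j _ hj => by simp [hj]) (by simp), Pi.single_eq_same,
      ← Real.exp_nat_mul, Real.log_exp]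
    norm_num
  rw [this]
  norm_num

/-- At the pole the degree is the real number `-n` and the parity is even, so the localised function
of a non-negative test function is non-negative and continuous. It is non-zero at a point of the
last axis, hence has positive integral. -/
theorem restrict_residueDist_ne_zero :
    restrict colUnipotent (residueDist (k := k) (1 : DirichletCharacter ℂ N) 0 (rhoMir k))
      (bumpTest k) ≠ 0 := by
  rw [restrict, residueDist_apply]
  refine mul_ne_zero (mul_ne_zero (by norm_num) (thetaConst_one_ne_zero _)) ?_
  refine integral_ne_zero_of_nonneg (contDiff_localized _).continuous
    (hasCompactSupport_localized _) (fun x => ?_)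
    (x₀ := Pi.single (Fin.last k) (Real.exp (-(3 / 2)))) ?_
  · rw [localized, lift_cellExtension]
    have h1 : -rhoMir k - rhoMir k = ((-((k : ℝ) + 1) : ℝ) : ℂ) := by rw [rhoMir]; push_cast; ring
    rw [h1]
    obtain ⟨r, hr, h⟩ := homog_bumpTest_nonneg (k := k) (-((k : ℝ) + 1)) (x (Fin.last k))
      fun i => x i.castSucc
    exact ⟨cut x * r, mul_nonneg (cut_nonneg x) hr, by rw [h]; push_cast; rfl⟩
  · rw [localized, lift_cellExtension]
    refine mul_ne_zero (by exact_mod_cast exists_cut_ne_zero _) ?_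
    have h2 : (fun i : Fin k => (Pi.single (Fin.last k) (Real.exp (-(3 / 2))) : Fin (k + 1) → ℝ)
        i.castSucc) = 0 := by
      funext i; simp [Fin.castSucc_ne_last]
    rw [h2]
    exact homog_bumpTest_ne_zero _ (by rw [Pi.single_eq_same]; positivity)

theorem restrict_ell_residueDist_ne_zero :
    restrict colUnipotent (ell (wLong (k + 1))
      (residueDist (k := k) (1 : DirichletCharacter ℂ N) 0 (rhoMir k))) (bumpTest k) ≠ 0 := by
  change residueDist (1 : DirichletCharacter ℂ N) 0 (rhoMir k) (SmoothSection.translate _ _) ≠ 0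
  rw [residueDist_apply]
  refine mul_ne_zero (mul_ne_zero (by norm_num) (thetaConst_one_ne_zero _)) ?_
  refine integral_ne_zero_of_nonneg (contDiff_localized _).continuous
    (hasCompactSupport_localized _) (fun x => ?_)
    (x₀ := Pi.single 0 (Real.exp (-(3 / 2)))) ?_
  · rw [localized, lift_translate_wLong, lift_cellExtension]
    have h1 : -rhoMir k - rhoMir k = ((-((k : ℝ) + 1) : ℝ) : ℂ) := by rw [rhoMir]; push_cast; ring
    rw [h1]
    obtain ⟨r, hr, h⟩ := homog_bumpTest_nonneg (k := k) (-((k : ℝ) + 1)) (x (Fin.last k).rev)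
      fun i => x i.castSucc.rev
    exact ⟨cut x * r, mul_nonneg (cut_nonneg x) hr, by rw [h]; push_cast; rfl⟩
  · rw [localized, lift_translate_wLong, lift_cellExtension]
    refine mul_ne_zero (by exact_mod_cast exists_cut_ne_zero _) ?_
    have h2 : (fun i : Fin k => (Pi.single 0 (Real.exp (-(3 / 2))) : Fin (k + 1) → ℝ)
        i.castSucc.rev) = 0 := by
      funext i
      rw [Fin.rev_castSucc, Pi.single_eq_of_ne (Fin.succ_ne_zero _)]
      rfl
    rw [h2]
    exact homog_bumpTest_ne_zero _ (by rw [Fin.rev_last, Pi.single_eq_same]; positivity)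

theorem parity_eq_zero (hε : (1 : DirichletCharacter ℂ N) (-1) = (-1) ^ ε.val) : ε = 0 := by
  rw [MulChar.one_apply isUnit_one.neg] at hε
  have h : ε.val < 2 := ZMod.val_lt ε
  have h2 : ε.val = 0 := by
    interval_cases h3 : ε.val
    · rfl
    · norm_num at hε
  exact (ZMod.val_eq_zero ε).1 h2

end Cell

/-! ### Primitive vectors and cosets -/

section Primitive

variable {k : ℕ}

/-- The first column of an integral matrix. -/
def firstCol (γ : GL (Fin (k + 1)) ℤ) : Fin (k + 1) → ℤ := fun i => γ i 0

theorem firstCol_mul (γ δ : GL (Fin (k + 1)) ℤ) : firstCol (γ * δ) = γ.1 *ᵥ firstCol δ := by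
  funext i
  exact Matrix.mul_apply

theorem firstCol_one : firstCol (1 : GL (Fin (k + 1)) ℤ) = Pi.single 0 1 := by
  funext i
  change (1 : Matrix (Fin (k + 1)) (Fin (k + 1)) ℤ) i 0 = _
  rw [Matrix.one_apply, Pi.single_apply]

theorem exists_dual_firstCol (γ : GL (Fin (k + 1)) ℤ) :
    ∃ u : Fin (k + 1) → ℤ, ∑ i, u i * firstCol γ i = 1 := by
  refine ⟨fun i => γ⁻¹ 0 i, ?_⟩
  have h : (γ⁻¹.1 * γ.1) 0 0 = 1 := by rw [Units.inv_mul, Matrix.one_apply_eq]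
  rwa [Matrix.mul_apply] at h

theorem firstCol_ne_zero (γ : GL (Fin (k + 1)) ℤ) : firstCol γ ≠ 0 := by
  intro h
  obtain ⟨u, hu⟩ := exists_dual_firstCol γ
  simp [h] at hu

/-- A unimodular vector is the first column of an invertible matrix. -/
theorem exists_firstCol {v u : Fin (k + 1) → ℤ} (h : ∑ i, u i * v i = 1) :
    ∃ γ : GL (Fin (k + 1)) ℤ, firstCol γ = v := by
  let L : (Fin (k + 1) → ℤ) →ₗ[ℤ] ℤ := Fintype.linearCombination ℤ u
  have hL : ∀ z, L z = ∑ i, z i * u i := fun z => by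
    simp [L, Fintype.linearCombination_apply]
  have hv : L v = 1 := by rw [hL, ← h]; exact Finset.sum_congr rfl fun i _ => mul_comm _ _
  have hrange : LinearMap.range L = ⊤ :=
    LinearMap.range_eq_top.2 fun a => ⟨a • v, by rw [map_smul, hv]; simp⟩
  have hrank : Module.finrank ℤ (LinearMap.ker L) = k := by
    have h1 := (LinearMap.ker L).finrank_quotient_add_finrank
    rw [L.quotKerEquivRange.finrank_eq, hrange, finrank_top, Module.finrank_self,
      Module.finrank_fin_fun] at h1
    omega
  let b : Module.Basis (Fin k) ℤ (LinearMap.ker L) := Module.finBasisOfFinrankEq ℤ _ hrank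
  -- Pairing with `u` splits the lattice as `ℤ v` plus the kernel of `L`, so a basis of the kernel
  -- is completed by `v`.
  let B : Module.Basis (Fin (k + 1)) ℤ (Fin (k + 1) → ℤ) := Module.Basis.mkFinCons v b
    (fun c x hx hc => by
      have := congrArg L hc
      rw [map_add, map_smul, hv, LinearMap.mem_ker.1 hx, map_zero] at this
      simpa using this)
    (fun z => ⟨-L z, by rw [LinearMap.mem_ker, map_add, map_smul, hv]; simp⟩)
  have hB : B 0 = v := by simp [B]
  let e := Pi.basisFun ℤ (Fin (k + 1))
  refine ⟨⟨e.toMatrix B, B.toMatrix e, e.toMatrix_mul_toMatrix_flip B,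
    B.toMatrix_mul_toMatrix_flip e⟩, funext fun i => ?_⟩
  change e.toMatrix B i 0 = v i
  rw [Module.Basis.toMatrix_apply, hB]
  simp [e]

theorem firstCol_mem_Gammat0 {N : ℕ} {γ : GL (Fin (k + 1)) ℤ} :
    γ ∈ Gammat0 k N ↔ ∀ i, i ≠ 0 → (N : ℤ) ∣ firstCol γ i := by
  constructor
  · intro h i hi
    have := h i hi
    rw [← ZMod.intCast_zmod_eq_zero_iff_dvd]
    exact this
  · intro h i hi
    have := h i hi
    rw [← ZMod.intCast_zmod_eq_zero_iff_dvd] at this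
    exact this

theorem conj_wLong_apply (g : GL (Fin (k + 1)) ℝ) (i j : Fin (k + 1)) :
    ((wLong (k + 1))⁻¹ * g * wLong (k + 1)) i j = g i.rev j.rev := by
  rw [wLong_inv]
  change ((wLong (k + 1)).1 * g.1 * (wLong (k + 1)).1) i j = _
  rw [Matrix.mul_apply, Finset.sum_eq_single j.rev]
  · rw [Matrix.mul_apply, Finset.sum_eq_single i.rev]
    · simp [wLong]
    · intro l _ hl
      simp [wLong, hl]
    · simp
  · intro l _ hl
    have : j ≠ l.rev := fun h => hl (by rw [h, Fin.rev_rev])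
    simp [wLong, this]
  · simp

theorem mem_GammatInf {N : ℕ} {γ : Gammat0 k N} :
    γ ∈ GammatInf k N ↔ ∀ i, i ≠ 0 → firstCol γ.1 i = 0 := by
  have h1 : ∀ i, ((wLong (k + 1))⁻¹ * intToReal (k + 1) γ.1 * wLong (k + 1)) i (Fin.last k) =
      (firstCol γ.1 i.rev : ℝ) := by
    intro i
    rw [conj_wLong_apply, Fin.rev_last]
    rfl
  have h2 : γ ∈ GammatInf k N ↔ (wLong (k + 1))⁻¹ * intToReal (k + 1) γ.1 * wLong (k + 1) ∈ Pt k := by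
    rw [GammatInf, Subgroup.mem_comap]
    simp
  rw [h2]
  constructor
  · intro h i hi
    have h3 := h i.rev (by rwa [Ne, ← Fin.rev_zero, Fin.rev_inj])
    rw [h1, Fin.rev_rev] at h3
    exact_mod_cast h3
  · intro h j hj
    rw [h1, h _ (by rwa [Ne, Fin.rev_eq_iff, Fin.rev_zero]), Int.cast_zero]

/-- Two elements of `Γ̃₀(N)` whose first columns agree up to sign lie in the same coset. -/
theorem mk_eq_mk_of_firstCol {N : ℕ} {γ δ : Gammat0 k N} {a : ℤ}
    (h : firstCol δ.1 = a • firstCol γ.1) :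
    (γ : Gammat0 k N ⧸ GammatInf k N) = δ := by
  rw [QuotientGroup.eq, mem_GammatInf]
  intro i hi
  change firstCol (γ.1⁻¹ * δ.1) i = 0
  rw [firstCol_mul, h, Matrix.mulVec_smul, ← firstCol_mul, inv_mul_cancel, firstCol_one]
  simp [hi]

/-- An element of the stabiliser has first column `±(1, 0, …, 0)`, so changing the representative of
a coset changes the first column at most by a sign. -/
theorem exists_firstCol_out {N : ℕ} (γ : Gammat0 k N) : ∃ a : ℤ, (a = 1 ∨ a = -1) ∧
    firstCol (QuotientGroup.mk γ : Gammat0 k N ⧸ GammatInf k N).out.1 = a • firstCol γ.1 := by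
  obtain ⟨h, hh⟩ := QuotientGroup.mk_out_eq_mul (GammatInf k N) γ
  rw [hh]
  have h1 : firstCol h.1.1 = (firstCol h.1.1 0) • (Pi.single 0 1 : Fin (k + 1) → ℤ) := by
    funext i
    by_cases hi : i = 0
    · simp [hi]
    · rw [mem_GammatInf.1 h.2 i hi]; simp [hi]
  refine ⟨firstCol h.1.1 0, ?_, ?_⟩
  · obtain ⟨u, hu⟩ := exists_dual_firstCol h.1.1
    rw [Finset.sum_eq_single 0 (fun i _ hi => by rw [mem_GammatInf.1 h.2 i hi, mul_zero])
      (by simp)] at hu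
    exact Int.isUnit_iff.1 (IsUnit.of_mul_eq_one_right _ hu)
  · change firstCol (γ.1 * h.1.1) = _
    rw [firstCol_mul, h1, Matrix.mulVec_smul, ← firstCol_one, ← firstCol_mul, mul_one]
    simp [firstCol_one]

/-! ### Lattice vectors and cosets -/

/-- The parametrisation of lattice vectors by a positive integer, a sign and a coset. -/
def cosetVec {N : ℕ} (p : ℕ+ × ℤˣ × (Gammat0 k N ⧸ GammatInf k N)) : Fin (k + 1) → ℤ :=
  ((p.1 : ℤ) * (p.2.1 : ℤ)) • firstCol p.2.2.out.1

/-- Pairing both sides with a vector dual to the unimodular column of `δ` exhibits `b` as a multiple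
of `a`. -/
theorem dvd_of_smul_firstCol_eq {γ δ : GL (Fin (k + 1)) ℤ} {a b : ℤ}
    (h : a • firstCol γ = b • firstCol δ) : a ∣ b := by
  obtain ⟨u, hu⟩ := exists_dual_firstCol δ
  refine ⟨∑ i, u i * firstCol γ i, ?_⟩
  calc b = b * ∑ i, u i * firstCol δ i := by rw [hu, mul_one]
    _ = ∑ i, u i * (b • firstCol δ) i := by
        rw [Finset.mul_sum]; exact Finset.sum_congr rfl fun i _ => by simp; ring
    _ = _ := by
        rw [← h, Finset.mul_sum]; exact Finset.sum_congr rfl fun i _ => by simp; ring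

/-- The positive multiplier is recovered by mutual divisibility, the coset from the column up to
sign, and then the sign because the column of the fixed representative is non-zero. -/
theorem cosetVec_injective {N : ℕ} : Function.Injective (cosetVec (k := k) (N := N)) := by
  rintro ⟨d, s, c⟩ ⟨d', s', c'⟩ h
  have h' : ((d : ℤ) * (s : ℤ)) • firstCol c.out.1 = ((d' : ℤ) * (s' : ℤ)) • firstCol c'.out.1 := h
  have h1 : (d : ℤ) ∣ d' := by
    have := dvd_of_smul_firstCol_eq h'
    rw [Units.dvd_mul_right] at this
    exact (dvd_mul_right _ _).trans this
  have h2 : (d' : ℤ) ∣ d := by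
    have := dvd_of_smul_firstCol_eq h'.symm
    rw [Units.dvd_mul_right] at this
    exact (dvd_mul_right _ _).trans this
  have hd : d = d' := by
    have := Nat.dvd_antisymm (Int.natCast_dvd_natCast.1 h1) (Int.natCast_dvd_natCast.1 h2)
    exact PNat.coe_injective this
  subst hd
  have hd0 : (d : ℤ) ≠ 0 := by exact_mod_cast d.ne_zero
  rw [mul_smul, mul_smul] at h'
  have h3 : (s : ℤ) • firstCol c.out.1 = (s' : ℤ) • firstCol c'.out.1 := smul_right_injective _ hd0 h'
  have h4 : firstCol c'.out.1 = ((s' : ℤ) * s) • firstCol c.out.1 := by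
    rw [mul_smul, h3, ← mul_smul]
    rw [show (s' : ℤ) * s' = 1 by rw [← Units.val_mul, Int.units_mul_self, Units.val_one], one_smul]
  have hc : c = c' := by
    rw [← QuotientGroup.out_eq' c, ← QuotientGroup.out_eq' c']
    exact mk_eq_mk_of_firstCol h4
  subst hc
  have hs : (s : ℤ) = s' := smul_left_injective ℤ (firstCol_ne_zero c.out.1) h3
  rw [Units.ext hs]

theorem coef_smul_firstCol {N : ℕ} [NeZero N] (ψ : DirichletCharacter ℂ N) (γ : Gammat0 k N)
    (a : ℤ) : coef ψ (a • firstCol γ.1) = ψ (a : ZMod N) * alphat ψ γ := by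
  unfold coef
  have h : ∀ i, i ≠ 0 → (N : ℤ) ∣ (a • firstCol γ.1) i := fun i hi =>
    Dvd.dvd.mul_left (firstCol_mem_Gammat0.1 γ.2 i hi) a
  rw [if_pos h]
  rw [Pi.smul_apply, smul_eq_mul, Int.cast_mul, map_mul]
  rfl

/-- Write `v = g w` with `g` the content. If the weight is non-zero, `v 0` and hence `g` are units
modulo `N`, so the divisibility of the other entries passes from `v` to `w`, and `w` is the first
column of an element of Γ̃₀(N). -/
theorem coef_eq_zero_of_notMem_range {N : ℕ} [NeZero N] (ψ : DirichletCharacter ℂ N)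
    {v : Fin (k + 1) → ℤ} (hv : v ≠ 0) (h : v ∉ range (cosetVec (k := k) (N := N))) :
    coef ψ v = 0 := by
  by_contra hne
  apply h
  unfold coef at hne
  have hdvd : ∀ i, i ≠ 0 → (N : ℤ) ∣ v i := by
    by_contra h0
    rw [if_neg h0] at hne
    exact hne rfl
  rw [if_pos hdvd] at hne
  obtain ⟨w, hw, hg⟩ := Finset.extract_gcd v (Finset.univ_nonempty)
  obtain ⟨u, hu⟩ := Finset.gcd_eq_sum_mul Finset.univ w
  set g := Finset.univ.gcd v with hgdef
  have hw' : ∀ i, v i = g * w i := fun i => hw i (Finset.mem_univ i)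
  rw [hg] at hu
  obtain ⟨γ, hγ⟩ := exists_firstCol (v := w) (u := u) (by
    rw [hu]; exact Finset.sum_congr rfl fun i _ => by ring)
  have hunit : IsUnit ((v 0 : ℤ) : ZMod N) := by
    by_contra h0
    exact hne (ψ.map_nonunit h0)
  have hgu : IsUnit ((g : ℤ) : ZMod N) := by
    rw [hw' 0, Int.cast_mul] at hunit
    exact isUnit_of_mul_isUnit_left hunit
  have hmem : γ ∈ Gammat0 k N := by
    rw [firstCol_mem_Gammat0]
    intro i hi
    have h1 := hdvd i hi
    rw [← ZMod.intCast_zmod_eq_zero_iff_dvd, hw', Int.cast_mul] at h1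
    rw [hγ, ← ZMod.intCast_zmod_eq_zero_iff_dvd]
    exact (hgu.mul_right_eq_zero).1 h1
  have hg0 : g ≠ 0 := by
    intro h0
    refine hv (funext fun i => ?_)
    rw [hw', h0, zero_mul]; rfl
  have hgpos : 0 < g := by
    have : normalize g = g := Finset.normalize_gcd
    exact lt_of_le_of_ne (Int.nonneg_of_normalize_eq_self this) hg0.symm
  -- The chosen representative of the coset may have first column `-w`; the unit coordinate of the
  -- triple absorbs this sign.
  obtain ⟨a, ha, hout⟩ := exists_firstCol_out (⟨γ, hmem⟩ : Gammat0 k N)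
  have haa : a * a = 1 := by rcases ha with rfl | rfl <;> rfl
  refine ⟨⟨⟨g.toNat, by omega⟩, ⟨a, a, haa, haa⟩, QuotientGroup.mk ⟨γ, hmem⟩⟩, ?_⟩
  unfold cosetVec
  simp only [hout, hγ]
  funext i
  rw [Pi.smul_apply, Pi.smul_apply, hw']
  have : ((g.toNat : ℕ) : ℤ) = g := Int.toNat_of_nonneg hgpos.le
  simp only [PNat.mk_coe, this, smul_eq_mul]
  linear_combination g * w i * haa

end Primitive

/-! ### The Eisenstein series as a lattice sum -/

section LatticeSum

/-- The Euclidean norm dominates the sup norm, and `1 + ‖v‖ ≤ 2 ‖v‖` for non-zero integral `v`. -/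
theorem exp_logNorm_intCast_le {d : ℕ} {σ : ℝ} (hσ : 0 ≤ σ) {v : Fin d → ℤ} (hv : v ≠ 0) :
    Real.exp (-σ * logNorm fun i => (v i : ℝ)) ≤ 2 ^ σ * (1 + ‖v‖) ^ (-σ) := by
  have h1 : 1 ≤ ‖v‖ := by
    obtain ⟨i, hi⟩ : ∃ i, v i ≠ 0 := by
      by_contra! h
      exact hv (funext h)
    refine le_trans ?_ (norm_le_pi_norm v i)
    rw [Int.norm_eq_abs]
    exact_mod_cast Int.one_le_abs hi
  have h2 : Real.log ‖v‖ ≤ logNorm fun i => (v i : ℝ) := by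
    unfold logNorm
    rw [le_div_iff₀ two_pos, mul_comm, ← Nat.cast_two (R := ℝ), ← Real.log_pow]
    refine Real.log_le_log (by positivity) ?_
    rw [← norm_intCast_pi]
    set x : Fin d → ℝ := fun i => (v i : ℝ)
    have h3 : ‖x‖ ≤ Real.sqrt (∑ i, x i ^ 2) := by
      refine (pi_norm_le_iff_of_nonneg (Real.sqrt_nonneg _)).2 fun i => ?_
      rw [Real.norm_eq_abs, ← Real.sqrt_sq_eq_abs]
      exact Real.sqrt_le_sqrt (Finset.single_le_sum (f := fun i => x i ^ 2)
        (fun i _ => sq_nonneg _) (Finset.mem_univ i))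
    calc ‖x‖ ^ 2 ≤ Real.sqrt (∑ i, x i ^ 2) ^ 2 := by gcongr
      _ = _ := Real.sq_sqrt (Finset.sum_nonneg fun i _ => sq_nonneg _)
  have h4 : 0 < 1 + ‖v‖ := by positivity
  have h5 : Real.log (1 + ‖v‖) ≤ Real.log 2 + Real.log ‖v‖ := by
    rw [← Real.log_mul two_ne_zero (by positivity)]
    exact Real.log_le_log h4 (by linarith)
  rw [Real.rpow_def_of_pos two_pos, Real.rpow_def_of_pos h4, ← Real.exp_add, Real.exp_le_exp]
  nlinarith

variable {k N : ℕ} [NeZero N] (ψ : DirichletCharacter ℂ N) {ε : ZMod 2} {μ : ℂ}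

theorem intCast_ne_zero {d : ℕ} {v : Fin d → ℤ} (hv : v ≠ 0) : (fun i => (v i : ℝ)) ≠ 0 := by
  intro h
  refine hv (funext fun i => ?_)
  have h1 : ((v i : ℤ) : ℝ) = 0 := congrFun h i
  exact_mod_cast h1

theorem exists_seminorm_lift_intCast (hμ : μ.re ≤ 0) :
    ∃ q : Seminorm ℂ (SmoothSection (Pt k) (chit k ε μ)), Continuous q ∧
      ∀ h : SmoothSection (Pt k) (chit k ε μ), ∀ v : Fin (k + 1) → ℤ,
        ‖lift h fun i => (v i : ℝ)‖ ≤ 2 ^ (-μ.re) * (1 + ‖v‖) ^ μ.re * q h := by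
  obtain ⟨q, hq, h⟩ := exists_seminorm_lift (k := k) (ε := ε) (μ := μ)
  refine ⟨q, hq, fun f v => ?_⟩
  by_cases hv : v = 0
  · have : (fun i => (v i : ℝ)) = 0 := by rw [hv]; funext i; simp
    rw [this, lift_zero, norm_zero]
    exact mul_nonneg (by positivity) (apply_nonneg q f)
  · refine (h f _ (intCast_ne_zero hv)).trans ?_
    refine mul_le_mul_of_nonneg_right ?_ (apply_nonneg q f)
    have := exp_logNorm_intCast_le (neg_nonneg.2 hμ) hv
    rwa [neg_neg] at this

theorem summable_lattice_bound (hμ : μ.re < -((k : ℝ) + 1)) :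
    Summable fun v : Fin (k + 1) → ℤ => 2 ^ (-μ.re) * (1 + ‖v‖) ^ μ.re := by
  have := (summable_one_add_norm_rpow (d := k + 1) (p := -μ.re) (by push_cast; linarith)).mul_left
    (2 ^ (-μ.re))
  simpa using this

theorem summable_coef_mul_lift (hμ : μ.re < -((k : ℝ) + 1))
    (h : SmoothSection (Pt k) (chit k ε μ)) :
    Summable fun v : Fin (k + 1) → ℤ => coef ψ v * lift h fun i => (v i : ℝ) := by
  obtain ⟨q, hq, hb⟩ := exists_seminorm_lift_intCast (k := k) (ε := ε) (μ := μ)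
    (by linarith [(Nat.cast_nonneg k : (0 : ℝ) ≤ k)])
  refine Summable.of_norm_bounded ((summable_lattice_bound hμ).mul_right (q h)) fun v => ?_
  rw [norm_mul]
  exact (mul_le_of_le_one_left (norm_nonneg _) (norm_coef_le ψ v)).trans (hb h v)

/-- Right multiplication by `w` makes the first column the last one, and the determinant factor
disappears because `|det| = 1`. -/
theorem evalAt_mul_wLong (h : SmoothSection (Pt k) (chit k ε μ)) (γ : GL (Fin (k + 1)) ℤ) :
    h (intToReal (k + 1) γ * wLong (k + 1)) = lift h fun i => (firstCol γ i : ℝ) := by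
  have h1 : lastCol (intToReal (k + 1) γ * wLong (k + 1)) = fun i => (firstCol γ i : ℝ) := by
    funext i
    change ((intToReal (k + 1) γ).1 * (wLong (k + 1)).1) i (Fin.last k) = _
    rw [Matrix.mul_apply, Finset.sum_eq_single 0]
    · simp [wLong, Fin.rev_zero]
      rfl
    · intro l _ hl
      have : Fin.last k ≠ l.rev := fun h0 => hl (by rw [← Fin.rev_rev l, ← h0, Fin.rev_last])
      simp [wLong, this]
    · simp
  have h2 : |(intToReal (k + 1) γ * wLong (k + 1)).1.det| = 1 := by
    have h3 : (intToReal (k + 1) γ * wLong (k + 1)).1.det =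
        (intToReal (k + 1) γ).1.det * (wLong (k + 1)).1.det := Matrix.det_mul _ _
    have h4 : (intToReal (k + 1) γ).1.det = (γ.1.det : ℝ) :=
      (RingHom.map_det (Int.castRingHom ℝ) γ.1).symm
    have h5 : IsUnit γ.1.det := (Matrix.isUnit_iff_isUnit_det _).1 γ.isUnit
    rw [h3, abs_mul, abs_det_wLong, mul_one, h4, ← Int.cast_abs, Int.isUnit_iff_abs_eq.1 h5,
      Int.cast_one]
  rw [lift_of_eq h h1, h2]
  simp

theorem eisensteintTerm_apply (ν : ℂ) (c : Gammat0 k N ⧸ GammatInf k N) (h : Wt k ε (-ν)) :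
    eisensteintTerm k N ψ ε ν c h =
      alphat ψ c.out * lift h fun i => (firstCol c.out.1 i : ℝ) := by
  rw [← evalAt_mul_wLong]
  change alphat ψ c.out * h ((intToReal (k + 1) c.out.1)⁻¹⁻¹ * ((wLong (k + 1))⁻¹⁻¹ * 1)) = _
  rw [inv_inv, inv_inv, mul_one]

variable {ψ} in
theorem parity_mul_sign (hε : ψ (-1) = (-1) ^ ε.val) (s : ℤˣ) :
    ψ ((s : ℤ) : ZMod N) * ((Real.sign ((s : ℤ) : ℝ) : ℝ) : ℂ) ^ ε.val = 1 := by
  rcases Int.units_eq_one_or s with rfl | rfl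
  · simp
  · simp only [Units.val_neg, Units.val_one, Int.cast_neg, Int.cast_one, hε]
    rw [Real.sign_of_neg (by norm_num), ← mul_pow]
    simp

variable {ψ} in
-- The sign contributes `ψ(s)` through the weight and `sgn(s)^ε` through the lift; by the parity
-- condition relating `ψ` and `ε` these cancel. The multiplier `d` contributes one term of the
-- Dirichlet series.
theorem coef_mul_lift_smul (hε : ψ (-1) = (-1) ^ ε.val) (h : SmoothSection (Pt k) (chit k ε μ))
    (γ : Gammat0 k N) (d : ℕ+) (s : ℤˣ) :
    coef ψ (((d : ℤ) * (s : ℤ)) • firstCol γ.1) *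
      lift h (fun i => (((((d : ℤ) * (s : ℤ)) • firstCol γ.1) i : ℤ) : ℝ)) =
    ψ ((d : ℕ) : ZMod N) * ((d : ℕ) : ℂ) ^ μ *
      (alphat ψ γ * lift h fun i => (firstCol γ.1 i : ℝ)) := by
  have h1 : (fun i => (((((d : ℤ) * (s : ℤ)) • firstCol γ.1) i : ℤ) : ℝ)) =
      ((d : ℝ) * ((s : ℤ) : ℝ)) • fun i => (firstCol γ.1 i : ℝ) := by
    funext i; simp
  have hd : (0 : ℝ) < (d : ℕ) := by exact_mod_cast d.pos
  have hs : ((s : ℤ) : ℝ) ≠ 0 := by exact_mod_cast s.ne_zero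
  have habs : |((s : ℤ) : ℝ)| = 1 := by
    rcases Int.units_eq_one_or s with rfl | rfl <;> simp
  have hsg : Real.sign ((d : ℝ) * ((s : ℤ) : ℝ)) = Real.sign ((s : ℤ) : ℝ) := by
    rcases Int.units_eq_one_or s with rfl | rfl
    · simp [Real.sign_of_pos hd]
    · simp [Real.sign_of_neg (neg_neg_of_pos hd), Real.sign_of_neg]
  rw [h1, lift_scale h (mul_ne_zero hd.ne' hs), coef_smul_firstCol, hsg, abs_mul, habs, mul_one,
    abs_of_pos hd]
  have h2 := parity_mul_sign hε s
  push_cast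
  rw [map_mul]
  linear_combination (ψ ((d : ℕ) : ZMod N) * ((d : ℕ) : ℂ) ^ μ *
      (alphat ψ γ * lift h fun i => (firstCol γ.1 i : ℝ))) * h2

theorem re_neg_sub_rhoMir {ν : ℂ} (hν : ((k : ℝ) + 1) / 2 < ν.re) :
    (-ν - rhoMir k).re < -((k : ℝ) + 1) := by
  have : (rhoMir k).re = ((k : ℝ) + 1) / 2 := by
    rw [rhoMir, show ((k : ℂ) + 1) / 2 = ((((k : ℝ) + 1) / 2 : ℝ) : ℂ) by push_cast; ring,
      Complex.ofReal_re]
  rw [Complex.sub_re, Complex.neg_re, this]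
  linarith

theorem firstCol_out_injective : Function.Injective
    fun c : Gammat0 k N ⧸ GammatInf k N => firstCol c.out.1 := by
  intro c c' h
  have := cosetVec_injective (k := k) (N := N) (a₁ := (1, 1, c)) (a₂ := (1, 1, c'))
    (by simpa [cosetVec] using h)
  simpa using this

theorem summable_eisensteintTerm {ν : ℂ} (hν : ((k : ℝ) + 1) / 2 < ν.re) :
    Summable (eisensteintTerm k N ψ ε ν) := by
  have hμ := re_neg_sub_rhoMir hν
  obtain ⟨q, hq, hb⟩ := exists_seminorm_lift_intCast (k := k) (ε := ε) (μ := -ν - rhoMir k)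
    (by linarith [(Nat.cast_nonneg k : (0 : ℝ) ≤ k)])
  refine summable_clm_of_seminorm ((summable_lattice_bound hμ).comp_injective
    (firstCol_out_injective (k := k) (N := N))) hq fun c h => ?_
  rw [eisensteintTerm_apply, norm_mul]
  exact (mul_le_of_le_one_left (norm_nonneg _) (ψ.norm_le_one _)).trans (hb h _)

theorem hasSum_LFunction {s : ℂ} (hs : 1 < s.re) :
    HasSum (fun d : ℕ+ => ψ ((d : ℕ) : ZMod N) * ((d : ℕ) : ℂ) ^ (-s))
      (DirichletCharacter.LFunction ψ s) := by
  have h1 := (DirichletCharacter.LSeriesSummable_of_one_lt_re ψ hs).hasSum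
  rw [DirichletCharacter.LFunction_eq_LSeries ψ hs]
  have h2 := (PNat.coe_injective.hasSum_iff (f := LSeries.term (fun n : ℕ => ψ n) s)
    (fun n hn => by
      have : n = 0 := by
        by_contra h0
        exact hn ⟨⟨n, Nat.pos_of_ne_zero h0⟩, rfl⟩
      rw [this, LSeries.term_zero])).2 h1
  refine h2.congr_fun fun d => ?_
  rw [Function.comp, LSeries.term_of_ne_zero d.ne_zero, Complex.cpow_neg, div_eq_mul_inv]

/-- The summand ignores the unit, and summing over the two units gives the factor 2. The slice with
index `1`, where `a 1 = 1`, yields summability over units and cosets. -/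
theorem eq_two_mul_of_hasSum {C : Type*} {a : ℕ+ → ℂ} {t : C → ℂ} {L T S : ℂ} (ha : HasSum a L)
    (ha1 : a 1 = 1) (ht : HasSum t T)
    (h : HasSum (fun p : ℕ+ × ℤˣ × C => a p.1 * t p.2.2) S) : S = 2 * (L * T) := by
  have hs : Summable fun p : ℤˣ × C => t p.2 := by
    have := h.summable.prod_factor 1
    simpa [ha1] using this
  have h1 : ∑' p : ℤˣ × C, t p.2 = 2 * T := by
    have h2 := (hs.hasSum.prod_fiberwise fun _ => ht).unique (hasSum_fintype _)
    rw [Finset.sum_const, Finset.card_univ, Fintype.card_units_int] at h2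
    rw [h2, nsmul_eq_mul, Nat.cast_ofNat]
  have h3 := h.prod_fiberwise fun d => (h1 ▸ hs.hasSum).mul_left (a d)
  rw [h3.unique (ha.mul_right (2 * T))]
  ring

variable {ψ} in
theorem hasSum_coset (hε : ψ (-1) = (-1) ^ ε.val) {ν : ℂ} {h : Wt k ε (-ν)} {S : ℂ}
    (hS : HasSum (fun v : Fin (k + 1) → ℤ => coef ψ v * lift h fun i => (v i : ℝ)) S) :
    HasSum (fun p : ℕ+ × ℤˣ × (Gammat0 k N ⧸ GammatInf k N) =>
      ψ ((p.1 : ℕ) : ZMod N) * ((p.1 : ℕ) : ℂ) ^ (-ν - rhoMir k) *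
        eisensteintTerm k N ψ ε ν p.2.2 h) S := by
  have h2 := (cosetVec_injective.hasSum_iff (fun v hv => by
    by_cases h0 : v = 0
    · have : (fun i => (v i : ℝ)) = 0 := by rw [h0]; funext i; simp
      rw [this, lift_zero, mul_zero]
    · rw [coef_eq_zero_of_notMem_range ψ h0 hv, zero_mul])).2 hS
  refine h2.congr_fun fun p => ?_
  rw [eisensteintTerm_apply, ← coef_mul_lift_smul hε h p.2.2.out p.1 p.2.1]
  rfl

theorem lt_re_add_rhoMir {ν : ℂ} (hν : ((k : ℝ) + 1) / 2 < ν.re) :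
    (k : ℝ) + 1 < (ν + rhoMir k).re := by
  have h := re_neg_sub_rhoMir hν
  have h9 : (ν + rhoMir k).re = -(-ν - rhoMir k).re := by simp; ring
  rw [h9]; linarith

variable {ψ} in
-- Lattice vectors outside the image of `cosetVec` contribute nothing, and on the image the sum
-- factors as the L-series times the sum over cosets.
theorem hasSum_coef_mul_lift (hε : ψ (-1) = (-1) ^ ε.val) {ν : ℂ}
    (hν : ((k : ℝ) + 1) / 2 < ν.re) (h : Wt k ε (-ν)) :
    HasSum (fun v : Fin (k + 1) → ℤ => coef ψ v * lift h fun i => (v i : ℝ))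
      (2 * eisensteint k N ψ ε ν h) := by
  have h1 := (summable_coef_mul_lift ψ (re_neg_sub_rhoMir hν) h).hasSum
  have hterm := hasSum_clm_apply (summable_eisensteintTerm (k := k) (ε := ε) ψ hν) h
  have hL := hasSum_LFunction ψ (s := ν + rhoMir k)
    (by linarith [lt_re_add_rhoMir hν, (Nat.cast_nonneg k : (0 : ℝ) ≤ k)])
  rw [neg_add'] at hL
  rw [eq_two_mul_of_hasSum hL (by simp) hterm (hasSum_coset hε h1)] at h1
  exact h1

variable {ψ} in
theorem eisensteint_eq_continuedDist (hε : ψ (-1) = (-1) ^ ε.val) {ν : ℂ}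
    (hν : ((k : ℝ) + 1) / 2 < ν.re) :
    eisensteint k N ψ ε ν = continuedDist ψ ε ν := by
  ext h
  have h1 := hasSum_coef_mul_lift hε hν h
  have h2 := hasSum_continued ψ (s := ν + rhoMir k) (H := lift h) (by
      push_cast; exact lt_re_add_rhoMir hν) (lift_zero h) (fun τ x => by rw [lift_exp_smul, neg_add'])
    (contDiff_localized h) h1.summable
  exact mul_left_cancel₀ two_ne_zero (h1.unique h2)

end LatticeSum

/-! ### Expansion over the half lattice -/

section HalfLattice

/-- An even function on the lattice which vanishes on the hyperplane `v j = 0` is summed over the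
half space `v j > 0`. -/
theorem hasSum_half {d : ℕ} {f : (Fin d → ℤ) → ℂ} {a : ℂ} (j : Fin d) (hf : HasSum f (2 * a))
    (hneg : ∀ v, f (-v) = f v) (hzero : ∀ v, v j = 0 → f v = 0) :
    HasSum (fun v : {v : Fin d → ℤ // 0 < v j} => f v) a := by
  let s : Set (Fin d → ℤ) := {v | 0 < v j}
  let t : Set (Fin d → ℤ) := {v | v j < 0}
  have hs : HasSum (f ∘ (↑) : s → ℂ) (∑' v : s, f v) := (hf.summable.subtype s).hasSum
  let e : t ≃ s :=
    { toFun := fun v => ⟨-v.1, by have := v.2; simp only [t, s, mem_ofPred_eq, Pi.neg_apply] at *; omega⟩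
      invFun := fun v => ⟨-v.1, by have := v.2; simp only [t, s, mem_ofPred_eq, Pi.neg_apply] at *; omega⟩
      left_inv := fun v => by simp
      right_inv := fun v => by simp }
  have ht : HasSum (f ∘ (↑) : t → ℂ) (∑' v : s, f v) := by
    refine (e.hasSum_iff.2 hs).congr_fun fun v => ?_
    exact (hneg v.1).symm
  have hdisj : Disjoint s t := by
    rw [Set.disjoint_left]
    intro v hv hv'
    exact lt_asymm (show 0 < v j from hv) hv'
  have hst := hs.add_disjoint hdisj ht
  rw [hasSum_subtype_iff_of_support_subset] at hst
  · have h1 := hst.unique hf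
    rw [← two_mul] at h1
    have h2 := mul_left_cancel₀ two_ne_zero h1
    rw [h2] at hs
    exact hs
  · intro v hv
    rcases lt_trichotomy (v j) 0 with h | h | h
    · exact Or.inr h
    · exact absurd (hzero v h) hv
    · exact Or.inl h

variable {k N : ℕ} [NeZero k] [NeZero N] {ψ : DirichletCharacter ℂ N} {ε : ZMod 2}

theorem coef_neg {d : ℕ} [NeZero d] (hε : ψ (-1) = (-1) ^ ε.val) (v : Fin d → ℤ) :
    coef ψ (-v) = (-1) ^ ε.val * coef ψ v := by
  unfold coef
  simp only [Pi.neg_apply, dvd_neg, Int.cast_neg]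
  split_ifs
  · rw [neg_eq_neg_one_mul, map_mul, hε]
  · simp

theorem homog_neg (φ : Test k) (ε : ZMod 2) (μ : ℂ) (t : ℝ) (y : Fin k → ℝ) :
    homog φ ε μ (-t) (-y) = (-1) ^ ε.val * homog φ ε μ t y := by
  have h := homog_smul φ ε μ (a := -1) (by norm_num) t y
  rw [neg_one_mul, neg_one_smul, Real.sign_of_neg (by norm_num)] at h
  rw [h]
  simp

theorem homog_intCast (φ : Test k) (ε : ZMod 2) (μ : ℂ) {t : ℤ} (ht : 0 < t) (y : Fin k → ℝ) :
    homog φ ε μ t y = (t : ℂ) ^ μ * φ fun i => y i / t := by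
  have ht' : (0 : ℝ) < t := by exact_mod_cast ht
  rw [homog, if_neg ht'.ne', Real.sign_of_pos ht', abs_of_pos ht']
  have : ((t : ℝ)⁻¹ • y) = fun i => y i / t := by
    funext i; simp [div_eq_inv_mul]
  rw [this]
  simp

/-- The half lattice sum over vectors `v` with the entries `v_1, …, v_{n-1}` divisible by `N`. -/
theorem hasSum_reversed {g : (Fin (k + 1) → ℤ) → ℂ} {a : ℂ} (j : Fin (k + 1))
    (h : HasSum (fun v : {v : Fin (k + 1) → ℤ // 0 < v j.rev} => coef ψ v.1 * g v.1) a) :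
    HasSum (fun v : {v : Fin (k + 1) → ℤ // 0 < v j ∧ ∀ i : Fin k, (N : ℤ) ∣ v i.castSucc} =>
      ψ ((v.1 (Fin.last k) : ℤ) : ZMod N) * g fun i => v.1 i.rev) a := by
  let ι : {v : Fin (k + 1) → ℤ // 0 < v j ∧ ∀ i : Fin k, (N : ℤ) ∣ v i.castSucc} →
      {v : Fin (k + 1) → ℤ // 0 < v j.rev} := fun v => ⟨fun i => v.1 i.rev, by
        simpa using v.2.1⟩
  have hι : Function.Injective ι := by
    intro v w hvw
    refine Subtype.ext (funext fun i => ?_)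
    have := congrFun (congrArg Subtype.val hvw) i.rev
    simpa [ι] using this
  have hdiv : ∀ v : Fin (k + 1) → ℤ, (∀ i, i ≠ 0 → (N : ℤ) ∣ v i) ↔
      ∀ i : Fin k, (N : ℤ) ∣ v i.castSucc.rev := by
    intro v
    constructor
    · intro hv i
      refine hv _ ?_
      rw [Fin.rev_castSucc]
      exact Fin.succ_ne_zero _
    · intro hv i hi
      obtain ⟨i, rfl⟩ := Fin.exists_succ_eq.2 hi
      have := hv i.rev
      rwa [Fin.rev_castSucc, Fin.rev_rev] at this
  refine ((hι.hasSum_iff fun v hv => ?_).2 h).congr_fun fun v => ?_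
  · have : ¬ ∀ i, i ≠ 0 → (N : ℤ) ∣ v.1 i := by
      intro h0
      refine hv ⟨⟨fun i => v.1 i.rev, v.2, (hdiv v.1).1 h0⟩, ?_⟩
      refine Subtype.ext (funext fun i => ?_)
      simp [ι]
    rw [coef, if_neg this, zero_mul]
  · have h0 : ∀ i, i ≠ 0 → (N : ℤ) ∣ (fun i : Fin (k + 1) => v.1 i.rev) i :=
      (hdiv _).2 fun i => by simpa using v.2.2 i
    simp only [Function.comp, ι]
    rw [coef, if_pos h0, Fin.rev_zero]

/-- The weight and the homogeneous function both have parity `ε`, so their product is even; it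
vanishes on the hyperplane that bounds the cell. -/
theorem hasSum_half_cell (hε : ψ (-1) = (-1) ^ ε.val) {ν : ℂ} (hν : ((k : ℝ) + 1) / 2 < ν.re)
    (φ : Test k) :
    HasSum (fun v : {v : Fin (k + 1) → ℤ // 0 < v (Fin.last k)} => coef ψ v.1 *
        homog φ ε (-ν - rhoMir k) (v.1 (Fin.last k)) fun i => (v.1 i.castSucc : ℝ))
      (restrict colUnipotent (eisensteint k N ψ ε ν) φ) := by
  refine hasSum_half (f := fun v => coef ψ v *
    homog φ ε (-ν - rhoMir k) (v (Fin.last k)) fun i => (v i.castSucc : ℝ)) _ ?_ (fun v => ?_)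
    fun v hv => ?_
  · refine (hasSum_coef_mul_lift hε hν (cellExtension colUnipotent φ)).congr_fun fun v => ?_
    rw [lift_cellExtension]
  · have : (fun i : Fin k => (((-v) i.castSucc : ℤ) : ℝ)) = -fun i : Fin k => (v i.castSucc : ℝ) := by
      funext i; simp
    rw [this, Pi.neg_apply, Int.cast_neg, homog_neg, coef_neg hε, mul_mul_mul_comm, ← mul_pow]
    simp
  · simp [hv, homog]

theorem hasSum_half_cell_translate (hε : ψ (-1) = (-1) ^ ε.val) {ν : ℂ}
    (hν : ((k : ℝ) + 1) / 2 < ν.re) (φ : Test k) :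
    HasSum (fun v : {v : Fin (k + 1) → ℤ // 0 < v 0} => coef ψ v.1 *
        homog φ ε (-ν - rhoMir k) (v.1 0) fun i => (v.1 i.castSucc.rev : ℝ))
      (restrict colUnipotent (ell (wLong (k + 1)) (eisensteint k N ψ ε ν)) φ) := by
  refine hasSum_half (f := fun v => coef ψ v *
    homog φ ε (-ν - rhoMir k) (v 0) fun i => (v i.castSucc.rev : ℝ)) _ ?_ (fun v => ?_)
    fun v hv => ?_
  · refine (hasSum_coef_mul_lift hε hν (SmoothSection.translate (wLong (k + 1))⁻¹
      (cellExtension colUnipotent φ))).congr_fun fun v => ?_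
    rw [lift_translate_wLong, lift_cellExtension, Fin.rev_last]
  · have : (fun i : Fin k => (((-v) i.castSucc.rev : ℤ) : ℝ)) =
        -fun i : Fin k => (v i.castSucc.rev : ℝ) := by
      funext i; simp
    rw [this, Pi.neg_apply, Int.cast_neg, homog_neg, coef_neg hε, mul_mul_mul_comm, ← mul_pow]
    simp
  · simp [hv, homog]

theorem hasSum_cell (hε : ψ (-1) = (-1) ^ ε.val) {ν : ℂ} (hν : ((k : ℝ) + 1) / 2 < ν.re)
    (φ : Test k) :
    HasSum (fun v : {v : Fin (k + 1) → ℤ // 0 < v 0 ∧ ∀ i : Fin k, (N : ℤ) ∣ v i.castSucc} =>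
        ψ ((v.1 (Fin.last k) : ℤ) : ZMod N) * ((v.1 0 : ℤ) : ℂ) ^ (-ν - rhoMir k) *
          φ (fun i => (v.1 i.castSucc.rev : ℝ) / (v.1 0 : ℝ)))
      (restrict colUnipotent (eisensteint k N ψ ε ν) φ) := by
  have h := hasSum_half_cell hε hν φ
  rw [← Fin.rev_zero] at h
  refine (hasSum_reversed (g := fun v => homog φ ε (-ν - rhoMir k) (v (Fin.rev 0))
    fun i => (v i.castSucc : ℝ)) 0 h).congr_fun fun v => ?_
  simp only [Fin.rev_rev]
  rw [homog_intCast φ ε _ v.2.1, mul_assoc]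

theorem hasSum_cell_translate (hε : ψ (-1) = (-1) ^ ε.val) {ν : ℂ}
    (hν : ((k : ℝ) + 1) / 2 < ν.re) (φ : Test k) :
    HasSum (fun v : {v : Fin (k + 1) → ℤ //
          0 < v (Fin.last k) ∧ ∀ i : Fin k, (N : ℤ) ∣ v i.castSucc} =>
        ψ ((v.1 (Fin.last k) : ℤ) : ZMod N) *
          ((v.1 (Fin.last k) : ℤ) : ℂ) ^ (-ν - rhoMir k) *
          φ (fun i => (v.1 i.castSucc : ℝ) / (v.1 (Fin.last k) : ℝ)))
      (restrict colUnipotent (ell (wLong (k + 1)) (eisensteint k N ψ ε ν)) φ) := by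
  have h := hasSum_half_cell_translate hε hν φ
  rw [← Fin.rev_last k] at h
  refine (hasSum_reversed (g := fun v => homog φ ε (-ν - rhoMir k) (v (Fin.last k).rev)
    fun i => (v i.castSucc.rev : ℝ)) (Fin.last k) h).congr_fun fun v => ?_
  simp only [Fin.rev_rev]
  rw [homog_intCast φ ε _ v.2.1, mul_assoc]

end HalfLattice

/-! ### Fourier expansions on the cell -/

section Fourier

/-- Poisson summation only compares the sums over each fibre. The total passes from one family to
the other because both double series are summable. -/
theorem hasSum_of_fiberwise {A B B' : Type*} {f : A × B → ℂ} {g : A × B' → ℂ} {c : A → ℂ} {S : ℂ}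
    (hf : HasSum f S) (h1 : ∀ a, HasSum (fun b => f (a, b)) (c a))
    (h2 : ∀ a, HasSum (fun b => g (a, b)) (c a)) (hg : Summable g) : HasSum g S := by
  have h3 := hf.prod_fiberwise h1
  have h4 := hg.hasSum.prod_fiberwise h2
  rw [h3.unique h4]
  exact hg.hasSum

/-- A pair of a positive integer `d` and a vector is a vector together with a divisor. -/
def divisorEquiv (k : ℕ) : ℕ+ × (Fin k → ℤ) ≃
    Σ r : Fin k → ℤ, {d : ℕ // 0 < d ∧ ∀ i, (d : ℤ) ∣ r i} where
  toFun p := ⟨fun i => (p.1 : ℕ) * p.2 i, (p.1 : ℕ), p.1.pos, fun i => dvd_mul_right _ _⟩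
  invFun q := (⟨q.2.1, q.2.2.1⟩, fun i => q.1 i / (q.2.1 : ℤ))
  left_inv p := by
    refine Prod.ext rfl (funext fun i => ?_)
    exact Int.mul_ediv_cancel_left _ (by exact_mod_cast p.1.ne_zero)
  right_inv q := by
    obtain ⟨r, d, hd, hr⟩ := q
    have h : (fun i => (d : ℤ) * (r i / (d : ℤ))) = r :=
      funext fun i => Int.mul_ediv_cancel' (hr i)
    exact Sigma.subtype_ext h rfl

/-- Collecting the terms with the same product `r = d m` is what produces the divisor sums in the
Fourier coefficients. -/
theorem hasSum_divisors {k : ℕ} {F : ℕ+ × (Fin k → ℤ) → ℂ} {S : ℂ} (h : HasSum F S) :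
    HasSum (fun r : Fin k → ℤ => ∑' d : {d : ℕ // 0 < d ∧ ∀ i, (d : ℤ) ∣ r i},
      F (⟨d.1, d.2.1⟩, fun i => r i / (d.1 : ℤ))) S := by
  have h1 := (divisorEquiv k).symm.hasSum_iff.2 h
  exact h1.sigma fun r => (h1.summable.sigma_factor r).hasSum

theorem summable_pnat_rpow {x : ℝ} (hx : x < -1) : Summable fun e : ℕ+ => ((e : ℕ) : ℝ) ^ x :=
  (Real.summable_nat_rpow.2 hx).comp_injective PNat.coe_injective

theorem norm_natCast_mul_pi {k : ℕ} (e : ℕ+) (r : Fin k → ℤ) :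
    ‖r‖ ≤ ‖fun i => ((e : ℕ) : ℤ) * r i‖ := by
  refine (pi_norm_le_iff_of_nonneg (norm_nonneg _)).2 fun i => ?_
  refine le_trans ?_ (norm_le_pi_norm _ i)
  rw [norm_mul]
  refine le_mul_of_one_le_left (norm_nonneg _) ?_
  rw [Int.norm_natCast]
  exact_mod_cast e.pos

/-- The multiplier contributes a convergent power series in `e`. Since `‖e r‖ ≥ ‖r‖`, the decay of
the Fourier transform is summable over `r` uniformly in `e`. -/
theorem summable_fourier {k : ℕ} {f : (Fin k → ℝ) → ℂ} (hf : ContDiff ℝ ∞ f)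
    (hc : HasCompactSupport f) {a : ℝ} (ha : 0 < a) {z : ℂ} (hz : z.re < -1)
    {c : ℕ+ → (Fin k → ℤ) → ℂ} {B : ℝ} (hB : ∀ e r, ‖c e r‖ ≤ B) :
    Summable fun p : ℕ+ × (Fin k → ℤ) => ((p.1 : ℕ) : ℂ) ^ z * c p.1 p.2 *
      ft f (a⁻¹ • fun i => ((((p.1 : ℕ) : ℤ) * p.2 i : ℤ) : ℝ)) := by
  obtain ⟨C, hC0, hC⟩ := exists_norm_ft_le hf hc (k + 1)
  have hB0 : 0 ≤ B := (norm_nonneg _).trans (hB 1 0)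
  have h1 := Summable.mul_of_nonneg (summable_pnat_rpow hz)
    ((summable_one_add_norm_rpow (d := k) (p := k + 1) (by linarith)).mul_left
      (B * (C * (1 + a) ^ ((k : ℝ) + 1))))
    (fun e => by positivity) (fun r => by positivity)
  refine Summable.of_norm_bounded h1 fun p => ?_
  obtain ⟨e, r⟩ := p
  have h2 : ‖ft f (a⁻¹ • fun i => ((((e : ℕ) : ℤ) * r i : ℤ) : ℝ))‖ ≤
      C * ((1 + a) ^ ((k : ℝ) + 1) * (1 + ‖r‖) ^ (-((k : ℝ) + 1))) := by
    refine (hC _).trans (mul_le_mul_of_nonneg_left ?_ hC0)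
    rw [norm_smul, norm_intCast_pi, Real.norm_of_nonneg (inv_nonneg.2 ha.le)]
    push_cast
    refine (one_add_div_rpow_le ha (norm_nonneg _) (by positivity)).trans ?_
    refine mul_le_mul_of_nonneg_left ?_ (by positivity)
    refine Real.rpow_le_rpow_of_nonpos (by positivity) ?_ (by linarith [(Nat.cast_nonneg k : (0 : ℝ) ≤ k)])
    linarith [norm_natCast_mul_pi e r]
  rw [norm_mul, norm_mul, Complex.norm_natCast_cpow_of_pos e.pos]
  calc _ ≤ ((e : ℕ) : ℝ) ^ z.re * B *
        (C * ((1 + a) ^ ((k : ℝ) + 1) * (1 + ‖r‖) ^ (-((k : ℝ) + 1)))) := by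
        gcongr
        exact hB e r
    _ = _ := by ring

variable {k N : ℕ} [NeZero k] [NeZero N] {ψ : DirichletCharacter ℂ N} {ε : ZMod 2}

theorem neg_sub_rhoMir_add (ν : ℂ) : -ν - rhoMir k + k = -ν + rhoMir k - 1 := by
  rw [rhoMir]; ring

theorem re_neg_add_rhoMir {ν : ℂ} (hν : ((k : ℝ) + 1) / 2 < ν.re) :
    (-ν + rhoMir k - 1).re < -1 := by
  rw [← neg_sub_rhoMir_add, Complex.add_re, Complex.natCast_re]
  linarith [re_neg_sub_rhoMir hν]

/-- The cell expansion, parametrised by the last entry and the remaining vector. -/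
theorem hasSum_cell_prod (hε : ψ (-1) = (-1) ^ ε.val) {ν : ℂ} (hν : ((k : ℝ) + 1) / 2 < ν.re)
    (φ : Test k) :
    HasSum (fun p : ℕ+ × (Fin k → ℤ) => ((N * (p.1 : ℕ) : ℕ) : ℂ) ^ (-ν - rhoMir k) *
        (coef ψ p.2 * φ (((N * (p.1 : ℕ) : ℕ) : ℝ)⁻¹ • fun i => (p.2 i : ℝ))))
      (restrict colUnipotent (eisensteint k N ψ ε ν) φ) := by
  have hN : 0 < N := NeZero.pos N
  let ι : ℕ+ × (Fin k → ℤ) → {v : Fin (k + 1) → ℤ // 0 < v (Fin.last k)} := fun p =>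
    ⟨Fin.snoc (α := fun _ => ℤ) p.2 ((N * (p.1 : ℕ) : ℕ) : ℤ), by
      rw [Fin.snoc_last]
      exact_mod_cast Nat.mul_pos hN p.1.pos⟩
  have hι : Function.Injective ι := by
    rintro ⟨e, u⟩ ⟨e', u'⟩ h
    have h0 := congrArg Subtype.val h
    have h1 := congrFun h0 (Fin.last k)
    have h2 : u = u' := funext fun i => by
      have := congrFun h0 i.castSucc
      simpa [ι] using this
    simp only [ι, Fin.snoc_last] at h1
    have h3 : N * (e : ℕ) = N * (e' : ℕ) := by exact_mod_cast h1
    rw [h2, PNat.coe_injective (Nat.eq_of_mul_eq_mul_left hN h3)]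
  have hcoef : ∀ v : Fin (k + 1) → ℤ, (N : ℤ) ∣ v (Fin.last k) →
      coef ψ v = coef ψ fun i : Fin k => v i.castSucc := by
    intro v hv
    have h1 : (∀ i, i ≠ 0 → (N : ℤ) ∣ v i) ↔ ∀ i : Fin k, i ≠ 0 → (N : ℤ) ∣ v i.castSucc := by
      constructor
      · exact fun h i hi => h _ (by rwa [Ne, Fin.castSucc_eq_zero_iff])
      · intro h i
        refine Fin.lastCases (fun _ => hv) (fun i hi => ?_) i
        exact h i fun h0 => hi (by rw [h0, Fin.castSucc_zero'])
    unfold coef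
    simp only [h1, Fin.castSucc_zero']
  refine ((hι.hasSum_iff fun v hv => ?_).2 (hasSum_half_cell hε hν φ)).congr_fun fun p => ?_
  · have : ¬ ∀ i, i ≠ 0 → (N : ℤ) ∣ v.1 i := by
      intro h
      -- This is where `n ≥ 2` matters: the last entry is among those whose divisibility by `N` the
      -- weight demands, so it is a positive multiple of `N`.
      have hl : Fin.last k ≠ 0 := by
        rw [Ne, Fin.last_eq_zero_iff]
        exact NeZero.ne k
      obtain ⟨m, hm⟩ := h _ hl
      have hm0 : 0 < m := by
        have := v.2
        rw [hm] at this
        exact pos_of_mul_pos_right this (by exact_mod_cast hN.le)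
      refine hv ⟨(⟨m.toNat, by omega⟩, fun i => v.1 i.castSucc), ?_⟩
      refine Subtype.ext (funext fun i => ?_)
      refine Fin.lastCases ?_ (fun i => ?_) i
      · simp only [ι, Fin.snoc_last, PNat.mk_coe, hm]
        push_cast
        rw [Int.toNat_of_nonneg hm0.le]
      · simp [ι]
    rw [coef, if_neg this, zero_mul]
  · have hpos : (0 : ℤ) < ((N * (p.1 : ℕ) : ℕ) : ℤ) := by exact_mod_cast Nat.mul_pos hN p.1.pos
    simp only [Function.comp, ι]
    rw [hcoef _ (by rw [Fin.snoc_last]; push_cast; exact dvd_mul_right _ _)]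
    simp only [Fin.snoc_last, Fin.snoc_castSucc]
    rw [homog_intCast φ ε _ hpos, mul_left_comm, Int.cast_natCast]
    congr 3
    funext i
    simp [div_eq_inv_mul]

/-- For fixed `e` the inner sum is a theta sum at scale `t = 1 / (N e)`, so `t N = 1 / e`: its
covolume raises the exponent of `e` by `k`, and the frequencies become `e r`. -/
theorem hasSum_theta_fourier {f : (Fin k → ℝ) → ℂ} (hf : ContDiff ℝ ∞ f) (hc : HasCompactSupport f)
    {μ S : ℂ} (hμ : (μ + k).re < -1)
    (h : HasSum (fun p : ℕ+ × (Fin k → ℤ) => ((N * (p.1 : ℕ) : ℕ) : ℂ) ^ μ *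
        (coef ψ p.2 * f (((N * (p.1 : ℕ) : ℕ) : ℝ)⁻¹ • fun i => (p.2 i : ℝ)))) S) :
    HasSum (fun p : ℕ+ × (Fin k → ℤ) => ((p.1 : ℕ) : ℂ) ^ (μ + k) *
      ((N : ℂ) ^ μ * psiHat ψ (-p.2 0)) *
        ft f ((1 : ℝ)⁻¹ • fun i => ((((p.1 : ℕ) : ℤ) * p.2 i : ℤ) : ℝ))) S := by
  have hN : 0 < N := NeZero.pos N
  have hpos : ∀ e : ℕ+, (0 : ℝ) < ((N * (e : ℕ) : ℕ) : ℝ) := fun e => by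
    exact_mod_cast Nat.mul_pos hN e.pos
  have hsum := summable_fourier hf hc one_pos hμ
    (c := fun _ r => (N : ℂ) ^ μ * psiHat ψ (-r 0)) (B := ‖(N : ℂ) ^ μ‖ * N) fun e r => by
      rw [norm_mul]; gcongr; exact norm_psiHat_le ψ _
  have h1 : ∀ e : ℕ+, HasSum (fun u : Fin k → ℤ => ((N * (e : ℕ) : ℕ) : ℂ) ^ μ *
      (coef ψ u * f (((N * (e : ℕ) : ℕ) : ℝ)⁻¹ • fun i => (u i : ℝ))))
      (((N * (e : ℕ) : ℕ) : ℂ) ^ μ * thetaSum ψ f ((N * (e : ℕ) : ℕ) : ℝ)⁻¹) := fun e =>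
    (summable_thetaSum ψ hc (inv_pos.2 (hpos e))).hasSum.mul_left _
  refine hasSum_of_fiberwise h h1 (fun e => ?_) hsum
  refine ((hasSum_thetaSum ψ hf hc (inv_pos.2 (hpos e))).mul_left _).congr_fun fun r => ?_
  have he : ((e : ℕ) : ℂ) ≠ 0 := by exact_mod_cast e.ne_zero
  have h1 : ((N * (e : ℕ) : ℕ) : ℝ)⁻¹ * N = ((e : ℕ) : ℝ)⁻¹ := by
    have : (N : ℝ) ≠ 0 := by exact_mod_cast hN.ne'
    push_cast
    field_simp
  have h2 : ((N * (e : ℕ) : ℕ) : ℂ) ^ μ = (N : ℂ) ^ μ * ((e : ℕ) : ℂ) ^ μ := by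
    push_cast
    exact Complex.natCast_mul_natCast_cpow _ _ _
  have h4 : ((1 : ℝ)⁻¹ • fun i => ((((e : ℕ) : ℤ) * r i : ℤ) : ℝ)) =
      (((e : ℕ) : ℝ)⁻¹)⁻¹ • fun i => (r i : ℝ) := by
    funext i; simp
  dsimp only
  rw [h1, h2, h4, Complex.cpow_add _ _ he, Complex.cpow_natCast]
  generalize ft f _ = X
  push_cast
  rw [inv_pow, inv_inv]
  ring

/-- Grouping the frequencies `d m` of the theta expansion by their value `r` gives the divisor sum;
the exponent is `-ν - n/2 + (n - 1) = -ν + n/2 - 1`. -/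
theorem hasSum_cell_fourier (hε : ψ (-1) = (-1) ^ ε.val) {ν : ℂ} (hν : ((k : ℝ) + 1) / 2 < ν.re)
    (φ : Test k) :
    HasSum (fun r : Fin k → ℤ => aCoeff ψ ν r *
        ∫ x : Fin k → ℝ, eFun (∑ i, (r i : ℂ) * (x i : ℂ)) * φ x)
      (restrict colUnipotent (eisensteint k N ψ ε ν) φ) := by
  have hre := re_neg_add_rhoMir hν
  rw [← neg_sub_rhoMir_add] at hre
  have hG := hasSum_theta_fourier φ.contDiff φ.hasCompactSupport hre (hasSum_cell_prod hε hν φ)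
  refine (hasSum_divisors hG).congr_fun fun r => ?_
  unfold aCoeff
  rw [← tsum_mul_left, ← tsum_mul_right]
  refine tsum_congr fun d => ?_
  have h5 : (fun i => (((d.1 : ℤ) * (r i / (d.1 : ℤ)) : ℤ) : ℝ)) = fun i => (r i : ℝ) :=
    funext fun i => by rw [Int.mul_ediv_cancel' (d.2.2 i)]
  simp only [PNat.mk_coe, h5, inv_one, one_smul, ft, neg_sub_rhoMir_add, Complex.ofReal_intCast]
  ring

/-- The expansion of the translate, parametrised by the last entry and the remaining vector. -/
theorem hasSum_cell_translate_prod (hε : ψ (-1) = (-1) ^ ε.val) {ν : ℂ}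
    (hν : ((k : ℝ) + 1) / 2 < ν.re) (φ : Test k) :
    HasSum (fun p : ℕ+ × (Fin k → ℤ) => ψ ((p.1 : ℕ) : ZMod N) *
        ((p.1 : ℕ) : ℂ) ^ (-ν - rhoMir k) *
          φ (((N : ℝ) / (p.1 : ℕ)) • (0 + fun i => (p.2 i : ℝ))))
      (restrict colUnipotent (ell (wLong (k + 1)) (eisensteint k N ψ ε ν)) φ) := by
  have hN : (N : ℤ) ≠ 0 := by exact_mod_cast NeZero.ne N
  let ι : ℕ+ × (Fin k → ℤ) → {v : Fin (k + 1) → ℤ //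
      0 < v (Fin.last k) ∧ ∀ i : Fin k, (N : ℤ) ∣ v i.castSucc} := fun p =>
    ⟨Fin.snoc (α := fun _ => ℤ) (fun i => (N : ℤ) * p.2 i) ((p.1 : ℕ) : ℤ), by
      rw [Fin.snoc_last]
      exact_mod_cast p.1.pos, fun i => by rw [Fin.snoc_castSucc]; exact dvd_mul_right _ _⟩
  have hι : Function.Injective ι := by
    rintro ⟨e, u⟩ ⟨e', u'⟩ h
    have h0 := congrArg Subtype.val h
    have h1 := congrFun h0 (Fin.last k)
    have h2 : u = u' := funext fun i => by
      have := congrFun h0 i.castSucc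
      simp only [ι, Fin.snoc_castSucc] at this
      exact mul_left_cancel₀ hN this
    simp only [ι, Fin.snoc_last] at h1
    rw [h2, PNat.coe_injective (by exact_mod_cast h1 : (e : ℕ) = e')]
  refine ((hι.hasSum_iff fun v hv => ?_).2 (hasSum_cell_translate hε hν φ)).congr_fun fun p => ?_
  · refine absurd ⟨(⟨(v.1 (Fin.last k)).toNat, by have := v.2.1; omega⟩,
      fun i => v.1 i.castSucc / N), ?_⟩ hv
    refine Subtype.ext (funext fun i => ?_)
    refine Fin.lastCases ?_ (fun i => ?_) i
    · simp only [ι, Fin.snoc_last, PNat.mk_coe]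
      exact Int.toNat_of_nonneg v.2.1.le
    · simp only [ι, Fin.snoc_castSucc]
      exact Int.mul_ediv_cancel' (v.2.2 i)
  · simp only [Function.comp, ι, Fin.snoc_last, Fin.snoc_castSucc, Int.cast_natCast]
    congr 2
    funext i
    simp [div_mul_eq_mul_div]

/-- Here `ψ` depends only on the multiplier `e`, so Poisson summation runs over the unshifted
lattice of scale `N / e`. Its covolume gives `N ^ (-k) e ^ k`, and its dual lattice the frequencies
`e r / N`. -/
theorem hasSum_smul_fourier {f : (Fin k → ℝ) → ℂ} (hf : ContDiff ℝ ∞ f) (hc : HasCompactSupport f)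
    {μ S : ℂ} (hμ : (μ + k).re < -1)
    (h : HasSum (fun p : ℕ+ × (Fin k → ℤ) => ψ ((p.1 : ℕ) : ZMod N) * ((p.1 : ℕ) : ℂ) ^ μ *
          f (((N : ℝ) / (p.1 : ℕ)) • (0 + fun i => (p.2 i : ℝ)))) S) :
    HasSum (fun p : ℕ+ × (Fin k → ℤ) => ((p.1 : ℕ) : ℂ) ^ (μ + k) *
      (1 / (N : ℂ) ^ k * ψ ((p.1 : ℕ) : ZMod N)) *
        ft f ((N : ℝ)⁻¹ • fun i => ((((p.1 : ℕ) : ℤ) * p.2 i : ℤ) : ℝ))) S := by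
  have hN : (0 : ℝ) < N := by exact_mod_cast NeZero.pos N
  have hpos : ∀ e : ℕ+, (0 : ℝ) < (e : ℕ) := fun e => by exact_mod_cast e.pos
  have hsum := summable_fourier hf hc hN hμ
    (c := fun e _ => 1 / (N : ℂ) ^ k * ψ ((e : ℕ) : ZMod N))
    (B := ‖1 / (N : ℂ) ^ k‖ * 1) fun e r => by
      rw [norm_mul]; gcongr; exact ψ.norm_le_one _
  have h1 : ∀ e : ℕ+, HasSum (fun m : Fin k → ℤ => ψ ((e : ℕ) : ZMod N) * ((e : ℕ) : ℂ) ^ μ *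
      f (((N : ℝ) / (e : ℕ)) • (0 + fun i => (m i : ℝ))))
      (ψ ((e : ℕ) : ZMod N) * ((e : ℕ) : ℂ) ^ μ *
          ∑' m : Fin k → ℤ, f (((N : ℝ) / (e : ℕ)) • (0 + fun i => (m i : ℝ)))) := by
    intro e
    refine HasSum.mul_left _ (Summable.hasSum ?_)
    have h1 := finite_support_comp_smul hc (div_pos hN (hpos e))
    simp only [zero_add]
    exact summable_of_hasFiniteSupport h1
  refine hasSum_of_fiberwise h h1 (fun e => ?_) hsum
  refine ((hasSum_poisson_smul hf hc (div_pos hN (hpos e)) 0).mul_left _).congr_fun fun r => ?_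
  have he : ((e : ℕ) : ℂ) ≠ 0 := by exact_mod_cast e.ne_zero
  have h4 : ((N : ℝ)⁻¹ • fun i => ((((e : ℕ) : ℤ) * r i : ℤ) : ℝ)) =
      ((N : ℝ) / (e : ℕ))⁻¹ • fun i => (r i : ℝ) := by
    funext i
    simp
    ring
  dsimp only
  rw [h4, Complex.cpow_add _ _ he, Complex.cpow_natCast]
  simp only [Pi.zero_apply, Complex.ofReal_zero, mul_zero, Finset.sum_const_zero, neg_zero,
    eFun_zero, mul_one]
  generalize ft f _ = X
  push_cast
  rw [div_pow, inv_div]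
  ring

theorem hasSum_cell_translate_fourier (hε : ψ (-1) = (-1) ^ ε.val) {ν : ℂ}
    (hν : ((k : ℝ) + 1) / 2 < ν.re) (φ : Test k) :
    HasSum (fun r : Fin k → ℤ => cCoeff ψ ν r *
        ∫ x : Fin k → ℝ, eFun ((∑ i, (r i : ℂ) * (x i : ℂ)) / N) * φ x)
      (restrict colUnipotent (ell (wLong (k + 1)) (eisensteint k N ψ ε ν)) φ) := by
  have hre := re_neg_add_rhoMir hν
  rw [← neg_sub_rhoMir_add] at hre
  have hG := hasSum_smul_fourier φ.contDiff φ.hasCompactSupport hre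
    (hasSum_cell_translate_prod hε hν φ)
  refine (hasSum_divisors hG).congr_fun fun r => ?_
  unfold cCoeff
  rw [← tsum_mul_left, ← tsum_mul_right]
  refine tsum_congr fun d => ?_
  have h5 : (fun i => (((d.1 : ℤ) * (r i / (d.1 : ℤ)) : ℤ) : ℝ)) = fun i => (r i : ℝ) :=
    funext fun i => by rw [Int.mul_ediv_cancel' (d.2.2 i)]
  have h6 : ft φ ((N : ℝ)⁻¹ • fun i => (r i : ℝ)) =
      ∫ x : Fin k → ℝ, eFun ((∑ i, (r i : ℂ) * (x i : ℂ)) / N) * φ x := by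
    unfold ft
    congr 1
    funext x
    congr 2
    rw [Finset.sum_div]
    refine Finset.sum_congr rfl fun i _ => ?_
    simp
    ring
  simp only [PNat.mk_coe, h5, h6, neg_sub_rhoMir_add]
  ring

end Fourier

/-! ### Expansion in the first variable -/

section Slice

variable {k N : ℕ} [NeZero k] [NeZero N] {ψ : DirichletCharacter ℂ N} {ε : ZMod 2}

/-- The restriction of `f` to the line through `z` in the direction of the `0`-th coordinate. -/
def slice (f : (Fin k → ℝ) → ℂ) (z : Fin k → ℝ) (x : Fin 1 → ℝ) : ℂ := f (Function.update z 0 (x 0))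

variable (k) in
/-- The inclusion of the `0`-th coordinate axis. -/
def axis : (Fin 1 → ℝ) →L[ℝ] (Fin k → ℝ) :=
  (ContinuousLinearMap.single ℝ (fun _ : Fin k => ℝ) 0).comp (ContinuousLinearMap.proj 0)

theorem norm_axis_le : ‖axis k‖ ≤ 1 := by
  refine ContinuousLinearMap.opNorm_le_bound _ zero_le_one fun x => ?_
  have : axis k x = Pi.single 0 (x 0) := rfl
  rw [this, one_mul, Pi.norm_single]
  exact norm_le_pi_norm x 0

theorem slice_eq (f : (Fin k → ℝ) → ℂ) (z : Fin k → ℝ) :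
    slice f z = (fun y => f (Function.update z 0 0 + y)) ∘ axis k := by
  funext x
  have : Function.update z 0 (x 0) = Function.update z 0 0 + axis k x := by
    funext i
    change _ = Function.update z 0 0 i + (Pi.single 0 (x 0) : Fin k → ℝ) i
    by_cases hi : i = 0
    · subst hi; simp
    · simp [hi]
  rw [slice, this]
  rfl

theorem contDiff_slice {f : (Fin k → ℝ) → ℂ} (hf : ContDiff ℝ ∞ f) (z : Fin k → ℝ) :
    ContDiff ℝ ∞ (slice f z) := by
  rw [slice_eq]
  exact (hf.comp (contDiff_const.add contDiff_id)).comp (axis k).contDiff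

theorem slice_eq_zero {f : (Fin k → ℝ) → ℂ} {R : ℝ} (hR : ∀ y, R < ‖y‖ → f y = 0) (z : Fin k → ℝ)
    (x : Fin 1 → ℝ) (hx : R < ‖x‖) : slice f z x = 0 := by
  refine hR _ (hx.trans_le ?_)
  refine (pi_norm_le_iff_of_nonneg (norm_nonneg _)).2 fun i => ?_
  rw [Subsingleton.elim i 0]
  have := norm_le_pi_norm (Function.update z 0 (x 0)) 0
  rwa [Function.update_self] at this

/-- A slice is a translate of `f` composed with a coordinate axis of norm at most one, so its
derivatives and its support are bounded independently of `z`. -/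
theorem norm_ft_slice_le {f : (Fin k → ℝ) → ℂ} (hf : ContDiff ℝ ∞ f) (hc : HasCompactSupport f)
    {R : ℝ} (hR : ∀ y, R < ‖y‖ → f y = 0) (M : ℕ) :
    ∃ K : ℝ, 0 ≤ K ∧ ∀ z ξ, ‖ft (slice f z) ξ‖ ≤ K * (1 + ‖ξ‖) ^ (-(M : ℝ)) := by
  obtain ⟨K, hK, h⟩ := norm_ft_le 1 M R
  obtain ⟨C, hC⟩ := exists_bound_iteratedFDeriv hf hc M
  have hC0 : 0 ≤ C := (norm_nonneg _).trans (hC 0 (Nat.zero_le _) 0)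
  refine ⟨K * C, by positivity, fun z ξ => h _ (contDiff_slice hf z) (slice_eq_zero hR z) C
    (fun j hj x => ?_) ξ⟩
  have h3 : ContDiff ℝ ∞ fun y => f (Function.update z 0 0 + y) :=
    hf.comp (contDiff_const.add contDiff_id)
  rw [slice_eq, (axis k).iteratedFDeriv_comp_right h3 x (i := j) (by exact_mod_cast le_top),
    iteratedFDeriv_comp_add_left]
  refine (ContinuousMultilinearMap.norm_compContinuousLinearMap_le _ _).trans ?_
  rw [Finset.prod_const, Finset.card_univ, Fintype.card_fin]
  calc _ ≤ C * 1 := mul_le_mul (hC j hj _) (pow_le_one₀ (norm_nonneg _) norm_axis_le)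
        (by positivity) hC0
    _ = C := mul_one C

theorem snoc_zero (w : Fin k → ℤ) (b : ℤ) :
    (Fin.snoc (α := fun _ => ℤ) w b : Fin (k + 1) → ℤ) 0 = w 0 := by
  have h := Fin.snoc_castSucc (α := fun _ => ℤ) b w 0
  rwa [Fin.castSucc_zero'] at h

/-- The base point of the line attached to an integral vector. -/
def sliceBase (w : Fin k → ℤ) (i : Fin k) : ℝ :=
  ((Fin.snoc (α := fun _ => ℤ) w 0 : Fin (k + 1) → ℤ) i.castSucc.rev : ℝ) / (w 0 : ℝ)

theorem sliceBase_rev (w : Fin k → ℤ) {i : Fin k} (hi : i ≠ 0) :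
    ∃ j : Fin k, j ≠ 0 ∧ sliceBase w j = (w i : ℝ) / (w 0 : ℝ) ∧ j.castSucc.rev = i.castSucc := by
  have hi0 : 0 < i.1 := Nat.pos_of_ne_zero fun h => hi (Fin.ext (by simpa using h))
  have hk := i.2
  have h1 : (⟨k - i.1, by omega⟩ : Fin k).castSucc.rev = i.castSucc := by
    ext; simp; omega
  refine ⟨⟨k - i.1, by omega⟩, ?_, ?_, h1⟩
  · intro h
    have := congrArg Fin.val h
    simp at this
    omega
  · rw [sliceBase, h1, Fin.snoc_castSucc]

/-- The line meets the support of `f` only if every ratio `w i / w 0` with `i ≠ 0` is at most `R` in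
absolute value; then `w 0` controls the whole vector. -/
theorem one_add_norm_le_of_slice_ne_zero {f : (Fin k → ℝ) → ℂ} {R : ℝ} (hR0 : 0 ≤ R)
    (hR : ∀ y, R < ‖y‖ → f y = 0) {w : Fin k → ℤ} (hw : 0 < w 0) {x : Fin 1 → ℝ}
    (hx : slice f (sliceBase w) x ≠ 0) : 1 + ‖w‖ ≤ (2 + R) * (w 0 : ℝ) := by
  have hw1 : (1 : ℝ) ≤ (w 0 : ℝ) := by exact_mod_cast hw
  have h1 : ‖Function.update (sliceBase w) 0 (x 0)‖ ≤ R := not_lt.1 fun h => hx (hR _ h)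
  have h2 : ‖w‖ ≤ (1 + R) * (w 0 : ℝ) := by
    refine (pi_norm_le_iff_of_nonneg (by positivity)).2 fun i => ?_
    rw [Int.norm_eq_abs]
    by_cases hi : i = 0
    · rw [hi, abs_of_pos (by linarith)]
      nlinarith
    · obtain ⟨j, hj, hjw, -⟩ := sliceBase_rev w hi
      have h3 := (norm_le_pi_norm _ j).trans h1
      rw [Function.update_of_ne hj, hjw, Real.norm_eq_abs, abs_div,
        abs_of_pos (show (0 : ℝ) < (w 0 : ℝ) by linarith), div_le_iff₀ (by linarith)] at h3
      nlinarith
  nlinarith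

/-- Where the slice does not vanish, `w 0` is comparable to `1 + ‖w‖`, so its power of exponent
below `-k` is summable over ℤᵏ. Decay of order two handles the one-dimensional frequency, because `w
0 ≥ 1`. -/
theorem summable_slice {f : (Fin k → ℝ) → ℂ} (hf : ContDiff ℝ ∞ f) (hc : HasCompactSupport f)
    {μ : ℂ} (hμ : μ.re + 1 < -(k : ℝ)) {c : (Fin 1 → ℤ) → ℂ} {B : ℝ} (hB : ∀ r, ‖c r‖ ≤ B) :
    Summable fun p : {w : Fin k → ℤ // 0 < w 0} × (Fin 1 → ℤ) =>
      ((p.1.1 0 : ℤ) : ℂ) ^ (μ + 1) *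
        ft (slice f (sliceBase p.1.1)) ((p.1.1 0 : ℝ) • fun i => (p.2 i : ℝ)) * c p.2 := by
  obtain ⟨R', hR'⟩ := hc.isCompact.isBounded.exists_norm_le
  set R := |R'|
  have hR0 : 0 ≤ R := abs_nonneg _
  have hR : ∀ y, R < ‖y‖ → f y = 0 := fun y hy => by
    by_contra h0
    have := hR' y (subset_tsupport f h0)
    linarith [le_abs_self R']
  obtain ⟨K, hK, hft⟩ := norm_ft_slice_le hf hc hR 2
  have hB0 : 0 ≤ B := (norm_nonneg _).trans (hB 0)
  obtain ⟨σ, hσ⟩ : ∃ σ : ℝ, σ = -(μ.re + 1) := ⟨_, rfl⟩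
  have hσ0 : 0 < σ := by linarith [(Nat.cast_nonneg k : (0 : ℝ) ≤ k)]
  have h1 := Summable.mul_of_nonneg
    (((summable_one_add_norm_rpow (d := k) (p := σ) (by linarith)).mul_left
      ((2 + R) ^ σ)).subtype {w : Fin k → ℤ | 0 < w 0})
    ((summable_one_add_norm_rpow (d := 1) (p := 2) (by norm_num)).mul_left (K * B))
    (fun w => by change 0 ≤ (2 + R) ^ σ * (1 + ‖w.1‖) ^ (-σ); positivity)
    (fun r => by positivity)
  refine Summable.of_norm_bounded h1 fun p => ?_
  obtain ⟨⟨w, hw⟩, r⟩ := p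
  have hw1 : (1 : ℝ) ≤ (w 0 : ℝ) := by exact_mod_cast hw
  have hw0 : (0 : ℝ) < (w 0 : ℝ) := by linarith
  simp only [Function.comp]
  by_cases hz : ∀ x, slice f (sliceBase w) x = 0
  · have : ft (slice f (sliceBase w)) ((w 0 : ℝ) • fun i => (r i : ℝ)) = 0 := by
      unfold ft
      simp [hz]
    rw [this]
    simp only [mul_zero, zero_mul, norm_zero]
    positivity
  · push Not at hz
    obtain ⟨x, hx⟩ := hz
    have h2 := one_add_norm_le_of_slice_ne_zero hR0 hR hw hx
    have h3 : ‖((w 0 : ℤ) : ℂ) ^ (μ + 1)‖ ≤ (2 + R) ^ σ * (1 + ‖w‖) ^ (-σ) := by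
      have h4 : ((w 0 : ℤ) : ℂ) = (((w 0 : ℤ) : ℝ) : ℂ) := by push_cast; rfl
      rw [h4, Complex.norm_cpow_eq_rpow_re_of_pos hw0, Complex.add_re, Complex.one_re,
        show μ.re + 1 = -σ by rw [hσ, neg_neg], Real.rpow_neg hw0.le,
        Real.rpow_neg (by positivity), ← div_eq_mul_inv, ← Real.div_rpow (by positivity)
        (by positivity), ← Real.inv_rpow hw0.le]
      refine Real.rpow_le_rpow (by positivity) ?_ hσ0.le
      rw [inv_le_comm₀ hw0 (by positivity), inv_div, div_le_iff₀ (by positivity), mul_comm]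
      exact h2
    have h5 : ‖ft (slice f (sliceBase w)) ((w 0 : ℝ) • fun i => (r i : ℝ))‖ ≤
        K * (1 + ‖r‖) ^ (-(2 : ℝ)) := by
      refine (hft _ _).trans (mul_le_mul_of_nonneg_left ?_ hK)
      rw [norm_smul, norm_intCast_pi, Real.norm_of_nonneg hw0.le]
      push_cast
      refine Real.rpow_le_rpow_of_nonpos (by positivity) ?_ (by norm_num)
      nlinarith [norm_nonneg r]
    rw [norm_mul, norm_mul]
    calc _ ≤ (2 + R) ^ σ * (1 + ‖w‖) ^ (-σ) * (K * (1 + ‖r‖) ^ (-(2 : ℝ))) * B := by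
          gcongr
          exact hB r
      _ = _ := by ring

/-- This is Poisson summation in the single variable `u₁`, the others being frozen by `w`. The scale
is `1 / (N w₀)`, whose inverse supplies the extra power of `w₀`. -/
theorem hasSum_slice_fourier {f : (Fin k → ℝ) → ℂ} (hf : ContDiff ℝ ∞ f) (hc : HasCompactSupport f)
    {μ S : ℂ} (hμ : μ.re + 1 < -(k : ℝ))
    (h : HasSum (fun p : {w : Fin k → ℤ // 0 < w 0} × (Fin 1 → ℤ) =>
      (((N * p.1.1 0 : ℤ) : ℝ) : ℂ) ^ μ * (coef ψ p.2 *
        slice f (sliceBase p.1.1) (((N * p.1.1 0 : ℤ) : ℝ)⁻¹ • fun i => (p.2 i : ℝ)))) S) :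
    HasSum (fun p : {w : Fin k → ℤ // 0 < w 0} × (Fin 1 → ℤ) => (N : ℂ) ^ μ *
      (((p.1.1 0 : ℤ) : ℂ) ^ (μ + 1) *
        ft (slice f (sliceBase p.1.1)) ((p.1.1 0 : ℝ) • fun i => (p.2 i : ℝ)) *
          psiHat ψ (-p.2 0))) S := by
  have hN : (0 : ℝ) < N := by exact_mod_cast NeZero.pos N
  have hsl : ∀ z, HasCompactSupport (slice f z) := by
    obtain ⟨R, hR⟩ := hc.isCompact.isBounded.exists_norm_le
    have hR' : ∀ y, R < ‖y‖ → f y = 0 := fun y hy => by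
      by_contra h0
      exact absurd (hR y (subset_tsupport f h0)) (not_le.2 hy)
    exact fun z => hasCompactSupport_of_norm (slice_eq_zero hR' z)
  have hpos : ∀ w : {w : Fin k → ℤ // 0 < w 0}, (0 : ℝ) < ((N * w.1 0 : ℤ) : ℝ) := fun w => by
    have : (0 : ℝ) < (w.1 0 : ℝ) := by exact_mod_cast w.2
    push_cast
    positivity
  have hsum := (summable_slice hf hc hμ (c := fun r => psiHat ψ (-r 0)) (B := N)
    fun r => norm_psiHat_le ψ _).mul_left ((N : ℂ) ^ μ)
  have h1 : ∀ w : {w : Fin k → ℤ // 0 < w 0}, HasSum (fun b : Fin 1 → ℤ =>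
      (((N * w.1 0 : ℤ) : ℝ) : ℂ) ^ μ * (coef ψ b *
        slice f (sliceBase w.1) (((N * w.1 0 : ℤ) : ℝ)⁻¹ • fun i => (b i : ℝ))))
      ((((N * w.1 0 : ℤ) : ℝ) : ℂ) ^ μ *
        thetaSum ψ (slice f (sliceBase w.1)) ((N * w.1 0 : ℤ) : ℝ)⁻¹) := fun w =>
    (summable_thetaSum ψ (hsl _) (inv_pos.2 (hpos w))).hasSum.mul_left _
  refine hasSum_of_fiberwise h h1 (fun w => ?_) hsum
  refine ((hasSum_thetaSum ψ (contDiff_slice hf _) (hsl _) (inv_pos.2 (hpos w))).mul_left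
    _).congr_fun fun r => ?_
  have hw : (0 : ℝ) < (w.1 0 : ℝ) := by exact_mod_cast w.2
  have hw' : ((w.1 0 : ℤ) : ℂ) ≠ 0 := by exact_mod_cast w.2.ne'
  have h2 : ((N * w.1 0 : ℤ) : ℝ)⁻¹ * N = (w.1 0 : ℝ)⁻¹ := by
    push_cast
    field_simp
  have h3 : (((N * w.1 0 : ℤ) : ℝ) : ℂ) ^ μ = (N : ℂ) ^ μ * ((w.1 0 : ℤ) : ℂ) ^ μ := by
    push_cast
    have := Complex.mul_cpow_ofReal_nonneg hN.le hw.le μ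
    simpa using this
  dsimp only
  rw [h2, h3, inv_inv, Complex.cpow_add _ _ hw', Complex.cpow_one, pow_one]
  generalize ft _ _ = X
  push_cast
  rw [inv_inv]
  ring

/-- Write `v = (N w, b)`. The factor `N` cancels from every ratio except the one giving `u₁`, which
is `b / (N w₀)`. -/
theorem hasSum_cell_slice (hε : ψ (-1) = (-1) ^ ε.val) {ν : ℂ} (hν : ((k : ℝ) + 1) / 2 < ν.re)
    (φ : Test k) :
    HasSum (fun p : {w : Fin k → ℤ // 0 < w 0} × (Fin 1 → ℤ) =>
      (((N * p.1.1 0 : ℤ) : ℝ) : ℂ) ^ (-ν - rhoMir k) * (coef ψ p.2 *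
        slice φ (sliceBase p.1.1) (((N * p.1.1 0 : ℤ) : ℝ)⁻¹ • fun i => (p.2 i : ℝ))))
      (restrict colUnipotent (eisensteint k N ψ ε ν) φ) := by
  have hN : (N : ℤ) ≠ 0 := by exact_mod_cast NeZero.ne N
  have hN0 : (0 : ℤ) < N := by exact_mod_cast NeZero.pos N
  let ι : {w : Fin k → ℤ // 0 < w 0} × (Fin 1 → ℤ) →
      {v : Fin (k + 1) → ℤ // 0 < v 0 ∧ ∀ i : Fin k, (N : ℤ) ∣ v i.castSucc} := fun p =>
    ⟨Fin.snoc (α := fun _ => ℤ) (fun i => (N : ℤ) * p.1.1 i) (p.2 0), by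
      rw [snoc_zero]
      exact mul_pos hN0 p.1.2, fun i => by rw [Fin.snoc_castSucc]; exact dvd_mul_right _ _⟩
  have hι : Function.Injective ι := by
    rintro ⟨⟨w, hw⟩, b⟩ ⟨⟨w', hw'⟩, b'⟩ h
    have h0 := congrArg Subtype.val h
    have h1 := congrFun h0 (Fin.last k)
    have h2 : w = w' := funext fun i => by
      have := congrFun h0 i.castSucc
      simp only [ι, Fin.snoc_castSucc] at this
      exact mul_left_cancel₀ hN this
    simp only [ι, Fin.snoc_last] at h1
    have h3 : b = b' := funext fun i => by rw [Subsingleton.elim i 0]; exact h1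
    subst h2 h3
    rfl
  refine ((hι.hasSum_iff fun v hv => ?_).2 (hasSum_cell hε hν φ)).congr_fun fun p => ?_
  · refine absurd ⟨(⟨fun i => v.1 i.castSucc / N, ?_⟩, fun _ => v.1 (Fin.last k)), ?_⟩ hv
    · have h1 := v.2.1
      have h2 := v.2.2 0
      change 0 < v.1 (Fin.castSucc 0) / N
      rw [Fin.castSucc_zero'] at h2 ⊢
      exact Int.ediv_pos_of_pos_of_dvd h1 hN0.le h2
    refine Subtype.ext (funext fun i => ?_)
    refine Fin.lastCases ?_ (fun i => ?_) i
    · simp only [ι, Fin.snoc_last]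
    · simp only [ι, Fin.snoc_castSucc]
      exact Int.mul_ediv_cancel' (v.2.2 i)
  · obtain ⟨⟨w, hw⟩, b⟩ := p
    have h1 : coef ψ b = ψ ((b 0 : ℤ) : ZMod N) := by
      rw [coef, if_pos fun i hi => absurd (Subsingleton.elim i 0) hi]
    have hs0 : (Fin.snoc (α := fun _ => ℤ) (fun i => (N : ℤ) * w i) (b 0) : Fin (k + 1) → ℤ) 0 =
        N * w 0 := snoc_zero _ _
    have h2 : (fun i : Fin k => (((Fin.snoc (α := fun _ => ℤ) (fun i => (N : ℤ) * w i) (b 0) :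
        Fin (k + 1) → ℤ) i.castSucc.rev : ℤ) : ℝ) / ((N * w 0 : ℤ) : ℝ)) =
        Function.update (sliceBase w) 0 (((N * w 0 : ℤ) : ℝ)⁻¹ * (b 0 : ℝ)) := by
      funext i
      by_cases hi : i = 0
      · subst hi
        rw [Function.update_self, Fin.castSucc_zero', Fin.rev_zero, Fin.snoc_last, div_eq_inv_mul]
      · obtain ⟨j, hj⟩ : ∃ j : Fin k, i.castSucc.rev = j.castSucc := by
          have hi0 : 0 < i.1 := Nat.pos_of_ne_zero fun h => hi (Fin.ext (by simpa using h))
          have hk := i.2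
          refine ⟨⟨k - i.1, by omega⟩, ?_⟩
          ext; simp
        rw [Function.update_of_ne hi, sliceBase, hj, Fin.snoc_castSucc, Fin.snoc_castSucc]
        have hN' : (N : ℝ) ≠ 0 := by exact_mod_cast NeZero.ne N
        push_cast
        rw [mul_div_mul_left _ _ hN']
    simp only [Function.comp, ι, hs0, Fin.snoc_last, slice, h1, h2, Pi.smul_apply, smul_eq_mul]
    push_cast
    ring

theorem hasSum_cell_fourier_first (hε : ψ (-1) = (-1) ^ ε.val) {ν : ℂ}
    (hν : ((k : ℝ) + 1) / 2 < ν.re) (φ : Test k) :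
    HasSum (fun v : {v : Fin (k + 1) → ℤ // 0 < v 0} =>
        (N : ℂ) ^ (-ν - rhoMir k) * (((v.1 0 : ℤ) : ℂ) ^ (-ν - rhoMir k + 1) *
          (∫ t : ℝ, eFun ((v.1 0 : ℂ) * (v.1 (Fin.last k) : ℂ) * t) *
            φ (Function.update (fun i => (v.1 i.castSucc.rev : ℝ) / (v.1 0 : ℝ)) 0 t)) *
          psiHat ψ (-v.1 (Fin.last k))))
      (restrict colUnipotent (eisensteint k N ψ ε ν) φ) := by
  have hμ : (-ν - rhoMir k).re + 1 < -(k : ℝ) := by linarith [re_neg_sub_rhoMir hν]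
  have h := hasSum_slice_fourier φ.contDiff φ.hasCompactSupport hμ (hasSum_cell_slice hε hν φ)
  let e : {v : Fin (k + 1) → ℤ // 0 < v 0} ≃ {w : Fin k → ℤ // 0 < w 0} × (Fin 1 → ℤ) :=
    { toFun := fun v => (⟨fun i => v.1 i.castSucc, by
        change 0 < v.1 (Fin.castSucc 0)
        rw [Fin.castSucc_zero']; exact v.2⟩,
        fun _ => v.1 (Fin.last k))
      invFun := fun p => ⟨Fin.snoc (α := fun _ => ℤ) p.1.1 (p.2 0), by
        rw [snoc_zero]; exact p.1.2⟩
      left_inv := fun v => Subtype.ext (funext fun i => by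
        refine Fin.lastCases ?_ (fun i => ?_) i <;> simp)
      right_inv := fun p => by
        refine Prod.ext (Subtype.ext (funext fun i => ?_)) (funext fun i => ?_)
        · simp
        · rw [Subsingleton.elim i 0]; simp }
  refine (e.hasSum_iff.2 h).congr_fun fun v => ?_
  have h0 : (e v).1.1 0 = v.1 0 := by
    change v.1 (Fin.castSucc 0) = v.1 0
    rw [Fin.castSucc_zero']
  have h1 : ∀ t : ℝ, Function.update (fun i : Fin k => (v.1 i.castSucc.rev : ℝ) / (v.1 0 : ℝ)) 0 t =
      Function.update (sliceBase (e v).1.1) 0 t := by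
    intro t
    funext i
    by_cases hi : i = 0
    · subst hi; simp
    · obtain ⟨j, hj⟩ : ∃ j : Fin k, i.castSucc.rev = j.castSucc := by
        have hi0 : 0 < i.1 := Nat.pos_of_ne_zero fun h => hi (Fin.ext (by simpa using h))
        have hk := i.2
        refine ⟨⟨k - i.1, by omega⟩, ?_⟩
        ext; simp
      rw [Function.update_of_ne hi, Function.update_of_ne hi, sliceBase, h0, hj, Fin.snoc_castSucc]
      rfl
  have h2 : ft (slice φ (sliceBase (e v).1.1)) (((e v).1.1 0 : ℝ) • fun i => ((e v).2 i : ℝ)) =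
      ∫ t : ℝ, eFun ((v.1 0 : ℂ) * (v.1 (Fin.last k) : ℂ) * t) *
        φ (Function.update (fun i => (v.1 i.castSucc.rev : ℝ) / (v.1 0 : ℝ)) 0 t) := by
    have h3 := (volume_preserving_funUnique (Fin 1) ℝ).integral_comp
      (MeasurableEquiv.funUnique (Fin 1) ℝ).measurableEmbedding
      fun t : ℝ => eFun ((v.1 0 : ℂ) * (v.1 (Fin.last k) : ℂ) * t) *
        φ (Function.update (fun i => (v.1 i.castSucc.rev : ℝ) / (v.1 0 : ℝ)) 0 t)
    rw [← h3, ft]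
    congr 1
    funext x
    rw [h1, slice, h0]
    congr 2
    rw [Fin.sum_univ_one]
    simp only [Pi.smul_apply, smul_eq_mul]
    push_cast
    rfl
  simp only [Function.comp]
  rw [h2, h0]
  rfl

end Slice

/-! ### The contragredient automorphism -/

section Twist

variable {n : ℕ} {R : Type*} [CommRing R]

/-- The automorphism `g ↦ w (gᵗ)⁻¹ w` of `GL(n, R)`. -/
def twist (g : GL (Fin n) R) : GL (Fin n) R where
  val := Matrix.of fun i j => g⁻¹.1 j.rev i.rev
  inv := Matrix.of fun i j => g.1 j.rev i.rev
  val_inv := by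
    ext i j
    have h : (g.1 * g⁻¹.1) j.rev i.rev = (1 : Matrix (Fin n) (Fin n) R) j.rev i.rev := by
      rw [Units.mul_inv]
    rw [Matrix.mul_apply, ← Equiv.sum_comp Fin.revPerm] at h
    rw [Matrix.mul_apply]
    simp only [Matrix.of_apply]
    calc ∑ l : Fin n, g⁻¹.1 l.rev i.rev * g.1 j.rev l.rev
        = ∑ l : Fin n, g.1 j.rev l.rev * g⁻¹.1 l.rev i.rev :=
          Finset.sum_congr rfl fun l _ => mul_comm _ _
      _ = (1 : Matrix (Fin n) (Fin n) R) j.rev i.rev := h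
      _ = _ := by simp [Matrix.one_apply, eq_comm]
  inv_val := by
    ext i j
    have h : (g⁻¹.1 * g.1) j.rev i.rev = (1 : Matrix (Fin n) (Fin n) R) j.rev i.rev := by
      rw [Units.inv_mul]
    rw [Matrix.mul_apply, ← Equiv.sum_comp Fin.revPerm] at h
    rw [Matrix.mul_apply]
    simp only [Matrix.of_apply]
    calc ∑ l : Fin n, g.1 l.rev i.rev * g⁻¹.1 j.rev l.rev
        = ∑ l : Fin n, g⁻¹.1 j.rev l.rev * g.1 l.rev i.rev :=
          Finset.sum_congr rfl fun l _ => mul_comm _ _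
      _ = (1 : Matrix (Fin n) (Fin n) R) j.rev i.rev := h
      _ = _ := by simp [Matrix.one_apply, eq_comm]

theorem twist_apply (g : GL (Fin n) R) (i j : Fin n) : twist g i j = g⁻¹ j.rev i.rev := rfl

theorem twist_inv_apply (g : GL (Fin n) R) (i j : Fin n) : (twist g)⁻¹ i j = g j.rev i.rev := rfl

theorem twist_twist (g : GL (Fin n) R) : twist (twist g) = g := by
  ext i j
  rw [twist_apply, twist_inv_apply, Fin.rev_rev, Fin.rev_rev]

theorem twist_mul (g h : GL (Fin n) R) : twist (g * h) = twist g * twist h := by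
  ext i j
  change (g * h)⁻¹ j.rev i.rev = ((twist g).1 * (twist h).1) i j
  rw [mul_inv_rev]
  change (h⁻¹.1 * g⁻¹.1) j.rev i.rev = _
  rw [Matrix.mul_apply, Matrix.mul_apply, ← Equiv.sum_comp Fin.revPerm]
  exact Finset.sum_congr rfl fun l _ => mul_comm _ _

theorem twist_one : twist (1 : GL (Fin n) R) = 1 := by
  have h := twist_mul (1 : GL (Fin n) R) 1
  rw [mul_one] at h
  exact (mul_eq_left.1 h.symm)

theorem twist_inv (g : GL (Fin n) R) : twist g⁻¹ = (twist g)⁻¹ :=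
  eq_inv_of_mul_eq_one_left (by rw [← twist_mul, inv_mul_cancel, twist_one])

theorem twist_map {S : Type*} [CommRing S] (f : R →+* S) (g : GL (Fin n) R) :
    twist (Matrix.GeneralLinearGroup.map f g) = Matrix.GeneralLinearGroup.map f (twist g) := by
  ext i j
  change (Matrix.GeneralLinearGroup.map f g)⁻¹ j.rev i.rev = f (g⁻¹ j.rev i.rev)
  rw [← map_inv]
  rfl

theorem twist_mem_colSubgroup {i : Fin n} {g : GL (Fin n) R} (hg : g ∈ rowSubgroup R i.rev) :
    twist g ∈ colSubgroup R i := by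
  intro j hj
  rw [twist_apply]
  exact (rowSubgroup R i.rev).inv_mem hg j.rev (by rwa [Ne, Fin.rev_inj])

theorem twist_mem_rowSubgroup {i : Fin n} {g : GL (Fin n) R} (hg : g ∈ colSubgroup R i.rev) :
    twist g ∈ rowSubgroup R i := by
  intro j hj
  rw [twist_apply]
  exact (colSubgroup R i.rev).inv_mem hg j.rev (by rwa [Ne, Fin.rev_inj])

theorem det_twist (g : GL (Fin n) ℝ) : (twist g).1.det = g.1.det⁻¹ := by
  rw [← det_inv', ← Matrix.det_transpose g⁻¹.1,
    ← Matrix.det_submatrix_equiv_self Fin.revPerm g⁻¹.1ᵀ]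
  rfl

theorem twist_wLong (n : ℕ) : twist (wLong n) = wLong n := by
  ext i j
  change (wLong n)⁻¹ j.rev i.rev = wLong n i j
  rw [wLong_inv]
  simp [wLong, eq_comm]

variable {k : ℕ}

theorem twist_mem_Pt {p : GL (Fin (k + 1)) ℝ} (hp : p ∈ P k) : twist p ∈ Pt k :=
  twist_mem_colSubgroup (by rwa [Fin.rev_last])

theorem twist_mem_P {p : GL (Fin (k + 1)) ℝ} (hp : p ∈ Pt k) : twist p ∈ P k :=
  twist_mem_rowSubgroup (by rwa [Fin.rev_zero])

/-- The contragredient inverts both the determinant and the corner entry, and the two characters,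
written in these terms, have opposite exponents. -/
theorem chi_twist {p : GL (Fin (k + 1)) ℝ} (hp : p ∈ Pt k) (ε : ZMod 2) (μ : ℂ) :
    chi k ε μ (twist p) = chit k ε μ p := by
  have h1 : twist p 0 0 = (p (Fin.last k) (Fin.last k))⁻¹ := by
    rw [twist_apply, Fin.rev_zero, Pt_inv_corner hp]
  rw [chi_eq (twist_mem_P hp), chit_eq hp, h1, det_twist, abs_cpow_inv, abs_cpow_inv, sign_inv',
    neg_div, neg_neg]

theorem twist_colUnipotent (x : Fin k → ℝ) : twist (colUnipotent x) = rowUnipotent (-x) := by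
  ext i j
  change colMatrix (-x) j.rev i.rev = rowMatrix (-x) i j
  refine Fin.cases ?_ (fun i => ?_) i <;> refine Fin.cases ?_ (fun j => ?_) j <;>
    simp [rowMatrix, colMatrix, Fin.succ_ne_zero, Fin.rev_succ, Fin.rev_zero,
      (Fin.castSucc_ne_last _).symm, eq_comm]

theorem twist_orthogonal {g : GL (Fin n) ℝ} (hg : g.1 ∈ Matrix.orthogonalGroup (Fin n) ℝ) :
    (twist g).1 ∈ Matrix.orthogonalGroup (Fin n) ℝ := by
  rw [Matrix.mem_orthogonalGroup_iff] at hg ⊢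
  have h1 : g⁻¹.1 = g.1ᵀ := by
    have : g⁻¹.1 = g⁻¹.1 * (g.1 * g.1ᵀ) := by rw [hg, mul_one]
    rw [this, ← mul_assoc, Units.inv_mul, one_mul]
  have h2 : (twist g).1ᵀ = (twist g)⁻¹.1 := by
    ext i j
    change g⁻¹.1 i.rev j.rev = g.1 j.rev i.rev
    rw [h1]
    rfl
  rw [h2, Units.mul_inv]

/-- The contragredient on arrays. -/
def twistArray (A : Fin n → Fin n → ℝ) (i j : Fin n) : ℝ := (Matrix.of A)⁻¹ j.rev i.rev

theorem contDiffOn_twistArray : ContDiffOn ℝ ∞ (twistArray (n := n)) (invertibleSet n) := by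
  intro A hA
  refine (contDiffAt_pi.2 fun a => contDiffAt_pi.2 fun b => ?_).contDiffWithinAt
  -- Cramer's rule writes the entries of the inverse as polynomials over the determinant.
  have h1 : ∀ A : Fin n → Fin n → ℝ, twistArray A a b =
      (Matrix.of A).det⁻¹ * ((Matrix.of A).updateRow a.rev (Pi.single b.rev 1)).det := by
    intro A
    rw [twistArray, Matrix.inv_def, Matrix.smul_apply, Matrix.adjugate_apply,
      Ring.inverse_eq_inv', smul_eq_mul]
  simp only [h1]
  refine ContDiffAt.mul (ContDiffAt.inv ?_ hA) ?_
  · exact (contDiff_det (M := fun A : Fin n → Fin n → ℝ => Matrix.of A)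
      (fun i j => contDiff_entry i j)).contDiffAt
  · refine (contDiff_det fun i j => ?_).contDiffAt
    by_cases hij : i = a.rev
    · subst hij
      simp only [Matrix.updateRow_self]
      exact contDiff_const
    · simp only [Matrix.updateRow_ne hij]
      exact contDiff_entry i j

theorem twistArray_coe (g : GL (Fin n) ℝ) : twistArray (fun i j => g i j) = fun i j => twist g i j := by
  funext i j
  rw [twist_apply, twistArray]
  change (g.1)⁻¹ j.rev i.rev = g⁻¹.1 j.rev i.rev
  rw [Matrix.coe_units_inv]

theorem exists_coe_eq {A : Fin n → Fin n → ℝ} (hA : A ∈ invertibleSet n) :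
    ∃ g : GL (Fin n) ℝ, A = fun i j => g i j :=
  ⟨Matrix.GeneralLinearGroup.mkOfDetNeZero (Matrix.of A) hA, rfl⟩

theorem mapsTo_twistArray : MapsTo (twistArray (n := n)) (invertibleSet n) (invertibleSet n) := by
  intro A hA
  obtain ⟨g, rfl⟩ := exists_coe_eq hA
  rw [twistArray_coe]
  exact det_ne_zero' (twist g)

theorem zeroExt_twist (f : GL (Fin n) ℝ → ℂ) {A : Fin n → Fin n → ℝ} (hA : A ∈ invertibleSet n) :
    zeroExt (fun g => f (twist g)) A = zeroExt f (twistArray A) := by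
  obtain ⟨g, rfl⟩ := exists_coe_eq hA
  rw [twistArray_coe, zeroExt_coe, zeroExt_coe]

end Twist

/-! ### Transfer from `G / P` to `G / P̃` -/

section Transfer

variable {k N : ℕ} {ε : ZMod 2} {μ : ℂ}

/-- Pull-back of sections by the contragredient automorphism, as a linear map. -/
def toWtLin : SmoothSection (P k) (chi k ε μ) →ₗ[ℂ] SmoothSection (Pt k) (chit k ε μ) where
  toFun f := ⟨fun g => f (twist g), by
    refine ContDiffOn.congr (f := fun A => zeroExt f (twistArray A)) ?_
      fun A hA => zeroExt_twist f hA
    exact ContDiffOn.comp f.smooth contDiffOn_twistArray mapsTo_twistArray, fun g q hq => by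
      change f (twist (g * q)) = _
      rw [twist_mul, f.equivariant _ (twist_mem_P hq), ← twist_inv,
        chi_twist ((Pt k).inv_mem hq)]⟩
  map_add' _ _ := rfl
  map_smul' _ _ := rfl

/-- By linearity continuity at zero suffices, and there `exists_seminorm_pullback` with constant
weight one bounds each jet on each compact set. -/
theorem continuous_toWtLin :
    Continuous (toWtLin : SmoothSection (P k) (chi k ε μ) →ₗ[ℂ] SmoothSection (Pt k) (chit k ε μ)) := by
  refine continuous_induced_rng.2 (continuous_pi fun m => ?_)
  let J : SmoothSection (P k) (chi k ε μ) →ₗ[ℂ] C(invertibleSet (k + 1),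
      (Fin (k + 1) → Fin (k + 1) → ℝ) [×m]→L[ℝ] ℂ) :=
    (LinearMap.proj m).comp ((SmoothSection.jets (Pt k) (chit k ε μ)).comp toWtLin)
  change Continuous J
  refine continuous_of_continuousAt_zero J ?_
  rw [ContinuousAt, map_zero, ContinuousMap.tendsto_iff_forall_isCompact_tendstoUniformlyOn]
  intro K hK
  obtain ⟨q, hq, h⟩ := exists_seminorm_pullback (Q := P k) (χ := chi k ε μ)
    (isOpen_invertibleSet (k + 1)) contDiffOn_twistArray mapsTo_twistArray
    (contDiffOn_const (c := (1 : ℂ))) (hK.image continuous_subtype_val)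
    (by rintro _ ⟨x, _, rfl⟩; exact x.2) m
  rw [Metric.tendstoUniformlyOn_iff]
  intro δ hδ
  have h0 : ∀ᶠ f in 𝓝 (0 : SmoothSection (P k) (chi k ε μ)), q f < δ := by
    have := hq.tendsto (0 : SmoothSection (P k) (chi k ε μ))
    rw [map_zero] at this
    exact this.eventually (gt_mem_nhds hδ)
  filter_upwards [h0] with f hf x hx
  rw [ContinuousMap.zero_apply, dist_zero_left]
  refine lt_of_le_of_lt (le_trans (le_of_eq ?_) (h f x.1 ⟨x, hx, rfl⟩)) hf
  change ‖iteratedFDeriv ℝ m (zeroExt (toWtLin f)) x.1‖ = _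
  congr 1
  refine Filter.EventuallyEq.eq_of_nhds (Filter.EventuallyEq.iteratedFDeriv ℝ ?_ m)
  filter_upwards [(isOpen_invertibleSet (k + 1)).mem_nhds x.2] with A hA
  rw [one_mul]
  exact zeroExt_twist f hA

/-- Pull-back of sections by the contragredient automorphism. -/
def toWt : SmoothSection (P k) (chi k ε μ) →L[ℂ] SmoothSection (Pt k) (chit k ε μ) :=
  ⟨toWtLin, continuous_toWtLin⟩

theorem toWt_apply (f : SmoothSection (P k) (chi k ε μ)) (g : GL (Fin (k + 1)) ℝ) :
    toWt f g = f (twist g) := rfl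

theorem toWt_translate_wLong (f : SmoothSection (P k) (chi k ε μ)) :
    toWt (SmoothSection.translate (wLong (k + 1))⁻¹ f) =
      SmoothSection.translate (wLong (k + 1))⁻¹ (toWt f) := by
  refine DFunLike.ext _ _ fun g => ?_
  change f ((wLong (k + 1))⁻¹⁻¹ * twist g) = f (twist ((wLong (k + 1))⁻¹⁻¹ * g))
  rw [inv_inv, twist_mul, twist_wLong]

theorem IsCellExtension.unique {n : ℕ} {Q : Subgroup (GL (Fin n) ℝ)} {χ : GL (Fin n) ℝ → ℂ}
    {u : (Fin k → ℝ) → GL (Fin n) ℝ} {φ : Test k} {f f' : SmoothSection Q χ}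
    (h : IsCellExtension u φ f) (h' : IsCellExtension u φ f') : f = f' := by
  refine DFunLike.ext _ _ fun g => ?_
  by_cases hg : ∃ x, (u x)⁻¹ * g ∈ Q
  · obtain ⟨x, hx⟩ := hg
    have h1 : g = u x * ((u x)⁻¹ * g) := by rw [mul_inv_cancel_left]
    rw [h1, f.equivariant _ hx, f'.equivariant _ hx, h.1, h'.1]
  · push Not at hg
    rw [h.2 g hg, h'.2 g hg]

theorem IsCellExtension.toWt {φ : Test k} {f : SmoothSection (P k) (chi k ε μ)}
    (h : IsCellExtension (fun x => rowUnipotent (-x)) φ f) :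
    IsCellExtension colUnipotent φ (toWt f) := by
  refine ⟨fun x => ?_, fun g hg => ?_⟩
  · rw [toWt_apply, twist_colUnipotent]
    exact h.1 x
  · rw [toWt_apply]
    refine h.2 _ fun x hx => hg x ?_
    have hx' : (rowUnipotent (-x))⁻¹ * twist g ∈ P k := hx
    have h1 := twist_mem_Pt hx'
    rwa [twist_mul, twist_twist, twist_inv, ← twist_colUnipotent, twist_twist] at h1

theorem toWt_cellExtension_neg (φ : Test k) :
    toWt (cellExtension (fun x => rowUnipotent (-x)) φ : SmoothSection (P k) (chi k ε μ)) =
      cellExtension colUnipotent φ :=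
  (cellExtension_spec (exists_rowExtension_neg φ ε μ)).toWt.unique
    (cellExtension_spec (exists_colExtension φ ε μ))

/-- The contragredient sends the chart `r(u)` to `c(-u)`, hence the reflection, which the chart
`r(-u)` does not need. -/
theorem toWt_cellExtension (φ : Test k) :
    toWt (cellExtension rowUnipotent φ : SmoothSection (P k) (chi k ε μ)) =
      cellExtension colUnipotent (reflect φ) := by
  have h := cellExtension_spec (exists_rowExtension φ ε μ)
  have h1 : IsCellExtension (fun x => rowUnipotent (-x)) (reflect φ)
      (cellExtension rowUnipotent φ : SmoothSection (P k) (chi k ε μ)) :=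
    ⟨fun x => h.1 (-x), fun g hg => h.2 g fun x => by simpa using hg (-x)⟩
  exact h1.toWt.unique (cellExtension_spec (exists_colExtension _ ε μ))

/-- The pull-back of distribution sections. -/
def pullback {ν : ℂ} (T : Wtdist k ε ν) : Wdist k ε ν := T.comp toWt

theorem restrict_pullback {ν : ℂ} (T : Wtdist k ε ν) (φ : Test k) :
    restrict (fun x => rowUnipotent (-x)) (pullback T) φ = restrict colUnipotent T φ := by
  change T (toWt _) = T _
  rw [toWt_cellExtension_neg]

theorem restrict_ell_pullback {ν : ℂ} (T : Wtdist k ε ν) (φ : Test k) :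
    restrict rowUnipotent (ell (wLong (k + 1)) (pullback T)) φ =
      restrict colUnipotent (ell (wLong (k + 1)) T) (reflect φ) := by
  change T (toWt (SmoothSection.translate _ _)) = T (SmoothSection.translate _ _)
  rw [toWt_translate_wLong, toWt_cellExtension]

theorem isFlat_toWt {h : (ν : ℂ) → W k ε (-ν)} (hh : IsFlat h) :
    IsFlat fun ν => (toWt (h ν) : Wt k ε (-ν)) := fun ν ν' _ hg => hh ν ν' _ (twist_orthogonal hg)

theorem reflect_reflect (φ : Test k) : reflect (reflect φ) = φ := by
  refine DFunLike.ext _ _ fun x => ?_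
  change φ (- -x) = φ x
  rw [neg_neg]

/-! ### Comparison of the two series -/

theorem twist_mem_Gammat0 {γ : GL (Fin (k + 1)) ℤ} (h : γ ∈ Gamma0 k N) : twist γ ∈ Gammat0 k N := by
  change Matrix.GeneralLinearGroup.map _ (twist γ) ∈ colSubgroup (ZMod N) 0
  rw [← twist_map]
  refine twist_mem_colSubgroup ?_
  rw [Fin.rev_zero]
  exact h

theorem twist_mem_Gamma0 {γ : GL (Fin (k + 1)) ℤ} (h : γ ∈ Gammat0 k N) : twist γ ∈ Gamma0 k N := by
  change Matrix.GeneralLinearGroup.map _ (twist γ) ∈ rowSubgroup (ZMod N) (Fin.last k)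
  rw [← twist_map]
  refine twist_mem_rowSubgroup ?_
  rw [Fin.rev_last]
  exact h

/-- The contragredient as an isomorphism `Γ₀(N) ≃ Γ̃₀(N)`. -/
def twistGamma (k N : ℕ) : Gamma0 k N ≃* Gammat0 k N where
  toFun γ := ⟨twist γ.1, twist_mem_Gammat0 γ.2⟩
  invFun γ := ⟨twist γ.1, twist_mem_Gamma0 γ.2⟩
  left_inv _ := Subtype.ext (twist_twist _)
  right_inv _ := Subtype.ext (twist_twist _)
  map_mul' _ _ := Subtype.ext (twist_mul _ _)

theorem twistGamma_mem {γ : Gamma0 k N} : twistGamma k N γ ∈ GammatInf k N ↔ γ ∈ GammaInf k N := by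
  have h1 : γ ∈ GammaInf k N ↔ (wLong (k + 1))⁻¹ * intToReal (k + 1) γ.1 * wLong (k + 1) ∈ P k := by
    rw [GammaInf, Subgroup.mem_comap]
    simp
  have h2 : twistGamma k N γ ∈ GammatInf k N ↔
      (wLong (k + 1))⁻¹ * intToReal (k + 1) (twist γ.1) * wLong (k + 1) ∈ Pt k := by
    rw [GammatInf, Subgroup.mem_comap]
    simp [twistGamma]
  have h3 : (wLong (k + 1))⁻¹ * intToReal (k + 1) (twist γ.1) * wLong (k + 1) =
      twist ((wLong (k + 1))⁻¹ * intToReal (k + 1) γ.1 * wLong (k + 1)) := by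
    rw [twist_mul, twist_mul, twist_inv, twist_wLong, intToReal, twist_map]
  rw [h1, h2, h3]
  refine ⟨fun h => ?_, twist_mem_Pt⟩
  have := twist_mem_P h
  rwa [twist_twist] at this

/-- The induced bijection of cosets. -/
def twistCoset (k N : ℕ) : Gamma0 k N ⧸ GammaInf k N ≃ Gammat0 k N ⧸ GammatInf k N :=
  Quotient.congr (twistGamma k N).toEquiv fun γ δ => by
    rw [QuotientGroup.leftRel_apply, QuotientGroup.leftRel_apply, ← twistGamma_mem, map_mul, map_inv]
    rfl

theorem twistCoset_mk (γ : Gamma0 k N) :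
    twistCoset k N (QuotientGroup.mk γ) = QuotientGroup.mk (twistGamma k N γ) := rfl

variable [NeZero N] (ψ : DirichletCharacter ℂ N)

/-- The upper left entry of the contragredient is the lower right entry of `γ⁻¹`. Modulo `N` the
last row of `γ⁻¹` is diagonal, so this entry is inverse to that of `γ`, which accounts for the
inverse in the definition of `alpha`. -/
theorem alphat_twistGamma (γ : Gamma0 k N) : alphat ψ (twistGamma k N γ) = alpha ψ γ := by
  have h1 : (((γ.1⁻¹ (Fin.last k) (Fin.last k) : ℤ) : ZMod N)) *
      ((γ.1 (Fin.last k) (Fin.last k) : ℤ) : ZMod N) = 1 := by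
    have h2 : ((γ.1⁻¹.1 * γ.1.1) (Fin.last k) (Fin.last k) : ℤ) = 1 := by
      rw [Units.inv_mul, Matrix.one_apply_eq]
    rw [Matrix.mul_apply] at h2
    have h3 := congrArg (Int.cast : ℤ → ZMod N) h2
    rw [Int.cast_sum, Finset.sum_eq_single (Fin.last k), Int.cast_mul, Int.cast_one] at h3
    · exact h3
    · intro l _ hl
      have h4 : ((γ.1⁻¹ (Fin.last k) l : ℤ) : ZMod N) = 0 := ((Gamma0 k N).inv_mem γ.2) l hl
      rw [Int.cast_mul]
      exact mul_eq_zero_of_left h4 _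
    · simp
  have h5 := congrArg ψ h1
  rw [map_mul, map_one] at h5
  change ψ ((γ.1⁻¹ (Fin.rev 0) (Fin.rev 0) : ℤ) : ZMod N) = _
  rw [Fin.rev_zero, alpha]
  exact eq_inv_of_mul_eq_one_left h5

variable {ψ} in
-- The chosen representatives of corresponding cosets need not correspond under the contragredient,
-- so independence of the representative is needed; the parity condition provides it.
theorem eisensteintTerm_mk (hε : ψ (-1) = (-1) ^ ε.val) (ν : ℂ) (γ : Gammat0 k N)
    (h : Wt k ε (-ν)) : eisensteintTerm k N ψ ε ν (QuotientGroup.mk γ) h =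
      alphat ψ γ * lift h fun i => (firstCol γ.1 i : ℝ) := by
  set c : Gammat0 k N ⧸ GammatInf k N := QuotientGroup.mk γ with hc
  obtain ⟨a, ha, hout⟩ := exists_firstCol_out γ
  have haa : a * a = 1 := by rcases ha with rfl | rfl <;> rfl
  have h1 := coef_mul_lift_smul hε h γ 1 ⟨a, a, haa, haa⟩
  have h2 := coef_mul_lift_smul hε h c.out 1 1
  simp only [PNat.one_coe, Nat.cast_one, one_mul, Units.val_one, one_smul, map_one,
    Complex.one_cpow] at h1 h2
  rw [← hc] at hout
  rw [eisensteintTerm_apply, ← h2, ← h1, hout]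

variable {ψ} in
theorem eisensteinTerm_eq (hε : ψ (-1) = (-1) ^ ε.val) (ν : ℂ) (c : Gamma0 k N ⧸ GammaInf k N) :
    eisensteinTerm k N ψ ε ν c = pullback (eisensteintTerm k N ψ ε ν (twistCoset k N c)) := by
  ext f
  change alpha ψ c.out * f ((intToReal (k + 1) c.out.1)⁻¹⁻¹ * ((wLong (k + 1))⁻¹⁻¹ * 1)) =
    eisensteintTerm k N ψ ε ν (twistCoset k N c) (toWt f)
  have h1 : twistCoset k N c = QuotientGroup.mk (twistGamma k N c.out) := by
    conv_lhs => rw [← QuotientGroup.out_eq' c]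
    exact twistCoset_mk c.out
  rw [h1, eisensteintTerm_mk hε, alphat_twistGamma, ← evalAt_mul_wLong, toWt_apply, twist_mul,
    twist_wLong]
  change _ = _ * f (twist (intToReal (k + 1) (twist c.out.1)) * _)
  rw [intToReal, twist_map, twist_twist, inv_inv, inv_inv, mul_one]

variable {ψ} in
theorem hasSum_eisensteinTerm (hε : ψ (-1) = (-1) ^ ε.val) {ν : ℂ}
    (hν : ((k : ℝ) + 1) / 2 < ν.re) :
    HasSum (eisensteinTerm k N ψ ε ν) (pullback (∑' c, eisensteintTerm k N ψ ε ν c)) := by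
  have h1 := (twistCoset k N).hasSum_iff.2 (summable_eisensteintTerm (k := k) (ε := ε) ψ hν).hasSum
  let L : (Wt k ε (-ν) →L[ℂ] ℂ) →L[ℂ] (W k ε (-ν) →L[ℂ] ℂ) :=
    ContinuousLinearMap.precomp ℂ toWt
  have h2 := h1.map L L.continuous
  refine h2.congr_fun fun c => ?_
  exact eisensteinTerm_eq hε ν c

variable {ψ} in
theorem eisenstein_eq_pullback (hε : ψ (-1) = (-1) ^ ε.val) {ν : ℂ}
    (hν : ((k : ℝ) + 1) / 2 < ν.re) :
    eisenstein k N ψ ε ν = pullback (eisensteint k N ψ ε ν) := by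
  rw [eisenstein, (hasSum_eisensteinTerm hε hν).tsum_eq]
  rfl

variable {ψ} in
-- Changing the sign of the first `n - 1` entries preserves the divisibility conditions and the last
-- entry, and reflects the point at which the test function is evaluated.
theorem restrict_ell_reflect [NeZero k] (hε : ψ (-1) = (-1) ^ ε.val) {ν : ℂ}
    (hν : ((k : ℝ) + 1) / 2 < ν.re) (φ : Test k) :
    restrict colUnipotent (ell (wLong (k + 1)) (eisensteint k N ψ ε ν)) (reflect φ) =
      restrict colUnipotent (ell (wLong (k + 1)) (eisensteint k N ψ ε ν)) φ := by
  refine (hasSum_cell_translate hε hν (reflect φ)).unique ?_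
  let ι : (Fin (k + 1) → ℤ) → Fin (k + 1) → ℤ := fun v i =>
    if i = Fin.last k then v i else -v i
  have hι : ∀ v, ι (ι v) = v := fun v => funext fun i => by
    simp only [ι]; split_ifs <;> simp
  have hlast : ∀ v, ι v (Fin.last k) = v (Fin.last k) := fun v => by simp [ι]
  have hcast : ∀ v (i : Fin k), ι v i.castSucc = -v i.castSucc := fun v i => by
    simp [ι, Fin.castSucc_ne_last]
  let e : {v : Fin (k + 1) → ℤ // 0 < v (Fin.last k) ∧ ∀ i : Fin k, (N : ℤ) ∣ v i.castSucc} ≃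
      {v : Fin (k + 1) → ℤ // 0 < v (Fin.last k) ∧ ∀ i : Fin k, (N : ℤ) ∣ v i.castSucc} :=
    { toFun := fun v => ⟨ι v.1, by rw [hlast]; exact v.2.1, fun i => by
        rw [hcast, dvd_neg]; exact v.2.2 i⟩
      invFun := fun v => ⟨ι v.1, by rw [hlast]; exact v.2.1, fun i => by
        rw [hcast, dvd_neg]; exact v.2.2 i⟩
      left_inv := fun v => Subtype.ext (hι v.1)
      right_inv := fun v => Subtype.ext (hι v.1) }
  refine (e.hasSum_iff.2 (hasSum_cell_translate hε hν φ)).congr_fun fun v => ?_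
  simp only [Function.comp, e, Equiv.coe_fn_mk, hlast, hcast]
  congr 1
  change φ (-fun i : Fin k => (v.1 i.castSucc : ℝ) / (v.1 (Fin.last k) : ℝ)) = _
  congr 1
  funext i
  simp [neg_div]

end Transfer

end MirabolicEisenstein

end

theorem proposition3p1 (k N : ℕ) [NeZero k] [NeZero N] (ψ : DirichletCharacter ℂ N) (ε : ZMod 2)
    (hε : ψ (-1) = (-1) ^ ε.val) :
    (∀ ν : ℂ, ((k : ℝ) + 1) / 2 < ν.re →
      -- the defining series converge in the strong distribution topology
      Summable (eisensteinTerm k N ψ ε ν) ∧ Summable (eisensteintTerm k N ψ ε ν) ∧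
      -- restriction to `U` and to `Ũ`
      (∀ φ : Test k,
        restrict (fun x => rowUnipotent (-x)) (eisenstein k N ψ ε ν) φ =
          restrict colUnipotent (eisensteint k N ψ ε ν) φ ∧
        HasSum
          (fun v : {v : Fin (k + 1) → ℤ // 0 < v 0 ∧ ∀ i : Fin k, (N : ℤ) ∣ v i.castSucc} =>
            ψ ((v.1 (Fin.last k) : ℤ) : ZMod N) * ((v.1 0 : ℤ) : ℂ) ^ (-ν - rhoMir k) *
              φ (fun i => (v.1 i.castSucc.rev : ℝ) / (v.1 0 : ℝ)))
          (restrict colUnipotent (eisensteint k N ψ ε ν) φ) ∧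
        HasSum
          (fun v : {v : Fin (k + 1) → ℤ // 0 < v 0} =>
            (N : ℂ) ^ (-ν - rhoMir k) * (((v.1 0 : ℤ) : ℂ) ^ (-ν - rhoMir k + 1) *
              (∫ t : ℝ, eFun ((v.1 0 : ℂ) * (v.1 (Fin.last k) : ℂ) * t) *
                φ (Function.update (fun i => (v.1 i.castSucc.rev : ℝ) / (v.1 0 : ℝ)) 0 t)) *
              psiHat ψ (-v.1 (Fin.last k))))
          (restrict colUnipotent (eisensteint k N ψ ε ν) φ) ∧
        HasSum
          (fun r : Fin k → ℤ => aCoeff ψ ν r *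
            ∫ x : Fin k → ℝ, eFun (∑ i, (r i : ℂ) * (x i : ℂ)) * φ x)
          (restrict colUnipotent (eisensteint k N ψ ε ν) φ)) ∧
      -- restriction of the `w_long`-translates
      (∀ φ : Test k,
        restrict rowUnipotent (ell (wLong (k + 1)) (eisenstein k N ψ ε ν)) φ =
          restrict colUnipotent (ell (wLong (k + 1)) (eisensteint k N ψ ε ν)) φ ∧
        HasSum
          (fun v : {v : Fin (k + 1) → ℤ //
              0 < v (Fin.last k) ∧ ∀ i : Fin k, (N : ℤ) ∣ v i.castSucc} =>
            ψ ((v.1 (Fin.last k) : ℤ) : ZMod N) *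
              ((v.1 (Fin.last k) : ℤ) : ℂ) ^ (-ν - rhoMir k) *
              φ (fun i => (v.1 i.castSucc : ℝ) / (v.1 (Fin.last k) : ℝ)))
          (restrict colUnipotent (ell (wLong (k + 1)) (eisensteint k N ψ ε ν)) φ) ∧
        HasSum
          (fun r : Fin k → ℤ => cCoeff ψ ν r *
            ∫ x : Fin k → ℝ, eFun ((∑ i, (r i : ℂ) * (x i : ℂ)) / N) * φ x)
          (restrict colUnipotent (ell (wLong (k + 1)) (eisensteint k N ψ ε ν)) φ))) ∧
    -- analytic continuation
    ∃ (F : (ν : ℂ) → Wdist k ε ν) (Ft : (ν : ℂ) → Wtdist k ε ν),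
      (∀ ν : ℂ, ((k : ℝ) + 1) / 2 < ν.re →
        F ν = eisenstein k N ψ ε ν ∧ Ft ν = eisensteint k N ψ ε ν) ∧
      (∀ S : Set ℂ, (S = {rhoMir k}ᶜ ∨ (ψ ≠ 1 ∧ S = Set.univ)) →
        IsHolomorphicFamily S F ∧ IsHolomorphicFamily S Ft ∧
        IsHolomorphicOnCell S (fun x : Fin k → ℝ => rowUnipotent (-x)) F ∧
        IsHolomorphicOnCell S (colUnipotent (k := k)) Ft ∧
        IsHolomorphicOnCell S (rowUnipotent (k := k)) (fun ν => ell (wLong (k + 1)) (F ν)) ∧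
        IsHolomorphicOnCell S (colUnipotent (k := k)) (fun ν => ell (wLong (k + 1)) (Ft ν))) ∧
      (ψ = 1 → ∃ (R : Wdist k ε (rhoMir k)) (Rt : Wtdist k ε (rhoMir k)),
        HasSimplePole (rhoMir k) F R ∧ HasSimplePole (rhoMir k) Ft Rt ∧
        HasSimplePoleOnCell (rhoMir k) (fun x : Fin k → ℝ => rowUnipotent (-x)) F R ∧
        HasSimplePoleOnCell (rhoMir k) (colUnipotent (k := k)) Ft Rt ∧
        HasSimplePoleOnCell (rhoMir k) (rowUnipotent (k := k))
          (fun ν => ell (wLong (k + 1)) (F ν)) (ell (wLong (k + 1)) R) ∧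
        HasSimplePoleOnCell (rhoMir k) (colUnipotent (k := k))
          (fun ν => ell (wLong (k + 1)) (Ft ν)) (ell (wLong (k + 1)) Rt)) := by
  refine ⟨fun ν hν => ⟨(hasSum_eisensteinTerm hε hν).summable, summable_eisensteintTerm ψ hν,
    fun φ => ⟨?_, hasSum_cell hε hν φ, hasSum_cell_fourier_first hε hν φ,
      hasSum_cell_fourier hε hν φ⟩,
    fun φ => ⟨?_, hasSum_cell_translate hε hν φ, hasSum_cell_translate_fourier hε hν φ⟩⟩, ?_⟩
  · rw [eisenstein_eq_pullback hε hν, restrict_pullback]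
  · rw [eisenstein_eq_pullback hε hν, restrict_ell_pullback, restrict_ell_reflect hε hν]
  -- The continuation of Ẽ is the explicit functional `continuedDist`, and that of `E` is its
  -- transfer by the contragredient.
  refine ⟨fun ν => pullback (continuedDist ψ ε ν), continuedDist ψ ε, fun ν hν => ⟨?_, ?_⟩,
    fun S hS => ⟨fun h hh => ?_, isHolomorphicFamily_continuedDist ψ hS, fun φ => ?_,
      isHolomorphicOnCell_continuedDist ψ hS, fun φ => ?_,
      isHolomorphicOnCell_ell_continuedDist ψ hS⟩, ?_⟩
  · rw [eisenstein_eq_pullback hε hν, eisensteint_eq_continuedDist hε hν]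
  · rw [eisensteint_eq_continuedDist hε hν]
  · exact isHolomorphicFamily_continuedDist ψ hS _ (isFlat_toWt hh)
  · simp only [restrict_pullback]
    exact isHolomorphicOnCell_continuedDist ψ hS φ
  · simp only [restrict_ell_pullback]
    exact isHolomorphicOnCell_ell_continuedDist ψ hS (reflect φ)
  rintro rfl
  -- The trivial character is even; the positivity argument for the residue needs `ε = 0`.
  obtain rfl := parity_eq_zero hε
  refine ⟨pullback (residueDist 1 0 (rhoMir k)), residueDist 1 0 (rhoMir k),
    ⟨fun h0 => ?_, fun h hh => tendsto_continuedDist 1 _ (isFlat_toWt hh)⟩,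
    ⟨fun h0 => ?_, tendsto_continuedDist 1⟩,
    ⟨⟨bumpTest k, ?_⟩, fun φ => ?_⟩,
    ⟨⟨bumpTest k, restrict_residueDist_ne_zero⟩, tendsto_restrict_continuedDist 1⟩,
    ⟨⟨reflect (bumpTest k), ?_⟩, fun φ => ?_⟩,
    ⟨⟨bumpTest k, restrict_ell_residueDist_ne_zero⟩, tendsto_restrict_ell_continuedDist 1⟩⟩
  · refine restrict_residueDist_ne_zero (k := k) (N := N) ?_
    rw [← restrict_pullback, h0]
    rfl
  · refine restrict_residueDist_ne_zero (k := k) (N := N) ?_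
    rw [h0]
    rfl
  · rw [restrict_pullback]
    exact restrict_residueDist_ne_zero
  · simp only [restrict_pullback]
    exact tendsto_restrict_continuedDist 1 φ
  -- The witness was the reflected bump, so the reflection caused by the row chart cancels.
  · rw [restrict_ell_pullback, reflect_reflect]
    exact restrict_ell_residueDist_ne_zero
  · simp only [restrict_ell_pullback]
    exact tendsto_restrict_ell_continuedDist 1 (reflect φ)
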